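/- **Setting.** Consider a two-dimensional crystal with reciprocal lattice $\Lambda^*$ (units $\hbar=c=1$) with two valleys $\alpha=\pm$ and spin. The spinless Bloch Hamiltonians $\tilde h_\alpha(k)$, $k\in\mathbb R^2$, are self-adjoint operators on the orbital space $\mathcal H_\alpha$ of the valley (spin enters as $\tilde h_\alpha\otimes s_0$), satisfy $S_{\alpha,G}^\dagger\tilde h_\alpha(k+G)S_{\alpha,G}=\tilde h_\alpha(k)$ with a unitary representation $S_\alpha$ of $\Lambda^*$, and commute with the spinless $C_{2z}\mathcal T$, an antiunitary of square one that commutes with the $S_{\alpha,G}$. Each valley has an isolated set of two bands, with orthonormal frame $|u_{\alpha,k}\rangle=(|u_{\alpha,k,1}\rangle,|u_{\alpha,k,2}\rangle)$ in any gauge with $|u_{\alpha,k+G}\rangle=S_{\alpha,G}|u_{\alpha,k}\rangle$, invariant under $C_{2z}\mathcal T$, with smooth projector $P_\alpha(k)=|u_{\alpha,k}\rangle\langle u_{\alpha,k}|$. Write $|u^{C_{2z}\mathcal T}\rangle=C_{2z}\mathcal T|u\rangle$, let $W_\alpha(k_0,k)=\lim_{L\to\infty}\langle u_{\alpha,k_0}|P_\alpha(k_1)\cdots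 P_\alpha(k_L)|u_{\alpha,k}\rangle$ be the Wilson line along the segment from $k_0$ to $k$, and put $$\eta_{\alpha}(k)=\sqrt{\det\langle u^{C_{2z}\mathcal T}_{\alpha,k_0}|u_{\alpha,k_0}\rangle}\,\det W_\alpha(k_0,k),\quad Q_{\alpha,k_0}(k)=\tfrac{\eta_\alpha^*(k)}{\sqrt2}|u_{\alpha,k}\rangle(-i\tau_y)\langle u^{C_{2z}\mathcal T}_{\alpha,k}|,$$ $$\mathcal N_{\alpha,k_0}=\tfrac1{2\pi}\int_{\rm BZ}d^2k\,\tfrac1{\sqrt2}\mathrm{Tr}\big[Q_{\alpha,k_0}(\partial_{k_x}P_\alpha\partial_{k_y}P_\alpha-\partial_{k_y}P_\alpha\partial_{k_x}P_\alpha)\big],\quad \mathcal N_\alpha=|\mathcal N_{\alpha,k_0}|,\quad Q_\alpha=\tfrac{\mathcal N_{\alpha,k_0}}{\mathcal N_\alpha}Q_{\alpha,k_0},$$ with arbitrary base points $k_0$ (one for each valley). Assume that the bands are orientable (for each basis vector $b_j$ of $\Lambda^*$ and each valley there is a $k$ with $\det W_\alpha(k,k+b_j)=1$) and that the Euler numbers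 $\mathcal N_\pm$ are non-zero. **Pairing.** Let $\sum_k c^\dagger_{+,k}\,\Delta(k)\otimes\Pi\,(c^\dagger_{-,-k})^T+h.c.$ be a $C_{2z}\mathcal T$-invariant pairing (the spin part of $C_{2z}\mathcal T$ being $i s_y$) in which $\Delta(k)$ is a $2\times2$ matrix periodic under $\Lambda^*$, $\sum_{a,a'}\Delta_{aa'}(k)|u_{+,k,a}\rangle|u_{-,-k,a'}\rangle$ is smooth, and $\Pi$ is a constant spin matrix with $s_y\Pi^*s_y=\Pi$, $\Pi^\dagger\Pi=s_0$. With $P_\Delta(k)=|u_{+,k}\rangle\Delta(k)\langle u^{C_{2z}\mathcal T}_{-,-k}|$, the channels $\Delta_\perp,\Delta_\parallel$ are defined by $$\tfrac12P_\Delta(k)\mp Q_+(k)P_\Delta(k)Q_-(-k)=|u_{+,k}\rangle\Delta_{\perp/\parallel}(k)\langle u^{C_{2z}\mathcal T}_{-,-k}|$$ (upper sign for $\perp$), and $|\Delta_b|=\sqrt{\tfrac12\mathrm{Tr}[\Delta_b\Delta_b^\dagger]}$. **Superfluid weight.** Let $V_\alpha(k):\mathbb C^2\to\mathcal H_\alpha$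 be the isometry with columns $|u_{\alpha,k,a}\rangle$, $V(k)$ the direct sum over the valleys of $V_\pm(k)\otimes s_0$, $h(k)$ the direct sum of $V_\pm^\dagger\tilde h_\pm V_\pm\otimes s_0$, and $\Delta_{\rm full}(k)$ the gap matrix with off-diagonal valley blocks $\Delta(k)\otimes\Pi$ (upper right) and $-\Delta(-k)^T\otimes\Pi^T$ (lower left). For a constant vector field $A$ and chemical potential $\mu$ let $E_{k,m}(A)$ be the eigenvalues of $$\begin{pmatrix}h(k+A)-\mu&D(k,A)\\D(k,A)^\dagger&-[h(-k+A)-\mu]^T\end{pmatrix},\qquad D(k,A)=V^\dagger(k+A)V(k)\Delta_{\rm full}(k)V^T(-k)V^*(-k+A).$$ The zero-temperature mean-field free energy per area is $\Omega_0(A)=\int_{\rm BZ}\frac{d^2k}{(2\pi)^2}\{-\frac14\sum_m|E_{k,m}(A)|+\frac12\mathrm{Tr}[h(k+A)-\mu]\}$, and the superfluid weight is $[D_{SF}]_{ij}=e^2\,\partial_{A_i}\partial_{A_j}\Omega_0(A)|_{A=0}$. **Theorem.** Suppose moreover that the bands are exactly flat with zero energy ($V_\pm^\dagger\tilde h_\pm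 V_\pm=0$ for all $k$), that $\mu\ne0$, and that the normal state has $C_{2z}$ symmetry (a $k$-independent unitary $\mathcal H_+\to\mathcal H_-$ taking the Hamiltonian and the two bands of valley $+$ at $k$ to those of valley $-$ at $-k$, commuting with $C_{2z}\mathcal T$ and satisfying $C_{2z}S_{+,G}=S_{-,-G}C_{2z}$). Let $g_{ij}=\frac12\mathrm{Tr}[\partial_{k_i}P_+\partial_{k_j}P_+]$ be the Fubini–Study metric and $\langle x\rangle_g=\int_{\rm BZ}x\,\mathrm{Tr}g\,d^2k\,/\int_{\rm BZ}\mathrm{Tr}g\,d^2k$. Then $\Omega_0$ is twice continuously differentiable, $\int_{\rm BZ}\mathrm{Tr}\,g\,d^2k>0$, the average below exists, and $$\mathrm{Tr}\,D_{SF}\ \ge\ \frac{4e^2}{\pi}\,\mathcal N_+\left\langle\frac{(|\Delta_\perp|-|\Delta_\parallel|)^2}{\sqrt{(|\Delta_\perp|-|\Delta_\parallel|)^2+\mu^2}}\right\rangle_g .$$ If in addition the pairing is the time-reversal-invariant uniform s-wave pairing of amplitude $\Delta_0$, that is, each flat-band state of valley $+$ is paired with its time-reversal partner with constant amplitude ($\Delta_{aa'}(k)=\Delta_0\langle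 u_{-,-k,a'}|\mathcal T u_{+,k,a}\rangle$, where $\mathcal T=C_{2z}\cdot C_{2z}\mathcal T$ is spinless), then $|\Delta_\perp(k)|=|\Delta_0|$ and $|\Delta_\parallel(k)|=0$ for all $k$, and the right-hand side equals $2\sqrt{\nu(1-\nu)}\,|\Delta_0|\cdot\frac{4e^2}{\pi}\mathcal N_+$, so that $$\mathrm{Tr}\,D_{SF}\ \ge\ 2\sqrt{\nu(1-\nu)}\,|\Delta_0|\,\frac{4e^2}{\pi}\,\mathcal N_+ .$$ Here $\nu\in[0,1]$ is the filling ratio of the flat bands: the particle number $-\partial\Omega_0(0)/\partial\mu$ per area divided by the number $8|{\rm BZ}|/(2\pi)^2$ of flat-band states per area. -/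

import Mathlib

open MeasureTheory Filter Topology Matrix
open scoped ContDiff Kronecker TensorProduct ComplexConjugate

noncomputable section

namespace FlatSC

/-- Two-dimensional momentum space (also the space of constant vector fields `A`). -/
abbrev Plane : Type := EuclideanSpace ℝ (Fin 2)

/-- The reciprocal lattice spanned by the basis vectors `b 0`, `b 1`. -/
abbrev recip (b : Module.Basis (Fin 2) ℝ Plane) : Submodule ℤ Plane :=
  Submodule.span ℤ (Set.range b)

/-- A fundamental cell of the reciprocal lattice. Every integrand below is periodic, so that
integrals over it are integrals over the first Brillouin zone. -/
abbrev cell (b : Module.Basis (Fin 2) ℝ Plane) : Set Plane :=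
  ZSpan.fundamentalDomain b

section Operators

variable {H : Type*} [NormedAddCommGroup H] [InnerProductSpace ℂ H] [CompleteSpace H]

/-- The trace `∑ᵢ ⟪eᵢ, T eᵢ⟫` over an orthonormal (Hilbert) basis of `H`. It is applied only to
operators of finite rank, for which it does not depend on the basis. -/
def opTrace (T : H →L[ℂ] H) : ℂ :=
  ∑' v : (exists_hilbertBasis ℂ H).choose, inner ℂ (v : H) (T (v : H))

/-- `|x⟩⟨y|`. -/
abbrev ketbra {E F : Type*} [NormedAddCommGroup E] [InnerProductSpace ℂ E]
    [NormedAddCommGroup F] [InnerProductSpace ℂ F] (x : E) (y : F) : F →L[ℂ] E :=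
  InnerProductSpace.rankOne ℂ x y

/-- The partial derivative `∂_{k_i}` of an operator-valued function. -/
def pderivOp (i : Fin 2) (f : Plane → H →L[ℂ] H) (k : Plane) : H →L[ℂ] H :=
  fderiv ℝ f k (EuclideanSpace.single i 1)

end Operators

/-- The spinless part of the normal state of one valley, with its isolated set of two (spin doubly
degenerate) bands. `H` is the space spanned by the orbitals `i` of the valley (the coefficient
space of the Bloch basis `ψ†_{k,i}`, extended to all `k ∈ ℝ²`). -/
structure Valley (b : Module.Basis (Fin 2) ℝ Plane) (H : Type*) [NormedAddCommGroup H]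
    [InnerProductSpace ℂ H] [CompleteSpace H] where
  /-- the Bloch Hamiltonian (possibly unbounded) -/
  ham : Plane → H →ₗ.[ℂ] H
  ham_selfAdjoint : ∀ k, IsSelfAdjoint (ham k)
  /-- the embedding matrices: `e^{-iG·r}` acts on the orbitals as `S G` -/
  S : recip b → H ≃ₗᵢ[ℂ] H
  S_add : ∀ G G' x, S (G + G') x = S G (S G' x)
  ham_periodic : ∀ (k : Plane) (G : recip b) (x y : H),
    (x, y) ∈ (ham k).graph → (S G x, S G y) ∈ (ham (k + (G : Plane))).graph
  /-- the spinless `C₂z𝒯`: an antiunitary with square one, acting at every fixed `k` -/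
  C2T : H →ₛₗᵢ[starRingEnd ℂ] H
  C2T_sq : ∀ x, C2T (C2T x) = x
  C2T_S : ∀ G x, C2T (S G x) = S G (C2T x)
  ham_C2T : ∀ (k : Plane) (x y : H),
    (x, y) ∈ (ham k).graph → (C2T x, C2T y) ∈ (ham k).graph
  /-- the periodic parts `|u_{k,a}⟩` of the Bloch states of the two bands, in an arbitrary gauge
  (not required to be continuous) -/
  u : Plane → Fin 2 → H
  u_orthonormal : ∀ k, Orthonormal ℂ (u k)
  u_periodic : ∀ (k : Plane) (G : recip b) (a : Fin 2), u (k + (G : Plane)) a = S G (u k a)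
  u_C2T : ∀ k a, C2T (u k a) ∈ Submodule.span ℂ (Set.range (u k))
  /-- the projected Hamiltonian `V† ham V` -/
  h : Plane → Matrix (Fin 2) (Fin 2) ℂ
  ham_u : ∀ k a, (u k a, ∑ c, h k c a • u k c) ∈ (ham k).graph
  /-- the two bands are isolated: at each `k`, the energies of the two bands lie in the resolvent
  set of the restriction of the Hamiltonian to the orthogonal complement of the two bands -/
  isolated : ∀ (k : Plane) (E : ℝ) (w : Fin 2 → ℂ), w ≠ 0 → h k *ᵥ w = (E : ℂ) • w →
    ∃ δ > 0, ∀ x y : H, (x, y) ∈ (ham k).graph → (∀ a, inner ℂ (u k a) x = 0) →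
      δ * ‖x‖ ≤ ‖y - (E : ℂ) • x‖
  /-- the projector on the two bands is a smooth function of `k` -/
  smooth : ContDiff ℝ ∞ (fun k => ∑ a, ketbra (u k a) (u k a))

namespace Valley

variable {b : Module.Basis (Fin 2) ℝ Plane} {H : Type*} [NormedAddCommGroup H]
  [InnerProductSpace ℂ H] [CompleteSpace H] (N : Valley b H)

/-- The projector `P(k) = |u_k⟩⟨u_k|` on the two bands. -/
def P (k : Plane) : H →L[ℂ] H := ∑ a, ketbra (N.u k a) (N.u k a)

/-- The sewing matrix `U(k)` of `C₂z𝒯`: `C₂z𝒯 |u_k⟩ = |u_k⟩ U(k)`. -/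
def sew (k : Plane) : Matrix (Fin 2) (Fin 2) ℂ :=
  Matrix.of fun a c => inner ℂ (N.u k a) (N.C2T (N.u k c))

/-- The overlap matrix `V†(k') V(k)`. -/
def overlap (k' k : Plane) : Matrix (Fin 2) (Fin 2) ℂ :=
  Matrix.of fun a c => inner ℂ (N.u k' a) (N.u k c)

/-- `⟨u_{k₀}| P(k₁) ⋯ P(k_L) |u_k⟩` for `k₁, …, k_L` equally spaced on the segment from `k₀`
to `k`. -/
def wilsonApprox (k₀ k : Plane) (L : ℕ) : Matrix (Fin 2) (Fin 2) ℂ :=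
  Matrix.of fun a c => inner ℂ (N.u k₀ a)
    (((List.range L).map fun j : ℕ =>
      N.P (k₀ + (((j : ℝ) + 1) / ((L : ℝ) + 1)) • (k - k₀))).prod (N.u k c))

/-- The Wilson line matrix along the segment from `k₀` to `k`. -/
def wilson (k₀ k : Plane) : Matrix (Fin 2) (Fin 2) ℂ :=
  limUnder atTop (N.wilsonApprox k₀ k)

/-- The bands are orientable: along each of the two basis vectors of the reciprocal lattice there
is an effectively closed straight path whose Wilson line has determinant one. -/
def Orientable : Prop := ∀ j : Fin 2, ∃ k : Plane, (N.wilson k (k + b j)).det = 1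

/-- `η_{k₀}(k) = √det⟨u^{C₂z𝒯}_{k₀}|u_{k₀}⟩ · det W(k₀, k)`, with the principal branch of the
square root. -/
def eta (k₀ k : Plane) : ℂ :=
  (Matrix.det (Matrix.of fun a c => inner ℂ (N.C2T (N.u k₀ a)) (N.u k₀ c))) ^ (1 / 2 : ℂ)
    * (N.wilson k₀ k).det

/-- `Q_{k₀}(k) = (η*_{k₀}(k)/√2) |u_k⟩(-iτ_y)⟨u_k^{C₂z𝒯}|`. -/
def Q₀ (k₀ k : Plane) : H →L[ℂ] H :=
  (conj (N.eta k₀ k) / (Real.sqrt 2 : ℂ)) •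
    ∑ a, ∑ c, (!![0, -1; 1, 0] : Matrix (Fin 2) (Fin 2) ℂ) a c •
      ketbra (N.u k a) (N.C2T (N.u k c))

/-- `Φ_{k₀}(k) = (1/√2) Tr[Q_{k₀} ∂ₓP ∂_yP] - (x ↔ y)`. -/
def Phi₀ (k₀ k : Plane) : ℂ :=
  (1 / (Real.sqrt 2 : ℂ)) *
    (opTrace (N.Q₀ k₀ k * pderivOp 0 N.P k * pderivOp 1 N.P k)
      - opTrace (N.Q₀ k₀ k * pderivOp 1 N.P k * pderivOp 0 N.P k))

/-- `𝒩_{k₀} = (1/2π) ∫ d²k Φ_{k₀}(k)`, an integer up to its type. -/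
def eulerAt (k₀ : Plane) : ℂ :=
  (1 / (2 * Real.pi : ℂ)) * ∫ k in cell b, N.Phi₀ k₀ k

/-- The Euler number `𝒩 = |𝒩_{k₀}|`, computed with the base point `k₀`. -/
def eulerNumber (k₀ : Plane) : ℝ := ‖N.eulerAt k₀‖

/-- `Q(k) = (𝒩_{k₀}/𝒩) Q_{k₀}(k)`. -/
def Q (k₀ k : Plane) : H →L[ℂ] H :=
  (N.eulerAt k₀ / (N.eulerNumber k₀ : ℂ)) • N.Q₀ k₀ k

/-- The Fubini–Study metric `g_{ij}(k) = ½ Tr[∂_i P ∂_j P]`. -/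
def metric (k : Plane) : Matrix (Fin 2) (Fin 2) ℝ :=
  Matrix.of fun i j => (1 / 2) * (opTrace (pderivOp i N.P k * pderivOp j N.P k)).re

/-- The average `⟨x⟩_g` over the Brillouin zone with the weight `Tr g`. -/
def average (x : Plane → ℝ) : ℝ :=
  (∫ k in cell b, x k * (N.metric k).trace) / ∫ k in cell b, (N.metric k).trace

/-- The two bands are exactly flat with zero energy. -/
def Flat : Prop := ∀ k, N.h k = 0

end Valley

section TwoValleys

variable {b : Module.Basis (Fin 2) ℝ Plane}
  {Hp Hm : Type*} [NormedAddCommGroup Hp] [InnerProductSpace ℂ Hp] [CompleteSpace Hp]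
  [NormedAddCommGroup Hm] [InnerProductSpace ℂ Hm] [CompleteSpace Hm]

/-- The (spinless part of the) `C₂z` symmetry of the normal state: it maps valley `+` at `k` to
valley `-` at `-k`. -/
structure C2zSymmetry (Np : Valley b Hp) (Nm : Valley b Hm) where
  /-- the action on the orbitals -/
  C : Hp ≃ₗᵢ[ℂ] Hm
  C_S : ∀ G x, C (Np.S G x) = Nm.S (-G) (C x)
  C_C2T : ∀ x, C (Np.C2T x) = Nm.C2T (C x)
  C_ham : ∀ (k : Plane) (x y : Hp),
    (x, y) ∈ (Np.ham k).graph ↔ (C x, C y) ∈ (Nm.ham (-k)).graph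
  /-- the action on the bands, `C₂z c†_{+,k} C₂z⁻¹ = c†_{-,-k} U(k)` -/
  U : Plane → Matrix.unitaryGroup (Fin 2) ℂ
  C_u : ∀ k a, C (Np.u k a) = ∑ c, (U k : Matrix (Fin 2) (Fin 2) ℂ) c a • Nm.u (-k) c

/-- The Pauli matrix `s_y`. -/
def sy : Matrix (Fin 2) (Fin 2) ℂ := !![0, -Complex.I; Complex.I, 0]

/-- The intervalley pairing `∑_k c†_{+,k} (Δ(k) ⊗ Π) (c†_{-,-k})ᵀ + h.c.`, invariant under `C₂z𝒯`
(whose spin part is `i s_y`). -/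
structure Pairing (Np : Valley b Hp) (Nm : Valley b Hm) where
  /-- the spinless part -/
  Δ : Plane → Matrix (Fin 2) (Fin 2) ℂ
  /-- the spin part -/
  Pi : Matrix (Fin 2) (Fin 2) ℂ
  Pi_real : sy * Pi.map conj * sy = Pi
  Pi_unitary : Piᴴ * Pi = 1
  periodic : ∀ (k : Plane) (G : recip b), Δ (k + (G : Plane)) = Δ k
  /-- `C₂z𝒯` commutes with the pairing operator -/
  C2T_inv : ∀ k, (Np.sew k ⊗ₖ (Complex.I • sy)) * (Δ k ⊗ₖ Pi).map conj
    * (Nm.sew (-k) ⊗ₖ (Complex.I • sy))ᵀ = Δ k ⊗ₖ Pi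
  /-- `∑ Δ(k)_{aa'} |u_{+,k,a}⟩|u_{-,-k,a'}⟩` is smooth -/
  smooth : ContDiff ℝ ∞ (fun k => ∑ a, ∑ c, Δ k a c • (Np.u k a ⊗ₜ[ℂ] Nm.u (-k) c))

/-- The two pairing channels. -/
inductive Channel
  | perp
  | par

/-- `(-1)^⊥ = 1`, `(-1)^∥ = -1`. -/
def Channel.sign : Channel → ℂ
  | .perp => 1
  | .par => -1

/-- Indices of the flat bands: (valley `+`: band, spin) or (valley `-`: band, spin). -/
abbrev Ix : Type := (Fin 2 × Fin 2) ⊕ (Fin 2 × Fin 2)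

/-- `V†(k') V(k)`, for both valleys and including spin. -/
def overlapFull (Np : Valley b Hp) (Nm : Valley b Hm) (k' k : Plane) : Matrix Ix Ix ℂ :=
  Matrix.fromBlocks (Np.overlap k' k ⊗ₖ (1 : Matrix (Fin 2) (Fin 2) ℂ)) 0 0
    (Nm.overlap k' k ⊗ₖ (1 : Matrix (Fin 2) (Fin 2) ℂ))

/-- The projected normal-state Hamiltonian `h(k)`, for both valleys and including spin. -/
def hFull (Np : Valley b Hp) (Nm : Valley b Hm) (k : Plane) : Matrix Ix Ix ℂ :=
  Matrix.fromBlocks (Np.h k ⊗ₖ (1 : Matrix (Fin 2) (Fin 2) ℂ)) 0 0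
    (Nm.h k ⊗ₖ (1 : Matrix (Fin 2) (Fin 2) ℂ))

namespace Pairing

variable {Np : Valley b Hp} {Nm : Valley b Hm} (D : Pairing Np Nm)

/-- `P_Δ(k) = |u_{+,k}⟩ Δ(k) ⟨u^{C₂z𝒯}_{-,-k}|`. -/
def PΔ (k : Plane) : Hm →L[ℂ] Hp :=
  ∑ a, ∑ c, D.Δ k a c • ketbra (Np.u k a) (Nm.C2T (Nm.u (-k) c))

/-- `P_b(k) = ½ P_Δ(k) - (-1)^b Q_+(k) P_Δ(k) Q_-(-k)`, where `Q_±` is computed with the base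
point `kp`, respectively `km`. -/
def Pch (kp km : Plane) (ch : Channel) (k : Plane) : Hm →L[ℂ] Hp :=
  (1 / 2 : ℂ) • D.PΔ k - ch.sign • (Np.Q kp k ∘L D.PΔ k ∘L Nm.Q km (-k))

/-- `Δ_b(k)`, given by `P_b(k) = |u_{+,k}⟩ Δ_b(k) ⟨u^{C₂z𝒯}_{-,-k}|`. -/
def Δch (kp km : Plane) (ch : Channel) (k : Plane) : Matrix (Fin 2) (Fin 2) ℂ :=
  Matrix.of fun a c => inner ℂ (Np.u k a) (D.Pch kp km ch k (Nm.C2T (Nm.u (-k) c)))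

/-- `|Δ_b(k)| = √(½ Tr[Δ_b(k) Δ_b(k)†])`. -/
def absΔ (kp km : Plane) (ch : Channel) (k : Plane) : ℝ :=
  Real.sqrt ((1 / 2) * (Matrix.trace (D.Δch kp km ch k * (D.Δch kp km ch k)ᴴ)).re)

/-- The gap matrix of the flat bands without vector field. -/
def gap (k : Plane) : Matrix Ix Ix ℂ :=
  Matrix.fromBlocks 0 (D.Δ k ⊗ₖ D.Pi) (-((D.Δ (-k))ᵀ ⊗ₖ D.Piᵀ)) 0

/-- The projected gap matrix in a constant vector field,
`D(k, A) = V†(k+A) V(k) gap(k) Vᵀ(-k) V*(-k+A)`. -/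
def gapA (A k : Plane) : Matrix Ix Ix ℂ :=
  overlapFull Np Nm (k + A) k * D.gap k * (overlapFull Np Nm (-k + A) (-k))ᵀ

/-- The Bogoliubov–de Gennes matrix at momentum `k`, in the vector field `A`. -/
def bdg (μ : ℝ) (A k : Plane) : Matrix (Ix ⊕ Ix) (Ix ⊕ Ix) ℂ :=
  Matrix.fromBlocks (hFull Np Nm (k + A) - (μ : ℂ) • 1) (D.gapA A k) (D.gapA A k)ᴴ
    (-(hFull Np Nm (-k + A) - (μ : ℂ) • 1)ᵀ)

/-- The mean-field zero-temperature free energy per area,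
`∫ d²k/(2π)² { -¼ ∑_m |E_{k,m}(A)| + ½ Tr[h(k+A) - μ] }`, where `E_{k,m}(A)` are the eigenvalues
of the Bogoliubov–de Gennes matrix with multiplicity. -/
def freeEnergy (μ : ℝ) (A : Plane) : ℝ :=
  (1 / (2 * Real.pi) ^ 2) * ∫ k in cell b,
    (-(1 / 4) * ((D.bdg μ A k).charpoly.roots.map (fun E => ‖E‖)).sum
      + (1 / 2) * (Matrix.trace (hFull Np Nm (k + A) - (μ : ℂ) • (1 : Matrix Ix Ix ℂ))).re)

/-- The zero-temperature superfluid weight `[D_SF]_{ij} = e² ∂²Ω/∂A_i∂A_j` at `A = 0`, with `Ω`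
the free energy per area. -/
def superfluidWeight (e μ : ℝ) : Matrix (Fin 2) (Fin 2) ℝ :=
  Matrix.of fun i j => e ^ 2 *
    fderiv ℝ (fun A => fderiv ℝ (D.freeEnergy μ) A (EuclideanSpace.single j 1)) 0
      (EuclideanSpace.single i 1)

/-- The filling ratio of the flat bands: the particle number `-∂Ω/∂μ` per area, divided by the
number of flat-band states (eight for each `k`) per area. -/
def filling (μ : ℝ) : ℝ :=
  -deriv (fun μ' => D.freeEnergy μ' 0) μ
    / (8 * (volume (cell b)).toReal / (2 * Real.pi) ^ 2)

/-- The quantity averaged in the lower bound,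
`(|Δ_⊥| - |Δ_∥|)² / √((|Δ_⊥| - |Δ_∥|)² + μ²)`. -/
def boundDensity (kp km : Plane) (μ : ℝ) (k : Plane) : ℝ :=
  (D.absΔ kp km .perp k - D.absΔ kp km .par k) ^ 2 /
    Real.sqrt ((D.absΔ kp km .perp k - D.absΔ kp km .par k) ^ 2 + μ ^ 2)

/-- The time-reversal-invariant uniform s-wave pairing of amplitude `Δ₀`: each flat-band state of
valley `+` is paired with its time-reversal partner (the spinless `𝒯` is `C₂z · C₂z𝒯`) with the
momentum-independent amplitude `Δ₀`. -/
def IsUniformSWave (σ : C2zSymmetry Np Nm) (Δ₀ : ℂ) : Prop :=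
  ∀ k a c, D.Δ k a c = Δ₀ * inner ℂ (Nm.u (-k) c) (σ.C (Np.C2T (Np.u k a)))

end Pairing

end TwoValleys

end FlatSC

end

/-! For flat bands the Bogoliubov–de Gennes matrix has diagonal blocks `∓μ`, so its eigenvalues are
`±√(μ² + y)` with `y` running over the eigenvalues of `D D†`. Since `Π` is unitary, spin only
contributes multiplicity, and the free energy becomes the integral of `√(μ² + y₁) + √(μ² + y₂)` with
`y₁ ≤ y₂` the squared singular values of one 2×2 intervalley block (`rootSum_bdg`, `freeEnergy_eq`).
This sum is a function of the trace and determinant of the squared block, smooth because `μ ≠ 0`.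

C₂z carries valley `-` at `-k + A` to valley `+` at `k - A`. The trace and determinant are therefore
those of `G(A) τ G(-A) τ†`, where `G(A) = ⟨u_k|P(k+A)|u_k⟩` and `τ τ† = Δ Δ†`
(`block_mul_conjTranspose`). Differentiating `P² = P` twice shows that `G` has no first-order term
and second derivative `-2Y`, with `Y` the Gram matrix of the vectors `∂P|u⟩`; the traces of `Y` over
the two directions add up to `Tr g`. As `Y ≥ 0` and both `ττ†` and `τ†τ` are at least `y₁`, the
second derivative of the pair energy is at most `-2 y₁/√(y₁ + μ²) · Tr Y`
(`exists_hasJet_pairEnergy`). Integration gives `Tr D_SF ≥ (e²/π²) ∫ y₁/√(y₁ + μ²) Tr g`.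

Two facts turn this into the stated bound. First, the Euler curvature satisfies `|Φ| ≤ ½ Tr g`
pointwise, hence `∫ Tr g ≥ 4π𝒩` (`norm_Phi₀_le`, `eulerNumber_le`). Second, C₂z𝒯 invariance turns `Q
P_Δ Q` into a rotated complex conjugate of `Δ`; the channel amplitudes are then half the sum and
half the difference of the singular values, so `(|Δ_⊥| - |Δ_∥|)² = y₁` (`absΔ_sub_sq`).

The gauge may be discontinuous, so smoothness is available only for gauge-invariant traces and
determinants (`contDiff_trace_mat`). The field `Q` is handled through parallel transport: it is
continuous and its square is fixed by the sewing matrix, so any two versions of it differ by one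
global sign (`eq_or_eq_neg_of_continuous`). Normalizing by the sign of the Euler integral removes
that sign, and this is what decides that uniform s-wave pairing lies in the `⊥` channel
(`channelPhase_eq`, `absΔ_eq_norm`). -/

namespace FlatSC

/-! ### Products of nearby projectors along a path, and their limits -/

section Chain

variable {R : Type*}

/-- The product `x 0 * x 1 * ⋯ * x n`. -/
def chain [Mul R] (x : ℕ → R) : ℕ → R
  | 0 => x 0
  | n + 1 => chain x n * x (n + 1)

theorem chain_eq_list_prod [Monoid R] (x : ℕ → R) (n : ℕ) :
    chain x (n + 1) = x 0 * ((List.range n).map fun j => x (j + 1)).prod * x (n + 1) := by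
  have key : ∀ n, chain x n = x 0 * ((List.range n).map fun j => x (j + 1)).prod := by
    intro n
    induction n with
    | zero => simp [chain]
    | succ n ih => simp [chain, List.range_succ, ih, mul_assoc]
  rw [chain, key]

variable [NormedRing R]

theorem chain_mul_last {x : ℕ → R} (hx : ∀ j, x j * x j = x j) (n : ℕ) :
    chain x n * x n = chain x n := by
  cases n with
  | zero => exact hx 0
  | succ n => rw [chain, mul_assoc, hx]

theorem first_mul_chain {x : ℕ → R} (hx : ∀ j, x j * x j = x j) (n : ℕ) :
    x 0 * chain x n = chain x n := by
  induction n with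
  | zero => exact hx 0
  | succ n ih => rw [chain, ← mul_assoc, ih]

theorem norm_chain_le {x : ℕ → R} (h1 : ∀ j, ‖x j‖ ≤ 1) (n : ℕ) : ‖chain x n‖ ≤ 1 := by
  induction n with
  | zero => exact h1 0
  | succ n ih =>
    exact (norm_mul_le _ _).trans (mul_le_one₀ ih (norm_nonneg _) (h1 _))

theorem chain_add {x : ℕ → R} (hx : ∀ j, x j * x j = x j) (n m : ℕ) :
    chain x (n + m) = chain x n * chain (fun j => x (n + j)) m := by
  induction m with
  | zero => simp [chain, chain_mul_last hx]
  | succ m ih => rw [← add_assoc, chain, ih, chain, mul_assoc, add_assoc]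

/-- The identity `pqr - pr = (p-q)q(r-q) - (p-q)(r-q)` makes the error second order in the
distances. Errors of this order, summed over a fine partition, tend to zero. -/
theorem norm_drop_middle_le {p q r : R} (hq : q * q = q) (h1 : ‖q‖ ≤ 1)
    {c d : ℝ} (hc : ‖p - q‖ ≤ c) (hd : ‖r - q‖ ≤ d) :
    ‖p * q * r - p * r‖ ≤ c * d + c * d := by
  have e : p * q * r - p * r = (p - q) * q * (r - q) - (p - q) * (r - q) := by
    simp only [sub_mul, mul_sub, mul_assoc, hq]
    abel
  have h0 : 0 ≤ c := (norm_nonneg _).trans hc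
  rw [e]
  refine (norm_sub_le _ _).trans (add_le_add ?_ ?_)
  · refine (norm_mul_le _ _).trans (mul_le_mul ?_ hd (norm_nonneg _) h0)
    refine (norm_mul_le _ _).trans ?_
    nlinarith [norm_nonneg (p - q), norm_nonneg q]
  · exact (norm_mul_le _ _).trans (mul_le_mul hc hd (norm_nonneg _) h0)

/-- A chain of close idempotents may be replaced by its end points. -/
theorem norm_chain_sub_ends_le {x : ℕ → R} (hx : ∀ j, x j * x j = x j) (h1 : ∀ j, ‖x j‖ ≤ 1)
    {c : ℝ} {m : ℕ} (hd : ∀ i ≤ m, ∀ j ≤ m, ‖x i - x j‖ ≤ c * |(i : ℝ) - j|) :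
    ‖chain x m - x 0 * x m‖ ≤ 2 * c ^ 2 * (m : ℝ) ^ 2 := by
  induction m with
  | zero => simp [chain, hx]
  | succ m ih =>
    have ih' := ih fun i hi j hj => hd i (hi.trans m.le_succ) j (hj.trans m.le_succ)
    have e : chain x (m + 1) - x 0 * x (m + 1)
        = (chain x m - x 0 * x m) * x (m + 1) + (x 0 * x m * x (m + 1) - x 0 * x (m + 1)) := by
      rw [chain, sub_mul]; abel
    have a1 := hd 0 (Nat.zero_le _) m m.le_succ
    have a2 := hd (m + 1) le_rfl m m.le_succ
    have a3 := norm_drop_middle_le (hx m) (h1 m) a1 a2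
    rw [e]
    refine (norm_add_le _ _).trans ?_
    have a4 : ‖(chain x m - x 0 * x m) * x (m + 1)‖ ≤ 2 * c ^ 2 * (m : ℝ) ^ 2 := by
      refine (norm_mul_le _ _).trans ?_
      calc _ ≤ ‖chain x m - x 0 * x m‖ * 1 := by gcongr; exact h1 _
        _ ≤ _ := by rw [mul_one]; exact ih'
    refine (add_le_add a4 a3).trans ?_
    have b1 : |((0 : ℕ) : ℝ) - m| = m := by simp
    have b2 : |((m + 1 : ℕ) : ℝ) - m| = 1 := by simp
    rw [b1, b2]
    push_cast
    nlinarith [mul_nonneg (sq_nonneg c) (Nat.cast_nonneg (α := ℝ) m), sq_nonneg c]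

/-- Passing to a refinement of the partition changes a chain of close idempotents little. -/
theorem norm_chain_refine_le {x : ℕ → R} (hx : ∀ j, x j * x j = x j) (h1 : ∀ j, ‖x j‖ ≤ 1)
    {c : ℝ} (n m : ℕ)
    (hd : ∀ i ≤ n * m, ∀ j ≤ n * m, ‖x i - x j‖ ≤ c * |(i : ℝ) - j|) :
    ‖chain x (n * m) - chain (fun j => x (j * m)) n‖ ≤ n * (2 * c ^ 2 * (m : ℝ) ^ 2) := by
  induction n with
  | zero => simp [chain]
  | succ n ih =>
    have le1 : n * m ≤ (n + 1) * m := Nat.mul_le_mul_right _ n.le_succ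
    have ih' := ih fun i hi j hj => hd i (hi.trans le1) j (hj.trans le1)
    have e0 : (n + 1) * m = n * m + m := by ring
    have a1 : ‖chain (fun j => x (n * m + j)) m - x (n * m) * x (n * m + m)‖
        ≤ 2 * c ^ 2 * (m : ℝ) ^ 2 := by
      refine norm_chain_sub_ends_le (x := fun j => x (n * m + j)) (fun _ => hx _) (fun _ => h1 _)
        fun i hi j hj => ?_
      have := hd (n * m + i) (by omega) (n * m + j) (by omega)
      push_cast at this
      simpa using this
    have e : chain x ((n + 1) * m) - chain (fun j => x (j * m)) (n + 1)
        = chain x (n * m) * (chain (fun j => x (n * m + j)) m - x (n * m) * x (n * m + m))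
          + (chain x (n * m) - chain (fun j => x (j * m)) n) * x (n * m + m) := by
      rw [e0, chain_add hx, chain, mul_sub, ← mul_assoc, chain_mul_last hx, sub_mul, e0]; abel
    rw [e]
    refine (norm_add_le _ _).trans ?_
    have b1 := (norm_mul_le (chain x (n * m))
      (chain (fun j => x (n * m + j)) m - x (n * m) * x (n * m + m))).trans
      (mul_le_mul (norm_chain_le h1 _) a1 (norm_nonneg _) zero_le_one)
    have b2 := (norm_mul_le (chain x (n * m) - chain (fun j => x (j * m)) n) (x (n * m + m))).trans
      (mul_le_mul ih' (h1 _) (norm_nonneg _) (by positivity))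
    refine (add_le_add b1 b2).trans (le_of_eq ?_)
    push_cast; ring

/-- The product of the idempotents `p 0, p (1/n), …, p 1`. -/
noncomputable def pathChain (p : ℝ → R) (n : ℕ) : R := chain (fun j => p (j / n)) n

/-- Each of the `n` blocks has length `1/n` and is replaced by its end points at cost `2(c/n)²`,
whatever the number `m` of points in it; the total is `2c²/n`. -/
theorem norm_pathChain_refine_le {p : ℝ → R} (hp : ∀ s, p s * p s = p s) (h1 : ∀ s, ‖p s‖ ≤ 1)
    {c : ℝ}
    (hd : ∀ s ∈ Set.Icc (0 : ℝ) 1, ∀ t ∈ Set.Icc (0 : ℝ) 1, ‖p s - p t‖ ≤ c * |s - t|)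
    {n m : ℕ} (hn : 0 < n) (hm : 0 < m) :
    ‖pathChain p (n * m) - pathChain p n‖ ≤ 2 * c ^ 2 / n := by
  have hn' : (0 : ℝ) < n := Nat.cast_pos.2 hn
  have hm' : (0 : ℝ) < m := Nat.cast_pos.2 hm
  have := norm_chain_refine_le (x := fun j : ℕ => p (j / ((n * m : ℕ) : ℝ))) (fun _ => hp _)
    (fun _ => h1 _) (c := c / (n * m)) n m (by
      intro i hi j hj
      have key : ∀ i : ℕ, i ≤ n * m → ((i : ℝ) / ((n * m : ℕ) : ℝ)) ∈ Set.Icc (0 : ℝ) 1 := by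
        intro i hi
        refine ⟨by positivity, div_le_one_of_le₀ (by exact_mod_cast hi) (by positivity)⟩
      refine (hd _ (key i hi) _ (key j hj)).trans (le_of_eq ?_)
      rw [← sub_div, abs_div, abs_of_nonneg (a := ((n * m : ℕ) : ℝ)) (by positivity)]
      push_cast; field_simp)
  have e : (fun j : ℕ => p (((j * m : ℕ) : ℝ) / ((n * m : ℕ) : ℝ))) = fun j : ℕ => p (j / n) := by
    funext j; congr 1; push_cast; field_simp
  rw [pathChain, pathChain, ← e]
  refine this.trans (le_of_eq ?_)
  field_simp

theorem norm_pathChain_sub_le {p : ℝ → R} (hp : ∀ s, p s * p s = p s) (h1 : ∀ s, ‖p s‖ ≤ 1)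
    {c : ℝ}
    (hd : ∀ s ∈ Set.Icc (0 : ℝ) 1, ∀ t ∈ Set.Icc (0 : ℝ) 1, ‖p s - p t‖ ≤ c * |s - t|)
    {n m : ℕ} (hn : 0 < n) (hm : 0 < m) :
    ‖pathChain p m - pathChain p n‖ ≤ 2 * c ^ 2 / m + 2 * c ^ 2 / n := by
  have a := norm_pathChain_refine_le hp h1 hd hn hm
  have b := norm_pathChain_refine_le hp h1 hd hm hn
  rw [mul_comm m n] at b
  -- Both chains are compared with their common refinement into `n * m` steps.
  calc _ = ‖(pathChain p (n * m) - pathChain p n) - (pathChain p (n * m) - pathChain p m)‖ := by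
        congr 1; abel
    _ ≤ _ := (norm_sub_le _ _).trans (by linarith)

/-- The rate of convergence involves the path only through its Lipschitz constant; this uniformity
later gives continuity of parallel transport in its end point. -/
theorem exists_tendsto_pathChain [CompleteSpace R] {p : ℝ → R} (hp : ∀ s, p s * p s = p s)
    (h1 : ∀ s, ‖p s‖ ≤ 1) {c : ℝ}
    (hd : ∀ s ∈ Set.Icc (0 : ℝ) 1, ∀ t ∈ Set.Icc (0 : ℝ) 1, ‖p s - p t‖ ≤ c * |s - t|) :
    ∃ T : R, Tendsto (fun n => pathChain p (n + 1)) atTop (𝓝 T) ∧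
      ∀ n : ℕ, ‖pathChain p (n + 1) - T‖ ≤ 2 * c ^ 2 / (n + 1) := by
  have lim : ∀ a : ℝ, Tendsto (fun n : ℕ => a / ((n : ℝ) + 1)) atTop (𝓝 0) := fun a =>
    Tendsto.div_atTop tendsto_const_nhds
      (tendsto_atTop_add_const_right _ _ tendsto_natCast_atTop_atTop)
  have cau : CauchySeq fun n => pathChain p (n + 1) := by
    refine cauchySeq_of_le_tendsto_0' (fun n : ℕ => 2 * (2 * c ^ 2) / ((n : ℝ) + 1)) ?_ (lim _)
    intro n m hnm
    rw [dist_eq_norm]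
    refine (norm_pathChain_sub_le hp h1 hd m.succ_pos n.succ_pos).trans ?_
    have : 2 * c ^ 2 / ((m + 1 : ℕ) : ℝ) ≤ 2 * c ^ 2 / ((n + 1 : ℕ) : ℝ) := by gcongr
    push_cast at this ⊢
    have e : 2 * (2 * c ^ 2) / ((n : ℝ) + 1) = 2 * c ^ 2 / ((n : ℝ) + 1) + 2 * c ^ 2 / ((n : ℝ) + 1) := by
      ring
    rw [e]
    linarith
  obtain ⟨T, hT⟩ := cauchySeq_tendsto_of_complete cau
  refine ⟨T, hT, fun n => ?_⟩
  have l1 : Tendsto (fun m : ℕ => ‖pathChain p (n + 1) - pathChain p (m + 1)‖) atTop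
      (𝓝 ‖pathChain p (n + 1) - T‖) := (tendsto_const_nhds.sub hT).norm
  have l2 : Tendsto (fun m : ℕ => 2 * c ^ 2 / ((n : ℝ) + 1) + 2 * c ^ 2 / ((m : ℝ) + 1)) atTop
      (𝓝 (2 * c ^ 2 / ((n : ℝ) + 1) + 0)) := tendsto_const_nhds.add (lim _)
  rw [add_zero] at l2
  refine le_of_tendsto_of_tendsto' l1 l2 fun m => ?_
  have := norm_pathChain_sub_le hp h1 hd (n := m + 1) (m := n + 1) m.succ_pos n.succ_pos
  push_cast at this
  exact this

/-- Chains of self-adjoint idempotents are nearly partial isometries. -/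
theorem tendsto_pathChain_mul_star [StarRing R] [NormedStarGroup R] {p : ℝ → R}
    (hp : ∀ s, p s * p s = p s) (h1 : ∀ s, ‖p s‖ ≤ 1) (hs : ∀ s, star (p s) = p s)
    {c : ℝ}
    (hd : ∀ s ∈ Set.Icc (0 : ℝ) 1, ∀ t ∈ Set.Icc (0 : ℝ) 1, ‖p s - p t‖ ≤ c * |s - t|) :
    Tendsto (fun n => pathChain p (n + 1) * star (pathChain p (n + 1))) atTop (𝓝 (p 0)) := by
  -- The innermost factor of `chain * star chain` is removed at cost `2(c/(n+1))²`; after all `n +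
  -- 1` removals only `p 0` is left, with error of order `1/n`.
  have main : ∀ n : ℕ, ∀ j ≤ n + 1,
      ‖chain (fun j : ℕ => p (j / ((n : ℝ) + 1))) j
        * star (chain (fun j : ℕ => p (j / ((n : ℝ) + 1))) j) - p 0‖
        ≤ j * (2 * c ^ 2 / ((n : ℝ) + 1) ^ 2) := by
    intro n j hj
    set x : ℕ → R := fun j : ℕ => p (j / ((n : ℝ) + 1)) with hx
    have hxx : ∀ j, x j * x j = x j := fun _ => hp _
    have hx1 : ∀ j, ‖x j‖ ≤ 1 := fun _ => h1 _
    induction j with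
    | zero => simp [chain, hx, hs, hp]
    | succ j ih =>
      have ih := ih (by omega)
      have e : chain x (j + 1) * star (chain x (j + 1)) - p 0
          = chain x j * (x j * x (j + 1) * x j - x j * x j) * star (chain x j)
            + (chain x j * star (chain x j) - p 0) := by
        have s1 : star (chain x j) = x j * star (chain x j) := by
          conv_lhs => rw [← chain_mul_last hxx j, star_mul]
          simp only [hx, hs]
        have s2 : star (x (j + 1)) = x (j + 1) := hs _
        have A : chain x (j + 1) * star (chain x (j + 1))
            = chain x j * (x j * x (j + 1) * x j) * star (chain x j) := by
          have s3 : x j * star (chain x j) = star (chain x j) := s1.symm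
          have s4 : chain x j * (x j * (x (j + 1) * star (chain x j)))
              = chain x j * (x (j + 1) * star (chain x j)) := by
            rw [← mul_assoc, chain_mul_last hxx]
          rw [chain, star_mul, s2]
          simp only [mul_assoc]
          rw [s3, s4, ← mul_assoc (x (j + 1)) (x (j + 1)), hxx]
        have B : chain x j * (x j * x j) * star (chain x j) = chain x j * star (chain x j) := by
          rw [hxx, chain_mul_last hxx]
        rw [A, mul_sub, sub_mul, B]; abel
      have key : ∀ i : ℕ, i ≤ n + 1 → ((i : ℝ) / ((n : ℝ) + 1)) ∈ Set.Icc (0 : ℝ) 1 := fun i hi =>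
        ⟨by positivity, div_le_one_of_le₀ (by exact_mod_cast hi) (by positivity)⟩
      have d1 : ‖x j - x (j + 1)‖ ≤ c / ((n : ℝ) + 1) := by
        refine (hd _ (key j (by omega)) _ (key _ hj)).trans (le_of_eq ?_)
        rw [← sub_div, abs_div, abs_of_nonneg (a := ((n : ℝ) + 1)) (by positivity)]
        push_cast; simp [div_eq_mul_inv]
      have d2 := norm_drop_middle_le (hxx (j + 1)) (hx1 _) d1 d1
      rw [e]
      refine (norm_add_le _ _).trans ?_
      have d3 : ‖chain x j * (x j * x (j + 1) * x j - x j * x j) * star (chain x j)‖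
          ≤ 2 * c ^ 2 / ((n : ℝ) + 1) ^ 2 := by
        calc _ ≤ ‖chain x j‖ * ‖x j * x (j + 1) * x j - x j * x j‖ * ‖star (chain x j)‖ :=
              (norm_mul_le _ _).trans (mul_le_mul_of_nonneg_right (norm_mul_le _ _) (norm_nonneg _))
          _ ≤ 1 * (c / ((n : ℝ) + 1) * (c / ((n : ℝ) + 1)) + c / ((n : ℝ) + 1) * (c / ((n : ℝ) + 1)))
              * 1 := by
              rw [norm_star]
              have d4 := norm_chain_le hx1 j
              have d5 := (norm_nonneg _).trans d2
              gcongr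
          _ = _ := by field_simp; ring
      refine (add_le_add d3 ih).trans (le_of_eq ?_)
      push_cast; ring
  rw [tendsto_iff_norm_sub_tendsto_zero]
  have lim : Tendsto (fun n : ℕ => 2 * c ^ 2 / ((n : ℝ) + 1)) atTop (𝓝 0) :=
    Tendsto.div_atTop tendsto_const_nhds
      (tendsto_atTop_add_const_right _ _ tendsto_natCast_atTop_atTop)
  refine squeeze_zero (fun _ => norm_nonneg _) (fun n => ?_) lim
  have := main n (n + 1) le_rfl
  simp only [pathChain]
  push_cast at this ⊢
  refine this.trans (le_of_eq ?_)
  field_simp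

end Chain

end FlatSC

namespace FlatSC

/-! ### Second-order jets with vanishing first derivative -/

section Jet

variable {𝔸 : Type*} [NormedAddCommGroup 𝔸] [NormedSpace ℝ 𝔸]

/-- `f` is differentiable, with `f(0) = a`, `f'(0) = 0` and `f''(0) = c`. -/
def HasJet (f : ℝ → 𝔸) (a c : 𝔸) : Prop :=
  ∃ f' : ℝ → 𝔸, (∀ s, HasDerivAt f (f' s) s) ∧ f 0 = a ∧ f' 0 = 0 ∧ HasDerivAt f' c 0

namespace HasJet

theorem const (a : 𝔸) : HasJet (fun _ => a) a 0 :=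
  ⟨fun _ => 0, fun s => hasDerivAt_const s a, rfl, rfl, hasDerivAt_const 0 0⟩

theorem congr {f : ℝ → 𝔸} {a c a' c' : 𝔸} (h : HasJet f a c) (ha : a = a') (hc : c = c') :
    HasJet f a' c' := ha ▸ hc ▸ h

theorem add {f g : ℝ → 𝔸} {a c a' c' : 𝔸} (hf : HasJet f a c) (hg : HasJet g a' c') :
    HasJet (fun s => f s + g s) (a + a') (c + c') := by
  obtain ⟨f', h1, h2, h3, h4⟩ := hf
  obtain ⟨g', k1, k2, k3, k4⟩ := hg
  exact ⟨fun s => f' s + g' s, fun s => (h1 s).add (k1 s), by simp [h2, k2], by simp [h3, k3],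
    h4.add k4⟩

/-- The two signs from the chain rule cancel in the second derivative, so `P(k - s v)` will have the
same jet as `P(k + s v)`. -/
theorem comp_neg {f : ℝ → 𝔸} {a c : 𝔸} (hf : HasJet f a c) : HasJet (fun s => f (-s)) a c := by
  obtain ⟨f', h1, h2, h3, h4⟩ := hf
  refine ⟨fun s => -f' (-s), fun s => ?_, by simp [h2], by simp [h3], ?_⟩
  · simpa [Function.comp_def] using (h1 (-s)).scomp s (hasDerivAt_neg s)
  · have h4' : HasDerivAt f' c (-0 : ℝ) := by simpa using h4
    have := (h4'.scomp (0 : ℝ) (hasDerivAt_neg (0 : ℝ))).neg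
    simp only [neg_smul, one_smul, neg_neg] at this
    exact this

theorem clm_comp {𝔹 : Type*} [NormedAddCommGroup 𝔹] [NormedSpace ℝ 𝔹] (L : 𝔸 →L[ℝ] 𝔹)
    {f : ℝ → 𝔸} {a c : 𝔸} (hf : HasJet f a c) : HasJet (fun s => L (f s)) (L a) (L c) := by
  obtain ⟨f', h1, h2, h3, h4⟩ := hf
  exact ⟨fun s => L (f' s), fun s => L.hasFDerivAt.comp_hasDerivAt s (h1 s), by simp [h2],
    by simp [h3], L.hasFDerivAt.comp_hasDerivAt 0 h4⟩

theorem sum {ι : Type*} (t : Finset ι) {f : ι → ℝ → 𝔸} {a c : ι → 𝔸}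
    (h : ∀ i ∈ t, HasJet (f i) (a i) (c i)) :
    HasJet (fun s => ∑ i ∈ t, f i s) (∑ i ∈ t, a i) (∑ i ∈ t, c i) := by
  classical
  induction t using Finset.induction_on with
  | empty => simpa using const (0 : 𝔸)
  | insert i t hi ih =>
    simp only [Finset.sum_insert hi]
    exact (h i (Finset.mem_insert_self i t)).add
      (ih fun j hj => h j (Finset.mem_insert_of_mem hj))

/-- The cross term `2 f' g'` of the product rule is absent because both first derivatives vanish at
zero. -/
theorem mul {R : Type*} [NormedRing R] [NormedAlgebra ℝ R] {f g : ℝ → R} {a c a' c' : R}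
    (hf : HasJet f a c) (hg : HasJet g a' c') :
    HasJet (fun s => f s * g s) (a * a') (c * a' + a * c') := by
  obtain ⟨f', h1, h2, h3, h4⟩ := hf
  obtain ⟨g', k1, k2, k3, k4⟩ := hg
  refine ⟨fun s => f' s * g s + f s * g' s, fun s => (h1 s).mul (k1 s), by simp [h2, k2],
    by simp [h3, k3], ?_⟩
  have := (h4.mul (k1 0)).add ((h1 0).mul k4)
  simp only [h2, h3, k2, k3, mul_zero, add_zero, zero_add] at this
  exact this

theorem sqrt {f : ℝ → ℝ} {a c : ℝ} (hf : HasJet f a c) (h0 : ∀ s, 0 < f s) :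
    HasJet (fun s => Real.sqrt (f s)) (Real.sqrt a) (c / (2 * Real.sqrt a)) := by
  obtain ⟨f', h1, h2, h3, h4⟩ := hf
  have hs : ∀ s, HasDerivAt (fun s => Real.sqrt (f s)) (f' s / (2 * Real.sqrt (f s))) s :=
    fun s => (h1 s).sqrt (h0 s).ne'
  have hne : ∀ s, 2 * Real.sqrt (f s) ≠ 0 := fun s =>
    mul_ne_zero two_ne_zero (Real.sqrt_pos.2 (h0 s)).ne'
  refine ⟨fun s => f' s / (2 * Real.sqrt (f s)), hs, by simp [h2], by simp [h3], ?_⟩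
  have := h4.div ((hs 0).const_mul 2) (hne 0)
  have e : (c * (2 * Real.sqrt (f 0)) - f' 0 * (2 * (f' 0 / (2 * Real.sqrt (f 0)))))
      / (2 * Real.sqrt (f 0)) ^ 2 = c / (2 * Real.sqrt a) := by
    rw [h3, ← h2, zero_mul, sub_zero, pow_two]
    exact mul_div_mul_right _ _ (hne 0)
  rwa [e] at this

/-- The second directional derivative of a `C²` function is read off from the jet along the line. -/
theorem fderiv_fderiv {E : Type*} [NormedAddCommGroup E] [NormedSpace ℝ E] {f : E → ℝ}
    (hf : ContDiff ℝ 2 f) (v : E) {a c : ℝ} (h : HasJet (fun s : ℝ => f (s • v)) a c) :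
    fderiv ℝ (fun x => fderiv ℝ f x v) 0 v = c := by
  obtain ⟨f', h1, -, -, h4⟩ := h
  have hline : ∀ s : ℝ, HasDerivAt (fun s : ℝ => s • v) v s := fun s => by
    simpa using (hasDerivAt_id s).smul_const v
  have d1 : Differentiable ℝ f := hf.differentiable (by norm_num)
  have e : f' = fun s => fderiv ℝ f (s • v) v := by
    funext s
    exact (h1 s).unique ((d1 (s • v)).hasFDerivAt.comp_hasDerivAt s (hline s))
  have d2 : Differentiable ℝ (fun x => fderiv ℝ f x v) := by
    have : ContDiff ℝ 1 (fderiv ℝ f) := hf.fderiv_right (by norm_num)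
    exact (this.differentiable (by norm_num)).clm_apply (differentiable_const v)
  have d3 := (d2 ((0 : ℝ) • v)).hasFDerivAt.comp_hasDerivAt (0 : ℝ) (hline 0)
  rw [zero_smul] at d3
  rw [e] at h4
  exact d3.unique h4

end HasJet

end Jet

/-! ### Differentiation under an integral over a bounded set -/

section ParametricIntegral

variable {E F X : Type} [NormedAddCommGroup E] [NormedSpace ℝ E] [FiniteDimensional ℝ E]
  [NormedAddCommGroup F] [NormedSpace ℝ F] [CompleteSpace F]
  [NormedAddCommGroup X] [NormedSpace ℝ X] [FiniteDimensional ℝ X]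
  [MeasurableSpace X] [BorelSpace X]

theorem integrableOn_of_continuous_of_isBounded {μ : Measure X} [IsFiniteMeasureOnCompacts μ]
    {f : X → F} (hf : Continuous f) {K : Set X} (hK : Bornology.IsBounded K) :
    IntegrableOn f K μ := by
  have : ProperSpace X := FiniteDimensional.proper ℝ X
  exact (hf.continuousOn.integrableOn_compact hK.isCompact_closure).mono_set subset_closure

theorem hasFDerivAt_setIntegral {μ : Measure X} [IsFiniteMeasureOnCompacts μ]
    {f : E → X → F} (hf : ContDiff ℝ 1 (fun q : E × X => f q.1 q.2)) {K : Set X}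
    (hK : Bornology.IsBounded K) (hKm : MeasurableSet K) (x : E) :
    HasFDerivAt (fun x => ∫ k in K, f x k ∂μ) (∫ k in K, fderiv ℝ (fun y => f y k) x ∂μ) x := by
  have : ProperSpace X := FiniteDimensional.proper ℝ X
  have : ProperSpace E := FiniteDimensional.proper ℝ E
  have hf' : Continuous (fun q : E × X => fderiv ℝ (fun y => f y q.2) q.1) := by
    have : ContDiff ℝ 0 (fun q : E × X => fderiv ℝ (fun y => f y q.2) q.1) :=
      ContDiff.fderiv (f := fun (q : E × X) y => f y q.2) (g := fun q : E × X => q.1) (n := 0) (m := 1)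
        (hf.comp (contDiff_snd.prodMk (contDiff_snd.comp contDiff_fst))) contDiff_fst (by simp)
    exact this.continuous
  -- The dominating function is a constant: the bound of the continuous derivative on this compact
  -- set.
  have hc : IsCompact (Metric.closedBall x 1 ×ˢ closure K) :=
    (isCompact_closedBall x 1).prod hK.isCompact_closure
  obtain ⟨C, hC⟩ := hc.exists_bound_of_continuousOn hf'.continuousOn
  have hfin : μ K < ⊤ := hK.measure_lt_top
  refine hasFDerivAt_integral_of_dominated_of_fderiv_le (F := fun x k => f x k)
    (F' := fun x k => fderiv ℝ (fun y => f y k) x) (bound := fun _ => C)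
    (Metric.ball_mem_nhds x one_pos) ?_ ?_ ?_ ?_ ?_ ?_
  · refine Eventually.of_forall fun y => ?_
    exact (hf.continuous.comp (Continuous.prodMk_right y)).aestronglyMeasurable
  · exact integrableOn_of_continuous_of_isBounded
      (hf.continuous.comp (Continuous.prodMk_right x)) hK
  · exact (hf'.comp (Continuous.prodMk_right x)).aestronglyMeasurable
  · refine (ae_restrict_iff' hKm).2 (Eventually.of_forall fun k hk y hy => ?_)
    exact hC (y, k) ⟨Metric.ball_subset_closedBall hy, subset_closure hk⟩
  · exact integrableOn_const hfin.ne
  · refine Eventually.of_forall fun k y _ => ?_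
    have : Differentiable ℝ (fun y => f y k) :=
      (hf.comp (contDiff_id.prodMk contDiff_const)).differentiable (by norm_num)
    exact (this y).hasFDerivAt

theorem contDiff_fderiv_of_contDiff_prod {f : E → X → F}
    (hf : ContDiff ℝ ∞ (fun q : E × X => f q.1 q.2)) :
    ContDiff ℝ ∞ (fun q : E × X => fderiv ℝ (fun y => f y q.2) q.1) :=
  ContDiff.fderiv (f := fun (q : E × X) y => f y q.2) (g := fun q : E × X => q.1) (n := ∞)
    (hf.comp (contDiff_snd.prodMk (contDiff_snd.comp contDiff_fst))) contDiff_fst (by simp)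

/-- Induction on the order: the derivative is again a parametric integral, now with values in `E
→L[ℝ] F`, so the target space has to vary in the induction. -/
theorem contDiff_setIntegral {μ : Measure X} [IsFiniteMeasureOnCompacts μ] (n : ℕ) :
    ∀ {F : Type} [NormedAddCommGroup F] [NormedSpace ℝ F] [CompleteSpace F]
    {f : E → X → F} (_ : ContDiff ℝ ∞ (fun q : E × X => f q.1 q.2)) {K : Set X}
    (_ : Bornology.IsBounded K) (_ : MeasurableSet K),
    ContDiff ℝ n (fun x => ∫ k in K, f x k ∂μ) := by
  induction n with
  | zero =>
    intro F _ _ _ f hf K hK hKm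
    refine contDiff_zero.2 (continuous_iff_continuousAt.2 fun x => ?_)
    exact (hasFDerivAt_setIntegral (hf.of_le (by norm_cast)) hK hKm x).continuousAt
  | succ n ih =>
    intro F _ _ _ f hf K hK hKm
    have h := fun x => hasFDerivAt_setIntegral (μ := μ)
      (hf.of_le (by norm_cast)) hK hKm x
    push_cast
    rw [contDiff_succ_iff_hasFDerivAt]
    exact ⟨_, ih (contDiff_fderiv_of_contDiff_prod hf) hK hKm, h⟩

theorem fderiv_fderiv_setIntegral {μ : Measure X} [IsFiniteMeasureOnCompacts μ]
    {f : E → X → ℝ} (hf : ContDiff ℝ ∞ (fun q : E × X => f q.1 q.2)) {K : Set X}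
    (hK : Bornology.IsBounded K) (hKm : MeasurableSet K) (x v w : E) :
    fderiv ℝ (fun y => fderiv ℝ (fun y => ∫ k in K, f y k ∂μ) y v) x w
      = ∫ k in K, fderiv ℝ (fun y => fderiv ℝ (fun y => f y k) y v) x w ∂μ := by
  have le1 : (1 : WithTop ℕ∞) ≤ ∞ := by norm_cast
  have hv : ContDiff ℝ ∞ (fun q : E × X => fderiv ℝ (fun y => f y q.2) q.1 v) :=
    (contDiff_fderiv_of_contDiff_prod hf).clm_apply contDiff_const
  have e : (fun y => fderiv ℝ (fun y => ∫ k in K, f y k ∂μ) y v)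
      = fun y => ∫ k in K, fderiv ℝ (fun y => f y k) y v ∂μ := by
    funext y
    rw [(hasFDerivAt_setIntegral (hf.of_le le1) hK hKm y).fderiv,
      ContinuousLinearMap.integral_apply]
    exact integrableOn_of_continuous_of_isBounded
      ((contDiff_fderiv_of_contDiff_prod hf).continuous.comp (Continuous.prodMk_right y)) hK
  rw [e, (hasFDerivAt_setIntegral
    (f := fun y k => fderiv ℝ (fun y => f y k) y v) (hv.of_le le1) hK hKm x).fderiv,
    ContinuousLinearMap.integral_apply]
  exact integrableOn_of_continuous_of_isBounded
    ((contDiff_fderiv_of_contDiff_prod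
      (f := fun y k => fderiv ℝ (fun y => f y k) y v) hv).continuous.comp (Continuous.prodMk_right x)) hK

end ParametricIntegral

/-! ### The cell of the reciprocal lattice -/

section Lattice

variable (b : Module.Basis (Fin 2) ℝ Plane)

theorem isBounded_cell : Bornology.IsBounded (cell b) := by
  refine isBounded_iff_forall_norm_le.2 ⟨∑ j, ‖b j‖, fun x hx => ?_⟩
  have hx := (ZSpan.mem_fundamentalDomain b).1 hx
  conv_lhs => rw [← b.sum_repr x]
  refine (norm_sum_le _ _).trans (Finset.sum_le_sum fun i _ => ?_)
  rw [norm_smul, Real.norm_eq_abs, abs_of_nonneg (hx i).1]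
  exact mul_le_of_le_one_left (norm_nonneg _) (hx i).2.le

theorem measurableSet_cell : MeasurableSet (cell b) := ZSpan.fundamentalDomain_measurableSet b

/-- The reflected cell is another fundamental domain of the same lattice, and a periodic function
has the same integral over both. -/
theorem setIntegral_cell_comp_neg {F : Type*} [NormedAddCommGroup F] [NormedSpace ℝ F]
    {f : Plane → F} (hf : ∀ k (G : recip b), f (k + (G : Plane)) = f k) :
    ∫ k in cell b, f (-k) = ∫ k in cell b, f k := by
  have h1 : IsAddFundamentalDomain (recip b) (cell b) (volume : Measure Plane) :=
    ZSpan.isAddFundamentalDomain b volume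
  have h2 : IsAddFundamentalDomain (recip b) (Neg.neg ⁻¹' cell b) (volume : Measure Plane) := by
    refine h1.preimage_of_equiv (e := Equiv.neg (recip b)) (f := Neg.neg)
      (Measure.measurePreserving_neg volume).quasiMeasurePreserving (Equiv.neg _).bijective ?_
    intro g x
    simp [Submodule.vadd_def, add_comm]
  have : VAddInvariantMeasure (recip b).toAddSubgroup Plane (volume : Measure Plane) :=
    inferInstance
  have : VAddInvariantMeasure (recip b) Plane (volume : Measure Plane) :=
    ⟨fun c s hs => this.measure_preimage_vadd c hs⟩
  have h3 := h1.setIntegral_eq h2 (f := fun k => f k) (fun g k => by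
    rw [Submodule.vadd_def, vadd_eq_add, add_comm]; exact hf k g)
  have mp : MeasurePreserving (Neg.neg : Plane → Plane) volume volume :=
    Measure.measurePreserving_neg volume
  rw [h3, ← mp.setIntegral_preimage_emb (MeasurableEquiv.neg Plane).measurableEmbedding]
  congr 2
  ext s
  simp

end Lattice

end FlatSC

namespace FlatSC

/-! ### Traces of finite-rank operators, and antiunitary maps -/

section Trace

variable {H : Type*} [NormedAddCommGroup H] [InnerProductSpace ℂ H] [CompleteSpace H]

/-- The series defining the trace of `T` converges to `t`. -/
def HasTrace (T : H →L[ℂ] H) (t : ℂ) : Prop :=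
  HasSum (fun v : (exists_hilbertBasis ℂ H).choose => inner ℂ (v : H) (T (v : H))) t

namespace HasTrace

theorem opTrace_eq {T : H →L[ℂ] H} {t : ℂ} (h : HasTrace T t) : opTrace T = t := h.tsum_eq

/-- Parseval's identity in the chosen Hilbert basis. All later traces are finite sums of this one,
which makes them independent of the basis. -/
theorem ketbra (x y : H) : HasTrace (FlatSC.ketbra x y : H →L[ℂ] H) (inner ℂ y x) := by
  obtain ⟨B, hB⟩ := (exists_hilbertBasis ℂ H).choose_spec
  have := B.hasSum_inner_mul_inner y x
  rw [hB] at this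
  simpa [HasTrace, InnerProductSpace.rankOne_apply, inner_smul_right] using this

theorem add {S T : H →L[ℂ] H} {s t : ℂ} (hs : HasTrace S s) (ht : HasTrace T t) :
    HasTrace (S + T) (s + t) := by
  simpa [HasTrace, inner_add_right] using HasSum.add hs ht

theorem smul (c : ℂ) {T : H →L[ℂ] H} {t : ℂ} (ht : HasTrace T t) : HasTrace (c • T) (c * t) := by
  simpa [HasTrace, inner_smul_right] using HasSum.mul_left c ht

theorem sum {ι : Type*} (I : Finset ι) {T : ι → H →L[ℂ] H} {t : ι → ℂ}
    (h : ∀ i ∈ I, HasTrace (T i) (t i)) : HasTrace (∑ i ∈ I, T i) (∑ i ∈ I, t i) := by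
  simpa [HasTrace, _root_.sum_apply, inner_sum] using hasSum_sum h

end HasTrace

end Trace

section Antiunitary

variable {H : Type*} [NormedAddCommGroup H] [InnerProductSpace ℂ H]

/-- Polarization: norms are preserved while `I • y` goes to `-(I • K y)`, so the imaginary part
changes sign. -/
theorem inner_antiunitary (K : H →ₛₗᵢ[starRingEnd ℂ] H) (x y : H) :
    inner ℂ (K x) (K y) = inner ℂ y x := by
  have hI : ∀ z : H, K (Complex.I • z) = -(Complex.I • K z) := fun z => by
    rw [LinearIsometry.map_smulₛₗ, Complex.conj_I, neg_smul]
  have e1 : ‖K x + K y‖ = ‖x + y‖ := by rw [← map_add, K.norm_map]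
  have e2 : ‖K x - K y‖ = ‖x - y‖ := by rw [← map_sub, K.norm_map]
  have e3 : ‖K x - Complex.I • K y‖ = ‖x + Complex.I • y‖ := by
    rw [← K.norm_map (x + _), map_add, hI, sub_eq_add_neg]
  have e4 : ‖K x + Complex.I • K y‖ = ‖x - Complex.I • y‖ := by
    rw [← K.norm_map (x - _), map_sub, hI, sub_neg_eq_add]
  rw [← inner_conj_symm y x, inner_eq_sum_norm_sq_div_four, inner_eq_sum_norm_sq_div_four (𝕜 := ℂ) x y]
  simp only [RCLike.I_to_complex]
  rw [e1, e2, e3, e4]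
  simp only [map_div₀, map_add, map_sub, map_mul, map_pow, Complex.conj_ofReal, Complex.conj_I,
    Complex.coe_algebraMap, map_ofNat]
  ring

end Antiunitary

/-! ### The band projector and its symmetry -/

namespace Valley

variable {b : Module.Basis (Fin 2) ℝ Plane} {H : Type*} [NormedAddCommGroup H]
  [InnerProductSpace ℂ H] [CompleteSpace H] (N : Valley b H)

theorem inner_C2T (x y : H) : inner ℂ (N.C2T x) (N.C2T y) = inner ℂ y x :=
  inner_antiunitary N.C2T x y

theorem inner_C2T_right (x y : H) : inner ℂ x (N.C2T y) = inner ℂ y (N.C2T x) := by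
  rw [← N.inner_C2T, N.C2T_sq]

theorem inner_u (k : Plane) (a c : Fin 2) :
    inner ℂ (N.u k a) (N.u k c) = if a = c then 1 else 0 :=
  orthonormal_iff_ite.1 (N.u_orthonormal k) a c

theorem P_apply (k : Plane) (x : H) : N.P k x = ∑ a, inner ℂ (N.u k a) x • N.u k a := by
  simp [P, InnerProductSpace.rankOne_apply]

theorem P_u (k : Plane) (a : Fin 2) : N.P k (N.u k a) = N.u k a := by
  simp [P_apply, inner_u]

theorem P_apply_of_mem {k : Plane} {x : H} (hx : x ∈ Submodule.span ℂ (Set.range (N.u k))) :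
    N.P k x = x := by
  induction hx using Submodule.span_induction with
  | mem x h => obtain ⟨a, rfl⟩ := h; exact N.P_u k a
  | zero => simp
  | add x y _ _ hx hy => rw [map_add, hx, hy]
  | smul c x _ hx => rw [map_smul, hx]

theorem inner_P_left (k : Plane) (x y : H) : inner ℂ (N.P k x) y = inner ℂ x (N.P k y) := by
  simp only [P_apply, sum_inner, inner_sum, inner_smul_left, inner_smul_right, inner_conj_symm]
  exact Finset.sum_congr rfl fun _ _ => mul_comm _ _

theorem P_P (k : Plane) (x : H) : N.P k (N.P k x) = N.P k x := by
  conv_lhs => rw [N.P_apply k x]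
  rw [map_sum]
  simp only [map_smul, P_u, ← P_apply]

theorem P_mul_P (k : Plane) : N.P k * N.P k = N.P k :=
  ContinuousLinearMap.ext fun x => N.P_P k x

theorem star_P (k : Plane) : star (N.P k) = N.P k := by
  rw [ContinuousLinearMap.star_eq_adjoint]
  exact (ContinuousLinearMap.eq_adjoint_iff _ _).2 (fun x y => N.inner_P_left k x y) |>.symm

theorem norm_P_le (k : Plane) : ‖N.P k‖ ≤ 1 := by
  have h := CStarRing.norm_star_mul_self (x := N.P k)
  rw [N.star_P, N.P_mul_P] at h
  nlinarith [norm_nonneg (N.P k)]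

theorem contDiff_P : ContDiff ℝ ∞ N.P := N.smooth

theorem C2T_u (k : Plane) (c : Fin 2) : N.C2T (N.u k c) = ∑ a, N.sew k a c • N.u k a := by
  rw [← N.P_apply_of_mem (N.u_C2T k c), P_apply]
  rfl

/-- Invariance of the bands says that `P C P = C P`; the antiunitary adjoint of this relation, with
`C² = 1`, gives `P C P = P C`. -/
theorem C2T_P (k : Plane) (x : H) : N.C2T (N.P k x) = N.P k (N.C2T x) := by
  have h1 : ∀ x, N.P k (N.C2T (N.P k x)) = N.C2T (N.P k x) := fun x => by
    rw [N.P_apply k x, map_sum, map_sum]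
    refine Finset.sum_congr rfl fun a _ => ?_
    rw [LinearIsometry.map_smulₛₗ, map_smul, N.P_apply_of_mem (N.u_C2T k a)]
  refine ext_inner_left ℂ fun y => ?_
  rw [← h1, ← N.inner_P_left, ← N.inner_P_left, N.inner_C2T_right, N.inner_P_left,
    ← N.inner_C2T_right, h1]

end Valley

end FlatSC

/-! ### Two-by-two matrices of operators in the band frame -/

namespace FlatSC

/-- `-iτ_y`. -/
def eps : Matrix (Fin 2) (Fin 2) ℂ := !![0, -1; 1, 0]

/-- Antisymmetric forms on a two-dimensional space are all multiples of one another, so a change of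
frame acts by a scalar, its determinant. -/
theorem mul_eps_mul_transpose (g : Matrix (Fin 2) (Fin 2) ℂ) : g * eps * gᵀ = g.det • eps := by
  ext i j
  fin_cases i <;> fin_cases j <;>
    simp [eps, Matrix.mul_apply, Fin.sum_univ_two, Matrix.det_fin_two] <;> ring

theorem ContDiff.clm_apply_real {E H F : Type*} [NormedAddCommGroup E] [NormedSpace ℝ E]
    [NormedAddCommGroup H] [InnerProductSpace ℂ H] [NormedAddCommGroup F] [InnerProductSpace ℂ F]
    {n : WithTop ℕ∞}
    {Z : E → H →L[ℂ] F} (hZ : ContDiff ℝ n Z) (x : H) : ContDiff ℝ n (fun q => Z q x) :=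
  ((ContinuousLinearMap.apply ℂ F x).restrictScalars ℝ).contDiff.comp hZ

theorem HasDerivAt.clm_apply_real {H F : Type*}
    [NormedAddCommGroup H] [InnerProductSpace ℂ H] [NormedAddCommGroup F] [InnerProductSpace ℂ F]
    {Z : ℝ → H →L[ℂ] F} {Z' : H →L[ℂ] F} {s : ℝ} (hZ : HasDerivAt Z Z' s) (x : H) :
    HasDerivAt (fun q => Z q x) (Z' x) s :=
  ((ContinuousLinearMap.apply ℂ F x).restrictScalars ℝ).hasFDerivAt.comp_hasDerivAt s hZ

namespace Valley

variable {b : Module.Basis (Fin 2) ℝ Plane} {H : Type*} [NormedAddCommGroup H]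
  [InnerProductSpace ℂ H] [CompleteSpace H] (N : Valley b H)

/-- The matrix `⟨u_k|Z|u_k⟩`. -/
noncomputable def mat (k : Plane) (Z : H →L[ℂ] H) : Matrix (Fin 2) (Fin 2) ℂ :=
  Matrix.of fun a c => inner ℂ (N.u k a) (Z (N.u k c))

theorem mat_apply (k : Plane) (Z : H →L[ℂ] H) (a c : Fin 2) :
    N.mat k Z a c = inner ℂ (N.u k a) (Z (N.u k c)) := rfl

theorem mat_mul_P_mul (k : Plane) (Z W : H →L[ℂ] H) :
    N.mat k (Z * N.P k * W) = N.mat k Z * N.mat k W := by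
  ext a c
  simp only [mat_apply, Matrix.mul_apply, mul_apply_eq_comp, P_apply, map_sum,
    map_smul, inner_sum, inner_smul_right]
  exact Finset.sum_congr rfl fun _ _ => mul_comm _ _

theorem mat_star (k : Plane) (Z : H →L[ℂ] H) : N.mat k (star Z) = (N.mat k Z)ᴴ := by
  ext a c
  rw [mat_apply, Matrix.conjTranspose_apply, mat_apply, ContinuousLinearMap.star_eq_adjoint,
    ContinuousLinearMap.adjoint_inner_right, RCLike.star_def, inner_conj_symm]

theorem mat_P (k : Plane) : N.mat k (N.P k) = 1 := by
  ext a c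
  rw [mat_apply, P_u, inner_u, Matrix.one_apply]

theorem mat_smul (k : Plane) (z : ℂ) (Z : H →L[ℂ] H) : N.mat k (z • Z) = z • N.mat k Z := by
  ext a c
  simp [mat_apply]

theorem P_mul_eq (k : Plane) (Z : H →L[ℂ] H) :
    N.P k * Z = ∑ a, ketbra (N.u k a) (star Z (N.u k a)) := by
  ext x
  simp [P_apply, ContinuousLinearMap.star_eq_adjoint, ContinuousLinearMap.adjoint_inner_left]

theorem mul_P_eq (k : Plane) (Z : H →L[ℂ] H) :
    Z * N.P k = ∑ a, ketbra (Z (N.u k a)) (N.u k a) := by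
  ext x
  simp [P_apply]

theorem hasTrace_P_mul (k : Plane) (Z : H →L[ℂ] H) :
    HasTrace (N.P k * Z) (N.mat k Z).trace := by
  rw [P_mul_eq]
  have := HasTrace.sum Finset.univ fun a _ => HasTrace.ketbra (N.u k a) (star Z (N.u k a))
  simpa [ContinuousLinearMap.star_eq_adjoint, ContinuousLinearMap.adjoint_inner_left,
    Matrix.trace, mat_apply] using this

theorem hasTrace_mul_P (k : Plane) (Z : H →L[ℂ] H) :
    HasTrace (Z * N.P k) (N.mat k Z).trace := by
  rw [mul_P_eq]
  exact HasTrace.sum Finset.univ fun a _ => HasTrace.ketbra (Z (N.u k a)) (N.u k a)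

/-- Cyclicity of the trace, available here because the projector in the middle makes the product a
sum of two rank-one operators. -/
theorem hasTrace_mul_P_mul (k : Plane) (Z W : H →L[ℂ] H) :
    HasTrace (Z * N.P k * W) (N.mat k (W * Z)).trace := by
  have e : Z * N.P k * W = ∑ a, ketbra (Z (N.u k a)) (star W (N.u k a)) := by
    ext x
    simp [P_apply, ContinuousLinearMap.star_eq_adjoint, ContinuousLinearMap.adjoint_inner_left]
  rw [e]
  have := HasTrace.sum Finset.univ fun a _ =>
    HasTrace.ketbra (Z (N.u k a)) (star W (N.u k a))
  simpa [ContinuousLinearMap.star_eq_adjoint, ContinuousLinearMap.adjoint_inner_left,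
    Matrix.trace, mat_apply] using this

/-! ### The sewing matrix -/

/-- Symmetry comes from the square of the antiunitary being `+1`. -/
theorem sew_symm (k : Plane) : (N.sew k)ᵀ = N.sew k := by
  ext a c
  simp only [Matrix.transpose_apply, sew, Matrix.of_apply]
  exact N.inner_C2T_right _ _

theorem conjTranspose_sew_mul_sew (k : Plane) : (N.sew k)ᴴ * N.sew k = 1 := by
  ext a c
  have h : inner ℂ (N.C2T (N.u k a)) (N.C2T (N.u k c)) = if a = c then (1 : ℂ) else 0 := by
    rw [inner_C2T, inner_u]; simp [eq_comm]
  rw [Matrix.one_apply, ← h, N.C2T_u k a, sum_inner]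
  simp only [inner_smul_left, Matrix.mul_apply, Matrix.conjTranspose_apply]
  rfl

theorem sew_mul_conjTranspose_sew (k : Plane) : N.sew k * (N.sew k)ᴴ = 1 :=
  mul_eq_one_comm.1 (N.conjTranspose_sew_mul_sew k)

theorem det_sew_mul_conj (k : Plane) : (N.sew k).det * conj (N.sew k).det = 1 := by
  have := congrArg Matrix.det (N.sew_mul_conjTranspose_sew k)
  rwa [Matrix.det_mul, Matrix.det_conjTranspose, Matrix.det_one] at this

theorem norm_det_sew (k : Plane) : ‖(N.sew k).det‖ = 1 := by
  have h := N.det_sew_mul_conj k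
  rw [Complex.mul_conj, ← Complex.ofReal_one, Complex.ofReal_inj, Complex.normSq_eq_norm_sq] at h
  nlinarith [norm_nonneg (N.sew k).det]

theorem inner_C2T_u (k : Plane) (a c : Fin 2) :
    inner ℂ (N.C2T (N.u k a)) (N.u k c) = (N.sew k)ᴴ a c := by
  rw [Matrix.conjTranspose_apply, RCLike.star_def, sew, Matrix.of_apply, inner_conj_symm]

/-- The operator `|u_k⟩(-iτ_y)⟨u_k^{C₂z𝒯}|`. -/
noncomputable def area (k : Plane) : H →L[ℂ] H :=
  ∑ a, ∑ c, eps a c • ketbra (N.u k a) (N.C2T (N.u k c))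

theorem P_mul_area (k : Plane) : N.P k * N.area k = N.area k := by
  ext x
  simp [area, P_u]

theorem area_mul_P (k : Plane) : N.area k * N.P k = N.area k := by
  ext x
  simp only [mul_apply_eq_comp, area, _root_.sum_apply, _root_.smul_apply,
    InnerProductSpace.rankOne_apply]
  simp only [← N.inner_P_left, ← N.C2T_P, P_u]

theorem mat_area (k : Plane) : N.mat k (N.area k) = eps * (N.sew k)ᴴ := by
  ext a c
  have hn := (N.u_orthonormal k).1
  fin_cases a <;> simp [mat_apply, area, inner_u, Matrix.mul_apply, inner_C2T_u, hn]

end Valley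

end FlatSC

/-! ### Parallel transport and Wilson lines -/

namespace FlatSC

namespace Valley

variable {b : Module.Basis (Fin 2) ℝ Plane} {H : Type*} [NormedAddCommGroup H]
  [InnerProductSpace ℂ H] [CompleteSpace H] (N : Valley b H)

theorem exists_lipschitz_P (R : ℝ) : ∃ C : ℝ, 0 ≤ C ∧ ∀ x ∈ Metric.closedBall (0 : Plane) R,
    ∀ y ∈ Metric.closedBall (0 : Plane) R, ‖N.P x - N.P y‖ ≤ C * ‖x - y‖ := by
  have hd : Differentiable ℝ N.P := N.contDiff_P.differentiable (by simp)
  have hc : Continuous (fderiv ℝ N.P) := N.contDiff_P.continuous_fderiv (by simp)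
  obtain ⟨C, hC⟩ := (isCompact_closedBall (0 : Plane) R).exists_bound_of_continuousOn
    hc.continuousOn
  refine ⟨max C 0, le_max_right _ _, fun x hx y hy => ?_⟩
  exact (convex_closedBall (0 : Plane) R).norm_image_sub_le_of_norm_fderiv_le
    (fun z _ => hd z) (fun z hz => (hC z hz).trans (le_max_left _ _)) hy hx

/-- The projectors along the segment from `k₀` to `k`. -/
noncomputable def path (k₀ k : Plane) (s : ℝ) : H →L[ℂ] H := N.P (k₀ + s • (k - k₀))

theorem path_zero (k₀ k : Plane) : N.path k₀ k 0 = N.P k₀ := by simp [path]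

theorem path_one (k₀ k : Plane) : N.path k₀ k 1 = N.P k := by simp [path]

/-- Parallel transport along the segment from `k` to `k₀`. -/
noncomputable def transport (k₀ k : Plane) : H →L[ℂ] H :=
  limUnder atTop fun n => pathChain (N.path k₀ k) (n + 1)

theorem exists_lipschitz_path (R : ℝ) : ∃ C : ℝ, ∀ k₀ ∈ Metric.closedBall (0 : Plane) R,
    ∀ k ∈ Metric.closedBall (0 : Plane) R, ∀ s ∈ Set.Icc (0 : ℝ) 1, ∀ t ∈ Set.Icc (0 : ℝ) 1,
      ‖N.path k₀ k s - N.path k₀ k t‖ ≤ C * |s - t| := by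
  obtain ⟨C, hC0, hC⟩ := N.exists_lipschitz_P R
  refine ⟨C * (2 * R), fun k₀ hk₀ k hk s hs t ht => ?_⟩
  have hmem : ∀ s ∈ Set.Icc (0 : ℝ) 1, k₀ + s • (k - k₀) ∈ Metric.closedBall (0 : Plane) R :=
    fun s hs => (convex_closedBall (0 : Plane) R).add_smul_sub_mem hk₀ hk hs
  refine (hC _ (hmem s hs) _ (hmem t ht)).trans ?_
  have e : k₀ + s • (k - k₀) - (k₀ + t • (k - k₀)) = (s - t) • (k - k₀) := by
    rw [sub_smul]; abel
  rw [e, norm_smul, Real.norm_eq_abs]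
  have h1 := mem_closedBall_zero_iff.1 hk₀
  have h2 := mem_closedBall_zero_iff.1 hk
  have h3 : ‖k - k₀‖ ≤ 2 * R := (norm_sub_le _ _).trans (by linarith)
  calc C * (|s - t| * ‖k - k₀‖) ≤ C * (|s - t| * (2 * R)) := by gcongr
    _ = _ := by ring

/-- One constant serves all segments inside a ball, so the discrete transports converge uniformly
there. -/
theorem exists_transport_approx (R : ℝ) : ∃ C : ℝ, ∀ k₀ ∈ Metric.closedBall (0 : Plane) R,
    ∀ k ∈ Metric.closedBall (0 : Plane) R,
      Tendsto (fun n => pathChain (N.path k₀ k) (n + 1)) atTop (𝓝 (N.transport k₀ k)) ∧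
      ∀ n : ℕ, ‖pathChain (N.path k₀ k) (n + 1) - N.transport k₀ k‖ ≤ C / (n + 1) := by
  obtain ⟨C, hC⟩ := N.exists_lipschitz_path R
  refine ⟨2 * C ^ 2, fun k₀ hk₀ k hk => ?_⟩
  obtain ⟨T, hT, hb⟩ := exists_tendsto_pathChain (p := N.path k₀ k) (fun _ => N.P_mul_P _)
    (fun _ => N.norm_P_le _) (hC k₀ hk₀ k hk)
  have e : N.transport k₀ k = T := hT.limUnder_eq
  rw [e]
  exact ⟨hT, hb⟩

theorem tendsto_transport (k₀ k : Plane) :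
    Tendsto (fun n => pathChain (N.path k₀ k) (n + 1)) atTop (𝓝 (N.transport k₀ k)) := by
  obtain ⟨C, hC⟩ := N.exists_transport_approx (max ‖k₀‖ ‖k‖)
  exact (hC k₀ (by simp) k (by simp)).1

theorem continuous_transport (k₀ : Plane) : Continuous (N.transport k₀) := by
  refine continuous_iff_continuousAt.2 fun k₁ => ?_
  set R := max ‖k₀‖ (‖k₁‖ + 1) with hR
  obtain ⟨C, hC⟩ := N.exists_transport_approx R
  have hu : TendstoUniformlyOn (fun (n : ℕ) k => pathChain (N.path k₀ k) (n + 1))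
      (N.transport k₀) atTop (Metric.closedBall (0 : Plane) R) := by
    rw [Metric.tendstoUniformlyOn_iff]
    intro ε hε
    have lim : Tendsto (fun n : ℕ => C / ((n : ℝ) + 1)) atTop (𝓝 0) :=
      Tendsto.div_atTop tendsto_const_nhds
        (tendsto_atTop_add_const_right _ _ tendsto_natCast_atTop_atTop)
    filter_upwards [lim.eventually (gt_mem_nhds hε)] with n hn k hk
    rw [dist_comm, dist_eq_norm]
    exact ((hC k₀ (by simp [hR]) k hk).2 n).trans_lt hn
  have hc : ∀ n : ℕ, Continuous fun k => pathChain (N.path k₀ k) n := by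
    have hP : Continuous N.P := N.contDiff_P.continuous
    intro n
    simp only [pathChain]
    suffices h : ∀ (x : Plane → ℕ → H →L[ℂ] H), (∀ j, Continuous fun k => x k j) →
        ∀ m, Continuous fun k => chain (x k) m by
      refine h _ (fun j => ?_) n
      exact hP.comp (by fun_prop)
    intro x hx m
    induction m with
    | zero => exact hx 0
    | succ m ih => exact ih.mul (hx _)
  have hcont := hu.continuousOn (Eventually.of_forall fun n => (hc (n + 1)).continuousOn).frequently
  refine hcont.continuousAt (mem_of_superset (Metric.ball_mem_nhds k₁ one_pos) fun x hx => ?_)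
  rw [mem_closedBall_zero_iff]
  refine le_trans ?_ (le_max_right _ _)
  have := norm_sub_norm_le x k₁
  have h2 := mem_ball_iff_norm.1 hx
  linarith

/-- In the limit, transport is a partial isometry onto the bands at `k₀`; this is the source of
unitarity of the Wilson line. -/
theorem transport_mul_star (k₀ k : Plane) :
    N.transport k₀ k * star (N.transport k₀ k) = N.P k₀ := by
  obtain ⟨C, hC⟩ := N.exists_lipschitz_path (max ‖k₀‖ ‖k‖)
  have h1 := tendsto_pathChain_mul_star (p := N.path k₀ k) (fun _ => N.P_mul_P _)
    (fun _ => N.norm_P_le _) (fun _ => N.star_P _) (hC k₀ (by simp) k (by simp))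
  have h2 := (N.tendsto_transport k₀ k).mul (N.tendsto_transport k₀ k).star
  rw [path_zero] at h1
  exact tendsto_nhds_unique h2 h1

theorem P_mul_transport (k₀ k : Plane) : N.P k₀ * N.transport k₀ k = N.transport k₀ k := by
  refine tendsto_nhds_unique ((N.tendsto_transport k₀ k).const_mul (N.P k₀)) ?_
  refine (N.tendsto_transport k₀ k).congr fun n => ?_
  have := first_mul_chain (x := fun j : ℕ => N.path k₀ k (j / ((n + 1 : ℕ) : ℝ)))
    (fun _ => N.P_mul_P _) (n + 1)
  simp only [Nat.cast_zero, zero_div, path_zero] at this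
  exact this.symm

theorem transport_mul_P (k₀ k : Plane) : N.transport k₀ k * N.P k = N.transport k₀ k := by
  refine tendsto_nhds_unique ((N.tendsto_transport k₀ k).mul_const (N.P k)) ?_
  refine (N.tendsto_transport k₀ k).congr fun n => ?_
  have := chain_mul_last (x := fun j : ℕ => N.path k₀ k (j / ((n + 1 : ℕ) : ℝ)))
    (fun _ => N.P_mul_P _) (n + 1)
  rw [div_self (by positivity), path_one] at this
  exact this.symm

theorem transport_self (k : Plane) : N.transport k k = N.P k := by
  refine (tendsto_const_nhds.congr fun n => ?_ : Tendsto _ atTop _).limUnder_eq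
  have : ∀ m, N.P k = chain (fun _ : ℕ => N.P k) m := by
    intro m
    induction m with
    | zero => rfl
    | succ m ih => rw [chain, ← ih, N.P_mul_P]
  simpa [pathChain, path] using this (n + 1)

theorem C2T_transport (k₀ k : Plane) (x : H) :
    N.C2T (N.transport k₀ k x) = N.transport k₀ k (N.C2T x) := by
  have hap : ∀ x, Tendsto (fun n => pathChain (N.path k₀ k) (n + 1) x) atTop
      (𝓝 (N.transport k₀ k x)) := fun x =>
    ((ContinuousLinearMap.apply ℂ H x).continuous.tendsto _).comp (N.tendsto_transport k₀ k)
  refine tendsto_nhds_unique ((N.C2T.continuous.tendsto _).comp (hap x)) ?_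
  refine (hap (N.C2T x)).congr fun n => ?_
  have key : ∀ m x, N.C2T (chain (fun j : ℕ => N.path k₀ k (j / ((n + 1 : ℕ) : ℝ))) m x)
      = chain (fun j : ℕ => N.path k₀ k (j / ((n + 1 : ℕ) : ℝ))) m (N.C2T x) := by
    intro m
    induction m with
    | zero => exact fun x => N.C2T_P _ x
    | succ m ih =>
      intro x
      rw [chain, mul_apply_eq_comp, mul_apply_eq_comp, ih, path, N.C2T_P]
  exact (key _ _).symm

/-- The projectors at the two end points act trivially on the frames. Adding them to the `L`
interior ones gives `L + 2` factors with spacing `1/(L + 1)`, hence the index `L + 1`. -/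
theorem wilsonApprox_eq (k₀ k : Plane) (L : ℕ) :
    N.wilsonApprox k₀ k L = Matrix.of fun a c =>
      inner ℂ (N.u k₀ a) (pathChain (N.path k₀ k) (L + 1) (N.u k c)) := by
  ext a c
  rw [wilsonApprox, Matrix.of_apply, Matrix.of_apply, pathChain, chain_eq_list_prod]
  have e1 : ((L + 1 : ℕ) : ℝ) / ((L + 1 : ℕ) : ℝ) = 1 := div_self (by positivity)
  rw [mul_apply_eq_comp, mul_apply_eq_comp, e1, path_one, P_u]
  simp only [Nat.cast_zero, zero_div, path_zero]
  rw [← N.inner_P_left, P_u]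
  simp [path]

theorem wilson_eq (k₀ k : Plane) :
    N.wilson k₀ k = Matrix.of fun a c => inner ℂ (N.u k₀ a) (N.transport k₀ k (N.u k c)) := by
  refine Tendsto.limUnder_eq ?_
  refine tendsto_pi_nhds.2 fun a => tendsto_pi_nhds.2 fun c => ?_
  have h1 : Tendsto (fun n => pathChain (N.path k₀ k) (n + 1) (N.u k c)) atTop
      (𝓝 (N.transport k₀ k (N.u k c))) :=
    ((ContinuousLinearMap.apply ℂ H (N.u k c)).continuous.tendsto _).comp
      (N.tendsto_transport k₀ k)
  have h2 := (tendsto_const_nhds (x := N.u k₀ a)).inner (𝕜 := ℂ) h1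
  refine h2.congr fun n => ?_
  rw [wilsonApprox_eq]
  rfl

theorem transport_u (k₀ k : Plane) (c : Fin 2) :
    N.transport k₀ k (N.u k c) = ∑ a, N.wilson k₀ k a c • N.u k₀ a := by
  rw [← N.P_mul_transport, mul_apply_eq_comp, P_apply, wilson_eq]
  rfl

theorem star_transport_u (k₀ k : Plane) (a : Fin 2) :
    star (N.transport k₀ k) (N.u k₀ a) = ∑ c, (N.wilson k₀ k)ᴴ c a • N.u k c := by
  have : star (N.transport k₀ k) = N.P k * star (N.transport k₀ k) := by
    conv_lhs => rw [← N.transport_mul_P, star_mul, N.star_P]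
  rw [this, mul_apply_eq_comp, P_apply]
  refine Finset.sum_congr rfl fun c _ => ?_
  rw [Matrix.conjTranspose_apply, wilson_eq, Matrix.of_apply, RCLike.star_def, inner_conj_symm,
    ContinuousLinearMap.star_eq_adjoint, ContinuousLinearMap.adjoint_inner_right]

theorem wilson_mul_conjTranspose (k₀ k : Plane) : N.wilson k₀ k * (N.wilson k₀ k)ᴴ = 1 := by
  ext a c
  have h := congrArg (fun Z : H →L[ℂ] H => inner ℂ (N.u k₀ a) (Z (N.u k₀ c)))
    (N.transport_mul_star k₀ k)
  simp only [mul_apply_eq_comp, star_transport_u, map_sum, map_smul, transport_u, P_u, inner_u,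
    inner_sum, inner_smul_right] at h
  rw [Matrix.one_apply, ← h]
  simp [Matrix.mul_apply, mul_comm]

/-- This is the commutation of C₂z𝒯 with transport, read in the frames; the conjugate on the right
is its antilinearity. -/
theorem wilson_mul_sew (k₀ k : Plane) :
    N.wilson k₀ k * N.sew k = N.sew k₀ * (N.wilson k₀ k).map conj := by
  ext a c
  have h := congrArg (fun x => inner ℂ (N.u k₀ a) x) (N.C2T_transport k₀ k (N.u k c))
  simp only [transport_u, C2T_u, map_sum, map_smul, LinearIsometry.map_smulₛₗ, inner_sum,
    inner_smul_right, inner_u] at h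
  simp [Matrix.mul_apply] at h ⊢
  linear_combination -h

theorem wilson_self (k : Plane) : N.wilson k k = 1 := by
  ext a c
  rw [wilson_eq, transport_self, Matrix.of_apply, P_u, inner_u, Matrix.one_apply]

theorem det_wilson_mul_conj (k₀ k : Plane) :
    (N.wilson k₀ k).det * conj (N.wilson k₀ k).det = 1 := by
  have := congrArg Matrix.det (N.wilson_mul_conjTranspose k₀ k)
  rwa [Matrix.det_mul, Matrix.det_conjTranspose, Matrix.det_one] at this

/-- Determinants of `wilson_mul_sew`, combined with the unit modulus of `det W` and of `det sew`. -/
theorem det_wilson_sq (k₀ k : Plane) :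
    (N.wilson k₀ k).det ^ 2 = (N.sew k₀).det * conj (N.sew k).det := by
  have h := congrArg Matrix.det (N.wilson_mul_sew k₀ k)
  have e : ((N.wilson k₀ k).map conj).det = conj (N.wilson k₀ k).det :=
    ((starRingEnd ℂ).map_det _).symm
  rw [Matrix.det_mul, Matrix.det_mul, e] at h
  linear_combination (N.wilson k₀ k).det * conj (N.sew k).det * h
    - (N.wilson k₀ k).det ^ 2 * N.det_sew_mul_conj k
    + (N.sew k₀).det * conj (N.sew k).det * N.det_wilson_mul_conj k₀ k

/-- The base-point factors cancel. Hence only the sign of `η` can depend on `k₀`, and the choice of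
branch of the square root is immaterial beyond a sign. -/
theorem eta_sq (k₀ k : Plane) : N.eta k₀ k ^ 2 = conj (N.sew k).det := by
  have e : (Matrix.of fun a c => inner ℂ (N.C2T (N.u k₀ a)) (N.u k₀ c)) = (N.sew k₀)ᴴ := by
    ext a c
    exact N.inner_C2T_u k₀ a c
  have s : ∀ z : ℂ, (z ^ (1 / 2 : ℂ)) ^ 2 = z := fun z => by
    rw [← Complex.cpow_nat_mul]; norm_num
  rw [eta, e, mul_pow, s, det_wilson_sq, Matrix.det_conjTranspose, RCLike.star_def, ← mul_assoc,
    mul_comm (conj (N.sew k₀).det), det_sew_mul_conj, one_mul]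

theorem norm_eta (k₀ k : Plane) : ‖N.eta k₀ k‖ = 1 := by
  have h := congrArg norm (N.eta_sq k₀ k)
  rw [norm_pow, RCLike.norm_conj, norm_det_sew] at h
  nlinarith [norm_nonneg (N.eta k₀ k)]

/-- The normalization `η*/√2`. -/
noncomputable def phase (k₀ k : Plane) : ℂ := conj (N.eta k₀ k) / (Real.sqrt 2 : ℂ)

theorem phase_sq (k₀ k : Plane) : N.phase k₀ k ^ 2 = (N.sew k).det / 2 := by
  have h2 : ((Real.sqrt 2 : ℝ) : ℂ) ^ 2 = 2 := by
    rw [← Complex.ofReal_pow, Real.sq_sqrt (by norm_num)]; norm_num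
  rw [phase, div_pow, h2, ← map_pow, eta_sq, Complex.conj_conj]

theorem Q₀_eq_phase (k₀ k : Plane) : N.Q₀ k₀ k = N.phase k₀ k • N.area k := rfl

end Valley

end FlatSC

/-! ### Continuity, base points and periodicity of `Q` -/

namespace FlatSC

theorem eq_zero_of_eq_neg {E : Type*} [NormedAddCommGroup E] [NormedSpace ℝ E] {x : E}
    (h : x = -x) : x = 0 := by
  have h2 : (2 : ℝ) • x = 0 := by
    rw [two_smul]
    nth_rewrite 1 [h]
    exact neg_add_cancel x
  exact (smul_eq_zero.1 h2).resolve_left two_ne_zero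

/-- Two continuous nowhere vanishing fields that agree up to sign at every point agree up to a
global sign. -/
theorem eq_or_eq_neg_of_continuous {X E : Type*} [TopologicalSpace X] [PreconnectedSpace X]
    [NormedAddCommGroup E] [NormedSpace ℝ E] {f g : X → E} (hf : Continuous f) (hg : Continuous g)
    (h : ∀ x, f x = g x ∨ f x = -g x) (h0 : ∀ x, g x ≠ 0) :
    (∀ x, f x = g x) ∨ ∀ x, f x = -g x := by
  have c1 : IsClosed {x | f x = g x} := isClosed_eq hf hg
  have c2 : IsClosed {x | f x = -g x} := isClosed_eq hf hg.neg
  have e : {x | f x = g x}ᶜ = {x | f x = -g x} := by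
    ext x
    constructor
    · exact fun hx => (h x).resolve_left hx
    · intro hx hx'
      simp only [Set.mem_ofPred_eq] at hx hx'
      exact h0 x (eq_zero_of_eq_neg (hx'.symm.trans hx))
  have o : IsOpen {x | f x = g x} := by
    rw [← isClosed_compl_iff, e]; exact c2
  rcases isClopen_iff.1 ⟨c1, o⟩ with h1 | h1
  · right
    intro x
    have : x ∈ {x | f x = g x}ᶜ := by rw [h1]; simp
    rwa [e] at this
  · left
    intro x
    have : x ∈ {x | f x = g x} := by rw [h1]; trivial
    exact this

section Conj

variable {H H' : Type*} [NormedAddCommGroup H] [InnerProductSpace ℂ H] [CompleteSpace H]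
  [NormedAddCommGroup H'] [InnerProductSpace ℂ H']

/-- Conjugation of operators by a unitary. -/
noncomputable def conjL (e : H ≃ₗᵢ[ℂ] H') : (H →L[ℂ] H) →L[ℝ] (H' →L[ℂ] H') :=
  (((ContinuousLinearMap.compL ℂ H' H H') (e.toContinuousLinearEquiv : H →L[ℂ] H')).comp
    ((ContinuousLinearMap.compL ℂ H' H H).flip
      (e.symm.toContinuousLinearEquiv : H' →L[ℂ] H))).restrictScalars ℝ

theorem conjL_apply (e : H ≃ₗᵢ[ℂ] H') (Z : H →L[ℂ] H) (x : H') :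
    conjL e Z x = e (Z (e.symm x)) := rfl

theorem conjL_mul (e : H ≃ₗᵢ[ℂ] H') (Z W : H →L[ℂ] H) :
    conjL e (Z * W) = conjL e Z * conjL e W := by
  ext x
  simp [conjL_apply]

theorem conjL_smul (e : H ≃ₗᵢ[ℂ] H') (z : ℂ) (Z : H →L[ℂ] H) :
    conjL e (z • Z) = z • conjL e Z := by
  ext x
  simp [conjL_apply]

theorem conjL_ketbra (e : H ≃ₗᵢ[ℂ] H') (x y : H) :
    conjL e (ketbra x y) = ketbra (e x) (e y) := by
  ext z
  simp only [conjL_apply, InnerProductSpace.rankOne_apply, map_smul]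
  rw [← e.inner_map_map y, e.apply_symm_apply]

/-- The area form `|v⟩(-iτ_y)⟨K v|` of a frame picks up the determinant of a change of frame. -/
theorem area_change_frame (K : H →ₛₗᵢ[starRingEnd ℂ] H) (v w : Fin 2 → H)
    (g : Matrix (Fin 2) (Fin 2) ℂ) (h : ∀ a, v a = ∑ d, g d a • w d) :
    ∑ a, ∑ c, eps a c • (ketbra (v a) (K (v c)) : H →L[ℂ] H)
      = g.det • ∑ a, ∑ c, eps a c • ketbra (w a) (K (w c)) := by
  ext x
  simp only [h, Fin.sum_univ_two, map_add, LinearIsometry.map_smulₛₗ, eps, Matrix.of_apply,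
    Matrix.cons_val_zero, Matrix.cons_val_one, Matrix.cons_val', Matrix.cons_val_fin_one,
    Matrix.det_fin_two, _root_.add_apply, _root_.smul_apply,
    InnerProductSpace.rankOne_apply, inner_smul_left, Complex.conj_conj]
  module

end Conj

namespace Valley

variable {b : Module.Basis (Fin 2) ℝ Plane} {H : Type*} [NormedAddCommGroup H]
  [InnerProductSpace ℂ H] [CompleteSpace H] (N : Valley b H)

theorem det_eps : eps.det = 1 := by simp [eps, Matrix.det_fin_two]

theorem area_ne_zero (k : Plane) : N.area k ≠ 0 := by
  intro h
  have h1 := congrArg Matrix.det (N.mat_area k)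
  have h2 : N.mat k (0 : H →L[ℂ] H) = 0 := by ext; simp [mat_apply]
  rw [h, h2, Matrix.det_mul, det_eps, Matrix.det_conjTranspose, Matrix.det_zero] at h1
  have h3 := N.norm_det_sew k
  rw [one_mul] at h1
  have h4 : (N.sew k).det = 0 := star_eq_zero.1 h1.symm
  rw [h4, norm_zero] at h3
  exact zero_ne_one h3

theorem phase_ne_zero (k₀ k : Plane) : N.phase k₀ k ≠ 0 := by
  intro h
  have := N.phase_sq k₀ k
  rw [h] at this
  have h3 := N.norm_det_sew k
  have h4 : (N.sew k).det = 0 := by simpa using this.symm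
  rw [h4, norm_zero] at h3
  exact zero_ne_one h3

theorem Q₀_ne_zero (k₀ k : Plane) : N.Q₀ k₀ k ≠ 0 := by
  rw [Q₀_eq_phase]
  exact smul_ne_zero (N.phase_ne_zero k₀ k) (N.area_ne_zero k)

theorem norm_phase_sq (k₀ k : Plane) : ‖N.phase k₀ k‖ ^ 2 = 1 / 2 := by
  rw [← norm_pow, phase_sq, norm_div, norm_det_sew]
  norm_num

theorem C2T_star_transport (k₀ k : Plane) (x : H) :
    N.C2T (star (N.transport k₀ k) x) = star (N.transport k₀ k) (N.C2T x) := by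
  refine ext_inner_left ℂ fun y => ?_
  rw [ContinuousLinearMap.star_eq_adjoint, ContinuousLinearMap.adjoint_inner_right,
    N.inner_C2T_right, ContinuousLinearMap.adjoint_inner_left, ← C2T_transport,
    N.inner_C2T_right]

/-- Conjugating by transport replaces the frame at `k₀` by its transported copy at `k`, which
differs from `u_k` by the Wilson line; `area` only sees the determinant of that change. -/
theorem star_transport_mul_area (k₀ k : Plane) :
    star (N.transport k₀ k) * N.area k₀ * N.transport k₀ k
      = conj (N.wilson k₀ k).det • N.area k := by
  have h1 : star (N.transport k₀ k) * N.area k₀ * N.transport k₀ k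
      = ∑ a, ∑ c, eps a c • (ketbra (star (N.transport k₀ k) (N.u k₀ a))
        (N.C2T (star (N.transport k₀ k) (N.u k₀ c))) : H →L[ℂ] H) := by
    ext x
    simp only [area, mul_apply_eq_comp, _root_.sum_apply, _root_.smul_apply,
      InnerProductSpace.rankOne_apply, map_sum, map_smul, C2T_star_transport]
    simp only [ContinuousLinearMap.star_eq_adjoint, ContinuousLinearMap.adjoint_inner_left]
  rw [h1, area_change_frame N.C2T _ (N.u k) _ (fun a => N.star_transport_u k₀ k a),
    Matrix.det_conjTranspose]
  rfl

/-- Although neither `η` nor the frame need be continuous in `k`, the gauge dependence cancels: up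
to a constant, `Q` is the form at `k₀` conjugated by the continuous parallel transport. -/
theorem continuous_Q₀ (k₀ : Plane) : Continuous (N.Q₀ k₀) := by
  set z := (Matrix.det (Matrix.of fun a c => inner ℂ (N.C2T (N.u k₀ a)) (N.u k₀ c))) ^ (1 / 2 : ℂ)
    with hz
  have e : N.Q₀ k₀ = fun k => (conj z / (Real.sqrt 2 : ℂ)) •
      (star (N.transport k₀ k) * N.area k₀ * N.transport k₀ k) := by
    funext k
    rw [star_transport_mul_area, smul_smul, Q₀_eq_phase, phase, eta, ← hz, map_mul]
    congr 1
    ring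
  rw [e]
  have hc := N.continuous_transport k₀
  exact Continuous.const_smul ((hc.star.mul continuous_const).mul hc)
    (conj z / (Real.sqrt 2 : ℂ))

/-- The fields `Q` for different base points agree up to a global sign. -/
theorem Q₀_change_base (k₀ k₁ : Plane) :
    (∀ k, N.Q₀ k₀ k = N.Q₀ k₁ k) ∨ ∀ k, N.Q₀ k₀ k = -N.Q₀ k₁ k := by
  refine eq_or_eq_neg_of_continuous (N.continuous_Q₀ k₀) (N.continuous_Q₀ k₁) (fun k => ?_)
    (N.Q₀_ne_zero k₁)
  have : N.phase k₀ k ^ 2 = N.phase k₁ k ^ 2 := by rw [phase_sq, phase_sq]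
  rw [Q₀_eq_phase, Q₀_eq_phase]
  rcases sq_eq_sq_iff_eq_or_eq_neg.1 this with h | h
  · left; rw [h]
  · right; rw [h, neg_smul]

theorem sew_periodic (k : Plane) (G : recip b) : N.sew (k + (G : Plane)) = N.sew k := by
  ext a c
  simp only [sew, Matrix.of_apply, N.u_periodic, N.C2T_S, LinearIsometryEquiv.inner_map_map]

theorem P_periodic (k : Plane) (G : recip b) : N.P (k + (G : Plane)) = conjL (N.S G) (N.P k) := by
  simp only [P, map_sum, conjL_ketbra, N.u_periodic]

theorem area_periodic (k : Plane) (G : recip b) :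
    N.area (k + (G : Plane)) = conjL (N.S G) (N.area k) := by
  simp only [area, map_sum, conjL_smul, conjL_ketbra, N.u_periodic, N.C2T_S]

/-- The two sides agree up to a global sign by continuity. Orientability supplies a point `k₁` where
a closed Wilson line has determinant one, which fixes the sign for the base point `k₁`; any other
base point changes both sides by the same sign. -/
theorem Q₀_periodic_basis (horient : N.Orientable) (k₀ k : Plane) (j : Fin 2) :
    N.Q₀ k₀ (k + b j) = conjL (N.S ⟨b j, Submodule.subset_span ⟨j, rfl⟩⟩) (N.Q₀ k₀ k) := by
  set G : recip b := ⟨b j, Submodule.subset_span ⟨j, rfl⟩⟩ with hG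
  obtain ⟨k₁, hk₁⟩ := horient j
  have base : N.Q₀ k₁ (k₁ + b j) = conjL (N.S G) (N.Q₀ k₁ k₁) := by
    have he : N.eta k₁ (k₁ + b j) = N.eta k₁ k₁ := by
      rw [eta, eta, hk₁, wilson_self, Matrix.det_one]
    rw [Q₀_eq_phase, Q₀_eq_phase, phase, phase, he, conjL_smul, ← area_periodic]
  have all : ∀ k, conjL (N.S G) (N.Q₀ k₁ k) = N.Q₀ k₁ (k + b j) := by
    have := eq_or_eq_neg_of_continuous (f := fun k => conjL (N.S G) (N.Q₀ k₁ k))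
      (g := fun k => N.Q₀ k₁ (k + b j)) ((conjL (N.S G)).continuous.comp (N.continuous_Q₀ k₁))
      ((N.continuous_Q₀ k₁).comp (continuous_id.add continuous_const)) (fun k => ?_)
      (fun k => N.Q₀_ne_zero _ _)
    · refine this.resolve_right fun h => ?_
      have h1 := h k₁
      rw [← base] at h1
      exact N.Q₀_ne_zero _ _ (eq_zero_of_eq_neg h1)
    · have hp : N.phase k₁ k ^ 2 = N.phase k₁ (k + b j) ^ 2 := by
        rw [phase_sq, phase_sq]
        have := N.sew_periodic k G
        simp only [hG] at this
        rw [this]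
      have ha : N.area (k + b j) = conjL (N.S G) (N.area k) := N.area_periodic k G
      simp only [Q₀_eq_phase, conjL_smul, ha]
      rcases sq_eq_sq_iff_eq_or_eq_neg.1 hp with h | h
      · left; rw [h]
      · right; rw [h, neg_smul]
  rcases N.Q₀_change_base k₀ k₁ with h | h
  · rw [h, h, all]
  · rw [h, h, map_neg, all]

theorem pderivOp_periodic (i : Fin 2) (k : Plane) (G : recip b) :
    pderivOp i N.P (k + (G : Plane)) = conjL (N.S G) (pderivOp i N.P k) := by
  have hd : Differentiable ℝ N.P := N.contDiff_P.differentiable (by simp)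
  have e : (fun k => N.P (k + (G : Plane))) = fun k => conjL (N.S G) (N.P k) :=
    funext fun k => N.P_periodic k G
  have h1 := fderiv_comp_add_right (𝕜 := ℝ) (f := N.P) (x := k) (G : Plane)
  rw [e] at h1
  have h2 : fderiv ℝ (fun k => conjL (N.S G) (N.P k)) k
      = (conjL (N.S G)).comp (fderiv ℝ N.P k) :=
    ((conjL (N.S G)).hasFDerivAt.comp k (hd k).hasFDerivAt).fderiv
  rw [pderivOp, pderivOp, ← h1, h2]
  rfl

/-- The Hilbert bases chosen in the two spaces are unrelated, so invariance is checked on the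
rank-one decomposition supplied by the projector. -/
theorem opTrace_conjL {H' : Type*} [NormedAddCommGroup H'] [InnerProductSpace ℂ H']
    [CompleteSpace H'] (e : H ≃ₗᵢ[ℂ] H') (k : Plane) (Z : H →L[ℂ] H) :
    opTrace (conjL e (N.P k * Z)) = opTrace (N.P k * Z) := by
  rw [P_mul_eq, map_sum]
  simp only [conjL_ketbra]
  rw [(HasTrace.sum Finset.univ fun a _ => HasTrace.ketbra (e (N.u k a))
      (e (star Z (N.u k a)))).opTrace_eq,
    (HasTrace.sum Finset.univ fun a _ => HasTrace.ketbra (N.u k a)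
      (star Z (N.u k a))).opTrace_eq]
  simp only [LinearIsometryEquiv.inner_map_map]

theorem P_mul_Q₀ (k₀ k : Plane) : N.P k * N.Q₀ k₀ k = N.Q₀ k₀ k := by
  rw [Q₀_eq_phase, mul_smul_comm, P_mul_area]

theorem Q₀_mul_P (k₀ k : Plane) : N.Q₀ k₀ k * N.P k = N.Q₀ k₀ k := by
  rw [Q₀_eq_phase, smul_mul_assoc, area_mul_P]

theorem opTrace_conjL_Q₀ {H' : Type*} [NormedAddCommGroup H'] [InnerProductSpace ℂ H']
    [CompleteSpace H'] (e : H ≃ₗᵢ[ℂ] H') (k₀ k : Plane) (X Y : H →L[ℂ] H) :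
    opTrace (conjL e (N.Q₀ k₀ k) * conjL e X * conjL e Y) = opTrace (N.Q₀ k₀ k * X * Y) := by
  rw [← conjL_mul, ← conjL_mul, ← N.P_mul_Q₀, mul_assoc, mul_assoc, opTrace_conjL]

theorem Phi₀_periodic_basis (horient : N.Orientable) (k₀ k : Plane) (j : Fin 2) :
    N.Phi₀ k₀ (k + b j) = N.Phi₀ k₀ k := by
  have hd := fun i => N.pderivOp_periodic i k ⟨b j, Submodule.subset_span ⟨j, rfl⟩⟩
  simp only at hd
  rw [Phi₀, Phi₀, Q₀_periodic_basis N horient, hd, hd, opTrace_conjL_Q₀, opTrace_conjL_Q₀]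

theorem Phi₀_periodic (horient : N.Orientable) (k₀ k : Plane) (G : recip b) :
    N.Phi₀ k₀ (k + (G : Plane)) = N.Phi₀ k₀ k := by
  obtain ⟨G, hG⟩ := G
  show N.Phi₀ k₀ (k + G) = _
  induction hG using Submodule.span_induction generalizing k with
  | mem x h => obtain ⟨j, rfl⟩ := h; exact N.Phi₀_periodic_basis horient k₀ k j
  | zero => rw [add_zero]
  | add x y _ _ hx hy => rw [← add_assoc, hy, hx]
  | smul n x _ hx =>
    -- Needed for negative integer multiples of a lattice vector.
    have hneg : ∀ k, N.Phi₀ k₀ (k - x) = N.Phi₀ k₀ k := fun k => by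
      rw [← hx (k - x), sub_add_cancel]
    induction n using Int.induction_on generalizing k with
    | zero => rw [zero_smul, add_zero]
    | succ n ih => rw [add_smul, one_smul, ← add_assoc, hx, ih]
    | pred n ih => rw [sub_smul, one_smul, ← add_sub_assoc, hneg, ih]

end Valley

end FlatSC

/-! ### Quantum geometry: metric, Euler curvature, and smoothness without a smooth gauge -/

namespace FlatSC

namespace Valley

variable {b : Module.Basis (Fin 2) ℝ Plane} {H : Type*} [NormedAddCommGroup H]
  [InnerProductSpace ℂ H] [CompleteSpace H] (N : Valley b H)

/-! ### Derivatives of the projector -/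

theorem hasDerivAt_P_line (k v : Plane) (s : ℝ) :
    HasDerivAt (fun s : ℝ => N.P (k + s • v)) (fderiv ℝ N.P (k + s • v) v) s := by
  have hd : Differentiable ℝ N.P := N.contDiff_P.differentiable (by simp)
  have hl : HasDerivAt (fun s : ℝ => k + s • v) v s := by
    simpa using ((hasDerivAt_id s).smul_const v).const_add k
  exact (hd _).hasFDerivAt.comp_hasDerivAt s hl

theorem hasDerivAt_fderiv_P_line (k v : Plane) :
    ∃ P2 : H →L[ℂ] H, HasDerivAt (fun s : ℝ => fderiv ℝ N.P (k + s • v) v) P2 0 := by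
  have h1 : ContDiff ℝ 1 (fderiv ℝ N.P) := N.contDiff_P.fderiv_right (by norm_cast)
  have hd : Differentiable ℝ (fun x => fderiv ℝ N.P x v) :=
    (h1.differentiable (by norm_num)).clm_apply (differentiable_const v)
  have hl : HasDerivAt (fun s : ℝ => k + s • v) v 0 := by
    simpa using ((hasDerivAt_id (0 : ℝ)).smul_const v).const_add k
  exact ⟨_, (hd _).hasFDerivAt.comp_hasDerivAt 0 hl⟩

theorem fderiv_P_mul (k v : Plane) :
    fderiv ℝ N.P k v = fderiv ℝ N.P k v * N.P k + N.P k * fderiv ℝ N.P k v := by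
  have h := N.hasDerivAt_P_line k v 0
  have h2 := h.mul h
  have e : ((fun s : ℝ => N.P (k + s • v)) * fun s : ℝ => N.P (k + s • v))
      = fun s : ℝ => N.P (k + s • v) := by
    funext s; exact N.P_mul_P _
  rw [e] at h2
  simpa using h.unique h2

/-- Compressing `P' = P'P + PP'` to the bands gives `x = x + x`. This is why band overlaps have no
first-order term. -/
theorem P_fderiv_P (k v : Plane) : N.P k * fderiv ℝ N.P k v * N.P k = 0 := by
  have h := congrArg (fun Z => N.P k * Z * N.P k) (N.fderiv_P_mul k v)
  simp only [mul_add, add_mul, mul_assoc, N.P_mul_P] at h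
  simp only [← mul_assoc, N.P_mul_P] at h
  exact left_eq_add.1 h

theorem star_fderiv_P (k v : Plane) : star (fderiv ℝ N.P k v) = fderiv ℝ N.P k v := by
  have h := N.hasDerivAt_P_line k v 0
  have h2 := h.star
  have e : (fun s : ℝ => star (N.P (k + s • v))) = fun s : ℝ => N.P (k + s • v) := by
    funext s; exact N.star_P _
  rw [e] at h2
  simpa using h2.unique h

theorem inner_fderiv_P (k v : Plane) (x y : H) :
    inner ℂ (fderiv ℝ N.P k v x) y = inner ℂ x (fderiv ℝ N.P k v y) := by
  conv_rhs => rw [← N.star_fderiv_P, ContinuousLinearMap.star_eq_adjoint,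
    ContinuousLinearMap.adjoint_inner_right]

/-- `C₂z𝒯` as a real-linear map. -/
noncomputable def C2TL : H →L[ℝ] H where
  toFun := N.C2T
  map_add' := map_add N.C2T
  map_smul' r x := by
    rw [← Complex.coe_smul, LinearIsometry.map_smulₛₗ, Complex.conj_ofReal, Complex.coe_smul]
    rfl
  cont := N.C2T.continuous

theorem C2T_fderiv_P (k v : Plane) (x : H) :
    N.C2T (fderiv ℝ N.P k v x) = fderiv ℝ N.P k v (N.C2T x) := by
  have h := N.hasDerivAt_P_line k v 0
  have h1 := N.C2TL.hasFDerivAt.comp_hasDerivAt (0 : ℝ) (HasDerivAt.clm_apply_real h x)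
  have h2 := HasDerivAt.clm_apply_real h (N.C2T x)
  have e : (fun s : ℝ => N.P (k + s • v) (N.C2T x))
      = N.C2TL ∘ fun s : ℝ => N.P (k + s • v) x := by
    funext s; exact (N.C2T_P _ x).symm
  rw [e] at h2
  have h3 := h1.unique h2
  rw [zero_smul, add_zero] at h3
  exact h3

/-! ### The Fubini–Study metric -/

/-- Splitting the second factor as `P'P + PP'` gives one trace over the bands for each order of the
factors. For `v = w` they coincide and cancel the `½` in the metric. -/
theorem opTrace_fderiv_mul_fderiv (k v w : Plane) :
    opTrace (fderiv ℝ N.P k v * fderiv ℝ N.P k w)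
      = (N.mat k (fderiv ℝ N.P k v * fderiv ℝ N.P k w)).trace
        + (N.mat k (fderiv ℝ N.P k w * fderiv ℝ N.P k v)).trace := by
  have h := (N.hasTrace_mul_P k (fderiv ℝ N.P k v * fderiv ℝ N.P k w)).add
    (N.hasTrace_mul_P_mul k (fderiv ℝ N.P k v) (fderiv ℝ N.P k w))
  rw [← h.opTrace_eq]
  congr 1
  conv_lhs => rw [N.fderiv_P_mul k w]
  simp only [mul_add, mul_assoc]

theorem trace_mat_fderiv_sq (k v : Plane) :
    (N.mat k (fderiv ℝ N.P k v * fderiv ℝ N.P k v)).trace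
      = ((∑ a, ‖fderiv ℝ N.P k v (N.u k a)‖ ^ 2 : ℝ) : ℂ) := by
  simp only [Matrix.trace, Matrix.diag_apply, mat_apply, mul_apply_eq_comp]
  push_cast
  refine Finset.sum_congr rfl fun a _ => ?_
  rw [← inner_fderiv_P]
  exact inner_self_eq_norm_sq_to_K _

theorem metric_trace_eq_mat (k : Plane) :
    (N.metric k).trace = ∑ i, ((N.mat k (pderivOp i N.P k * pderivOp i N.P k)).trace).re := by
  simp only [Matrix.trace, Matrix.diag_apply, metric, Matrix.of_apply]
  refine Finset.sum_congr rfl fun i _ => ?_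
  have := N.opTrace_fderiv_mul_fderiv k (EuclideanSpace.single i 1) (EuclideanSpace.single i 1)
  rw [pderivOp, this]
  simp only [Matrix.trace, Matrix.diag_apply, Complex.add_re]
  ring

theorem metric_trace (k : Plane) :
    (N.metric k).trace = ∑ i, ∑ a, ‖pderivOp i N.P k (N.u k a)‖ ^ 2 := by
  rw [metric_trace_eq_mat]
  refine Finset.sum_congr rfl fun i _ => ?_
  rw [pderivOp, trace_mat_fderiv_sq, Complex.ofReal_re]

theorem metric_trace_nonneg (k : Plane) : 0 ≤ (N.metric k).trace := by
  rw [metric_trace]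
  positivity

/-! ### The Euler curvature -/

theorem opTrace_Q₀_mul (k₀ k : Plane) (Z : H →L[ℂ] H) :
    opTrace (N.Q₀ k₀ k * Z) = N.phase k₀ k *
      (inner ℂ (N.C2T (N.u k 0)) (Z (N.u k 1)) - inner ℂ (N.C2T (N.u k 1)) (Z (N.u k 0))) := by
  have h : N.Q₀ k₀ k * Z = N.phase k₀ k • ∑ a, ∑ c, eps a c •
      (ketbra (N.u k a) (star Z (N.C2T (N.u k c))) : H →L[ℂ] H) := by
    rw [Q₀_eq_phase]
    ext x
    simp only [area, smul_mul_assoc, mul_apply_eq_comp, _root_.sum_apply, _root_.smul_apply,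
      InnerProductSpace.rankOne_apply, ContinuousLinearMap.star_eq_adjoint,
      ContinuousLinearMap.adjoint_inner_left]
  rw [h, (HasTrace.smul _ (HasTrace.sum Finset.univ fun a _ => HasTrace.sum Finset.univ fun c _ =>
    HasTrace.smul (eps a c) (HasTrace.ketbra (N.u k a)
      (star Z (N.C2T (N.u k c)))))).opTrace_eq]
  simp [Fin.sum_univ_two, eps, ContinuousLinearMap.star_eq_adjoint,
    ContinuousLinearMap.adjoint_inner_left]
  left
  ring

/-- The first derivative is moved onto the bra, where it passes through the isometric C₂z𝒯;
Cauchy–Schwarz then does the rest. -/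
theorem norm_opTrace_Q₀_le (k₀ k v w : Plane) :
    ‖opTrace (N.Q₀ k₀ k * fderiv ℝ N.P k v * fderiv ℝ N.P k w)‖ ≤ ‖N.phase k₀ k‖ *
      (‖fderiv ℝ N.P k v (N.u k 0)‖ * ‖fderiv ℝ N.P k w (N.u k 1)‖
        + ‖fderiv ℝ N.P k v (N.u k 1)‖ * ‖fderiv ℝ N.P k w (N.u k 0)‖) := by
  have key : ∀ a c, ‖inner ℂ (N.C2T (N.u k a))
      ((fderiv ℝ N.P k v * fderiv ℝ N.P k w) (N.u k c))‖
      ≤ ‖fderiv ℝ N.P k v (N.u k a)‖ * ‖fderiv ℝ N.P k w (N.u k c)‖ := fun a c => by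
    rw [mul_apply_eq_comp, ← inner_fderiv_P, ← C2T_fderiv_P]
    refine (norm_inner_le_norm _ _).trans ?_
    rw [N.C2T.norm_map]
  rw [mul_assoc, opTrace_Q₀_mul, norm_mul]
  exact mul_le_mul_of_nonneg_left ((norm_sub_le _ _).trans (add_le_add (key 0 1) (key 1 0)))
    (norm_nonneg _)

/-- The prefactors `1/√2` and `|η|/√2` combine to `½`, and the products `x₀y₁`, `x₁y₀` of lengths of
`∂P|u⟩` are split by `2xy ≤ x² + y²` into exactly the squares that make up the metric trace. -/
theorem norm_Phi₀_le (k₀ k : Plane) : ‖N.Phi₀ k₀ k‖ ≤ 1 / 2 * (N.metric k).trace := by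
  have hx := N.norm_opTrace_Q₀_le k₀ k (EuclideanSpace.single 0 1) (EuclideanSpace.single 1 1)
  have hy := N.norm_opTrace_Q₀_le k₀ k (EuclideanSpace.single 1 1) (EuclideanSpace.single 0 1)
  rw [metric_trace]
  simp only [Fin.sum_univ_two, Phi₀, pderivOp]
  set x0 := ‖fderiv ℝ N.P k (EuclideanSpace.single 0 1) (N.u k 0)‖
  set x1 := ‖fderiv ℝ N.P k (EuclideanSpace.single 0 1) (N.u k 1)‖
  set y0 := ‖fderiv ℝ N.P k (EuclideanSpace.single 1 1) (N.u k 0)‖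
  set y1 := ‖fderiv ℝ N.P k (EuclideanSpace.single 1 1) (N.u k 1)‖
  have hr : ‖(1 / (Real.sqrt 2 : ℂ))‖ * ‖N.phase k₀ k‖ = 1 / 2 := by
    have h1 : ‖N.phase k₀ k‖ = 1 / Real.sqrt 2 := by
      rw [phase, norm_div, RCLike.norm_conj, norm_eta, Complex.norm_real,
        Real.norm_of_nonneg (Real.sqrt_nonneg 2)]
    rw [h1, norm_div, norm_one, Complex.norm_real, Real.norm_of_nonneg (Real.sqrt_nonneg 2),
      div_mul_div_comm, Real.mul_self_sqrt (by norm_num), one_mul]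
  rw [norm_mul]
  calc _ ≤ ‖(1 / (Real.sqrt 2 : ℂ))‖ * (‖N.phase k₀ k‖ * (x0 * y1 + x1 * y0)
        + ‖N.phase k₀ k‖ * (y0 * x1 + y1 * x0)) := by
        refine mul_le_mul_of_nonneg_left ?_ (norm_nonneg _)
        exact (norm_sub_le _ _).trans (add_le_add hx hy)
    _ = (‖(1 / (Real.sqrt 2 : ℂ))‖ * ‖N.phase k₀ k‖) * (2 * (x0 * y1 + x1 * y0)) := by ring
    _ ≤ _ := by
        rw [hr]
        nlinarith [sq_nonneg (x0 - y1), sq_nonneg (x1 - y0)]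

/-! ### Algebra of `Q` -/

/-- The matrix of `Q`. -/
theorem mat_Q₀ (k₀ k : Plane) : N.mat k (N.Q₀ k₀ k) = N.phase k₀ k • (eps * (N.sew k)ᴴ) := by
  rw [Q₀_eq_phase, mat_smul, mat_area]

theorem mat_Q₀_conjTranspose (k₀ k : Plane) :
    (N.mat k (N.Q₀ k₀ k))ᴴ = -N.mat k (N.Q₀ k₀ k) := by
  have heps : epsᴴ = -eps := by
    ext i j
    fin_cases i <;> fin_cases j <;> simp [eps]
  have h1 : N.sew k * eps = (N.sew k).det • (eps * (N.sew k)ᴴ) := by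
    have := mul_eps_mul_transpose (N.sew k)
    rw [N.sew_symm] at this
    rw [← smul_mul_assoc, ← this, mul_assoc, N.sew_mul_conjTranspose_sew, mul_one]
  have h2 : conj (N.phase k₀ k) * (N.sew k).det = N.phase k₀ k := by
    have e1 := N.phase_sq k₀ k
    have e2 : N.phase k₀ k * conj (N.phase k₀ k) = 1 / 2 := by
      rw [Complex.mul_conj, Complex.normSq_eq_norm_sq, norm_phase_sq]; norm_num
    linear_combination (-2 * conj (N.phase k₀ k)) * e1 + 2 * N.phase k₀ k * e2
  rw [mat_Q₀, Matrix.conjTranspose_smul, Matrix.conjTranspose_mul,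
    Matrix.conjTranspose_conjTranspose, heps, mul_neg, h1, smul_neg, smul_smul, RCLike.star_def, h2]

theorem mat_Q₀_mul (k₀ k : Plane) (Z : H →L[ℂ] H) :
    N.mat k (N.Q₀ k₀ k * Z) = N.mat k (N.Q₀ k₀ k) * N.mat k Z := by
  rw [← mat_mul_P_mul, Q₀_mul_P]

theorem opTrace_Q₀_eq_mat (k₀ k : Plane) (Z : H →L[ℂ] H) :
    opTrace (N.Q₀ k₀ k * Z) = (N.mat k (N.Q₀ k₀ k) * N.mat k Z).trace := by
  rw [← mat_Q₀_mul, ← (N.hasTrace_P_mul k (N.Q₀ k₀ k * Z)).opTrace_eq, ← mul_assoc, P_mul_Q₀]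

/-- `Q` is anti-Hermitian on the bands while the derivatives of `P` are Hermitian, so conjugation
exchanges the two orderings with a minus sign, which the antisymmetrization absorbs. -/
theorem conj_Phi₀ (k₀ k : Plane) : conj (N.Phi₀ k₀ k) = N.Phi₀ k₀ k := by
  have h : ∀ v w, conj (opTrace (N.Q₀ k₀ k * fderiv ℝ N.P k v * fderiv ℝ N.P k w))
      = -opTrace (N.Q₀ k₀ k * fderiv ℝ N.P k w * fderiv ℝ N.P k v) := fun v w => by
    rw [mul_assoc, mul_assoc, opTrace_Q₀_eq_mat, opTrace_Q₀_eq_mat, ← RCLike.star_def,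
      ← Matrix.trace_conjTranspose, Matrix.conjTranspose_mul, mat_Q₀_conjTranspose, ← mat_star,
      star_mul, star_fderiv_P, star_fderiv_P, mul_neg, Matrix.trace_neg, Matrix.trace_mul_comm]
  simp only [Phi₀, pderivOp, map_mul, map_sub, h, map_div₀, map_one, Complex.conj_ofReal]
  ring

theorem conj_eulerAt (k₀ : Plane) : conj (N.eulerAt k₀) = N.eulerAt k₀ := by
  rw [eulerAt, map_mul, ← integral_conj]
  simp only [conj_Phi₀, map_div₀, map_mul, map_one, map_ofNat, Complex.conj_ofReal]

/-- The sign of the Euler integral. -/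
theorem eulerSign_sq (k₀ : Plane) (h : N.eulerNumber k₀ ≠ 0) :
    (N.eulerAt k₀ / (N.eulerNumber k₀ : ℂ)) ^ 2 = 1 := by
  have e : N.eulerAt k₀ ^ 2 = (N.eulerNumber k₀ : ℂ) ^ 2 := by
    have := Complex.mul_conj (N.eulerAt k₀)
    rw [conj_eulerAt, Complex.normSq_eq_norm_sq] at this
    rw [pow_two, this, eulerNumber]
    push_cast; rfl
  rw [div_pow, e, div_self]
  exact pow_ne_zero 2 (Complex.ofReal_ne_zero.2 h)

/-! ### Smoothness of traces over the bands -/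

/-- The frame is arbitrary, but the trace is gauge invariant. Near `q₀` the frozen frame `w` can be
used instead: with `o` the overlaps of the moving frame with `w`, the frozen matrices are `g = o†o`
and `y = o† mat o`, so the trace equals `tr(g⁻¹ y)`, a rational expression in smooth entries. -/
theorem contDiff_trace_mat {E : Type*} [NormedAddCommGroup E] [NormedSpace ℝ E]
    {κ : E → Plane} (hκ : ContDiff ℝ ∞ κ) {Z : E → H →L[ℂ] H} (hZ : ContDiff ℝ ∞ Z) :
    ContDiff ℝ ∞ (fun q => (N.mat (κ q) (Z q)).trace) := by
  refine contDiff_iff_contDiffAt.2 fun q₀ => ?_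
  set w := N.u (κ q₀) with hw
  have hP : ContDiff ℝ ∞ fun q => N.P (κ q) := N.contDiff_P.comp hκ
  have hent : ∀ {Y : E → H →L[ℂ] H}, ContDiff ℝ ∞ Y → ∀ a c,
      ContDiff ℝ ∞ fun q => inner ℂ (w a) (Y q (w c)) := fun hY a c =>
    contDiff_const.inner ℂ (ContDiff.clm_apply_real hY (w c))
  set g : E → Matrix (Fin 2) (Fin 2) ℂ := fun q => Matrix.of fun a c =>
    inner ℂ (w a) (N.P (κ q) (w c)) with hg
  set y : E → Matrix (Fin 2) (Fin 2) ℂ := fun q => Matrix.of fun a c =>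
    inner ℂ (w a) ((N.P (κ q) * Z q * N.P (κ q)) (w c)) with hy
  have hgc : ∀ a c, ContDiff ℝ ∞ fun q => g q a c := fun a c => hent hP a c
  have hyc : ∀ a c, ContDiff ℝ ∞ fun q => y q a c := fun a c => hent ((hP.mul hZ).mul hP) a c
  have hdet : ContDiff ℝ ∞ fun q => (g q).det := by
    simp only [Matrix.det_fin_two]
    exact ((hgc 0 0).mul (hgc 1 1)).sub ((hgc 0 1).mul (hgc 1 0))
  have hdet0 : (g q₀).det ≠ 0 := by
    have : g q₀ = 1 := by
      ext a c
      simp only [hg, Matrix.of_apply, hw, P_u, inner_u, Matrix.one_apply]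
    rw [this, Matrix.det_one]
    exact one_ne_zero
  -- The adjugate replaces `g⁻¹`, so that the identity holds even where `g` is singular.
  have key : ∀ q, (g q).det * (N.mat (κ q) (Z q)).trace = ((g q).adjugate * y q).trace := by
    intro q
    set o : Matrix (Fin 2) (Fin 2) ℂ := Matrix.of fun a c => inner ℂ (N.u (κ q) a) (w c) with ho
    have e1 : g q = oᴴ * o := by
      ext a c
      simp [hg, ho, P_apply, Matrix.mul_apply, mul_comm]
    have e2 : y q = oᴴ * N.mat (κ q) (Z q) * o := by
      ext a c
      simp only [hy, Matrix.of_apply, mul_apply_eq_comp]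
      rw [← inner_P_left, P_apply, P_apply]
      simp only [Matrix.mul_apply, Fin.sum_univ_two, map_add, map_smul, inner_add_left,
        inner_add_right, inner_smul_left, inner_smul_right, inner_conj_symm, ho, mat_apply,
        Matrix.conjTranspose_apply, Matrix.of_apply, RCLike.star_def]
      ring
    rw [e2, e1, Matrix.adjugate_mul_distrib, Matrix.trace_mul_comm, Matrix.det_mul]
    have e3 : oᴴ * N.mat (κ q) (Z q) * o * (o.adjugate * oᴴ.adjugate)
        = (o.det) • (oᴴ * N.mat (κ q) (Z q) * oᴴ.adjugate) := by
      calc _ = oᴴ * N.mat (κ q) (Z q) * (o * o.adjugate) * oᴴ.adjugate := by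
            simp only [mul_assoc]
        _ = _ := by
            rw [Matrix.mul_adjugate, mul_smul_comm, mul_one, smul_mul_assoc]
    rw [e3, Matrix.trace_smul, Matrix.trace_mul_comm, ← mul_assoc, Matrix.adjugate_mul,
      smul_mul_assoc, one_mul, Matrix.trace_smul, smul_eq_mul, smul_eq_mul]
    ring
  have hnum : ContDiff ℝ ∞ fun q => ((g q).adjugate * y q).trace := by
    simp only [Matrix.trace_fin_two, Matrix.mul_apply, Fin.sum_univ_two, Matrix.adjugate_fin_two,
      Matrix.of_apply, Matrix.cons_val_zero, Matrix.cons_val_one, Matrix.cons_val',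
      Matrix.cons_val_fin_one]
    exact (((hgc 1 1).mul (hyc 0 0)).add ((hgc 0 1).neg.mul (hyc 1 0))).add
      (((hgc 1 0).neg.mul (hyc 0 1)).add ((hgc 0 0).mul (hyc 1 1)))
  have hev : (fun q => (N.mat (κ q) (Z q)).trace) =ᶠ[𝓝 q₀]
      fun q => ((g q).adjugate * y q).trace * ((g q).det)⁻¹ := by
    filter_upwards [hdet.continuous.continuousAt.eventually_ne hdet0] with q hq
    rw [← key q, mul_comm, inv_mul_cancel_left₀ hq]
  have hinv : ContDiffAt ℝ ∞ (fun q => ((g q).det)⁻¹) q₀ :=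
    ContDiffAt.inv hdet.contDiffAt hdet0
  exact (hnum.contDiffAt.mul hinv).congr_of_eventuallyEq hev

/-- In size two, `2 det M = (tr M)² - tr M²`, and `M²` is itself a compression once `P` is inserted
between the factors. -/
theorem contDiff_det_mat {E : Type*} [NormedAddCommGroup E] [NormedSpace ℝ E]
    {κ : E → Plane} (hκ : ContDiff ℝ ∞ κ) {Z : E → H →L[ℂ] H} (hZ : ContDiff ℝ ∞ Z) :
    ContDiff ℝ ∞ (fun q => (N.mat (κ q) (Z q)).det) := by
  have e : ∀ q, (N.mat (κ q) (Z q)).det = ((N.mat (κ q) (Z q)).trace ^ 2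
      - (N.mat (κ q) (Z q * N.P (κ q) * Z q)).trace) / 2 := fun q => by
    rw [mat_mul_P_mul, Matrix.det_fin_two, Matrix.trace_fin_two, Matrix.trace_fin_two]
    simp only [Matrix.mul_apply, Fin.sum_univ_two]
    ring
  simp only [e]
  have hP : ContDiff ℝ ∞ fun q => N.P (κ q) := N.contDiff_P.comp hκ
  exact (((N.contDiff_trace_mat hκ hZ).pow 2).sub
    (N.contDiff_trace_mat hκ ((hZ.mul hP).mul hZ))).div_const 2

theorem contDiff_metric_trace : ContDiff ℝ ∞ fun k => (N.metric k).trace := by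
  simp only [metric_trace_eq_mat]
  refine ContDiff.sum fun i _ => ?_
  have h1 : ContDiff ℝ ∞ (fun k => pderivOp i N.P k) :=
    (N.contDiff_P.fderiv_right (m := ∞) (by simp)).clm_apply contDiff_const
  exact Complex.reCLM.contDiff.comp (N.contDiff_trace_mat contDiff_id (h1.mul h1))

theorem integrableOn_metric_trace : IntegrableOn (fun k => (N.metric k).trace) (cell b) :=
  integrableOn_of_continuous_of_isBounded N.contDiff_metric_trace.continuous (isBounded_cell b)

/-- The Euler number bounds the quantum volume from below. -/
theorem eulerNumber_le (k₀ : Plane) :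
    4 * Real.pi * N.eulerNumber k₀ ≤ ∫ k in cell b, (N.metric k).trace := by
  have h1 : ‖∫ k in cell b, N.Phi₀ k₀ k‖ ≤ ∫ k in cell b, 1 / 2 * (N.metric k).trace :=
    norm_integral_le_of_norm_le (N.integrableOn_metric_trace.const_mul _)
      (Eventually.of_forall fun k => N.norm_Phi₀_le k₀ k)
  rw [integral_const_mul] at h1
  have h2 : ‖(1 / (2 * Real.pi : ℂ))‖ = 1 / (2 * Real.pi) := by
    rw [norm_div, norm_mul, Complex.norm_real, Real.norm_of_nonneg Real.pi_pos.le]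
    simp
  rw [eulerNumber, eulerAt, norm_mul, h2]
  have hpi := Real.pi_pos
  calc 4 * Real.pi * (1 / (2 * Real.pi) * ‖∫ k in cell b, N.Phi₀ k₀ k‖)
      = 2 * ‖∫ k in cell b, N.Phi₀ k₀ k‖ := by field_simp; ring
    _ ≤ _ := by linarith

end Valley

end FlatSC

namespace FlatSC

/-! ### Spectrum of the Bogoliubov–de Gennes matrix -/

section Spectrum

open Polynomial

/-- Right multiplication by a block lower triangular matrix clears the lower left block and leaves
the Schur complement `(x² - μ²) - BC`. The superfluous factor `(X - μ)^n` is a nonzero polynomial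
and is cancelled, which covers `x = μ` as well. -/
theorem charpoly_chiral {n : Type*} [Fintype n] [DecidableEq n] (B C : Matrix n n ℂ) (μ : ℂ) :
    (Matrix.fromBlocks (-(μ • 1)) B C (μ • 1)).charpoly
      = (B * C).charpoly.comp (X ^ 2 - Polynomial.C (μ ^ 2)) := by
  have hne : (X - Polynomial.C μ : ℂ[X]) ^ Fintype.card n ≠ 0 := pow_ne_zero _ (X_sub_C_ne_zero μ)
  refine mul_right_cancel₀ hne (Polynomial.funext fun x => ?_)
  rw [eval_mul, eval_mul, eval_comp, Matrix.eval_charpoly, Matrix.eval_charpoly]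
  simp only [eval_pow, eval_sub, eval_X, eval_C]
  have e1 : Matrix.scalar (n ⊕ n) x - Matrix.fromBlocks (-(μ • 1)) B C (μ • 1)
      = Matrix.fromBlocks ((x + μ) • (1 : Matrix n n ℂ)) (-B) (-C) ((x - μ) • 1) := by
    rw [Matrix.scalar_apply, ← Matrix.smul_one_eq_diagonal, ← Matrix.fromBlocks_one,
      Matrix.fromBlocks_smul, sub_eq_add_neg, Matrix.fromBlocks_neg, Matrix.fromBlocks_add]
    simp only [smul_zero, zero_add, neg_neg, add_smul, sub_eq_add_neg, neg_smul]
  have e2 : Matrix.scalar n (x ^ 2 - μ ^ 2) - B * C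
      = ((x + μ) * (x - μ)) • (1 : Matrix n n ℂ) - B * C := by
    rw [Matrix.scalar_apply, ← Matrix.smul_one_eq_diagonal]
    congr 2
    ring
  have e3 : Matrix.fromBlocks ((x + μ) • (1 : Matrix n n ℂ)) (-B) (-C) ((x - μ) • 1)
      * Matrix.fromBlocks ((x - μ) • (1 : Matrix n n ℂ)) 0 C 1
      = Matrix.fromBlocks (((x + μ) * (x - μ)) • (1 : Matrix n n ℂ) - B * C) (-B) 0
        ((x - μ) • 1) := by
    rw [Matrix.fromBlocks_multiply]
    congr 1 <;> simp [smul_smul, sub_eq_add_neg, mul_comm]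
  have h := congrArg Matrix.det e3
  rw [Matrix.det_mul, Matrix.det_fromBlocks_zero₁₂, Matrix.det_fromBlocks_zero₂₁, Matrix.det_smul,
    Matrix.det_one, mul_one, mul_one] at h
  rw [e1, e2]
  exact h

theorem charpoly_kronecker_one {m n : Type*} [Fintype m] [DecidableEq m] [Fintype n]
    [DecidableEq n] (B : Matrix m m ℂ) :
    (B ⊗ₖ (1 : Matrix n n ℂ)).charpoly = B.charpoly ^ Fintype.card n := by
  refine Polynomial.funext fun x => ?_
  rw [eval_pow, Matrix.eval_charpoly, Matrix.eval_charpoly]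
  have : Matrix.scalar (m × n) x - B ⊗ₖ (1 : Matrix n n ℂ)
      = (Matrix.scalar m x - B) ⊗ₖ (1 : Matrix n n ℂ) := by
    rw [Matrix.scalar_apply, Matrix.scalar_apply, ← Matrix.smul_one_eq_diagonal,
      ← Matrix.smul_one_eq_diagonal, ← Matrix.one_kronecker_one]
    ext ⟨a, c⟩ ⟨a', c'⟩
    rw [Matrix.one_kronecker_one, Matrix.kroneckerMap_apply, Matrix.sub_apply, Matrix.sub_apply,
      Matrix.smul_apply, Matrix.smul_apply, Matrix.kroneckerMap_apply, sub_mul,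
      ← Matrix.one_kronecker_one, Matrix.kroneckerMap_apply, smul_mul_assoc]
  rw [this, Matrix.det_kronecker, Matrix.det_one, one_pow, mul_one]

/-- The sum of the absolute values of the roots. -/
noncomputable def rootSum (p : ℂ[X]) : ℝ := (p.roots.map fun E => ‖E‖).sum

theorem rootSum_mul {p q : ℂ[X]} (hp : p ≠ 0) (hq : q ≠ 0) :
    rootSum (p * q) = rootSum p + rootSum q := by
  rw [rootSum, roots_mul (mul_ne_zero hp hq), Multiset.map_add, Multiset.sum_add]
  rfl

theorem rootSum_X_sub_C (z : ℂ) : rootSum (X - Polynomial.C z) = ‖z‖ := by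
  simp [rootSum]

theorem rootSum_sq_sub {y : ℝ} (hy : 0 ≤ y) :
    rootSum (X ^ 2 - Polynomial.C (y : ℂ)) = 2 * Real.sqrt y := by
  have e : (X ^ 2 - Polynomial.C (y : ℂ) : ℂ[X])
      = (X - Polynomial.C (Real.sqrt y : ℂ)) * (X - Polynomial.C (-(Real.sqrt y : ℂ))) := by
    have : (y : ℂ) = (Real.sqrt y : ℂ) * (Real.sqrt y : ℂ) := by
      rw [← Complex.ofReal_mul, Real.mul_self_sqrt hy]
    rw [this, Polynomial.C_mul, Polynomial.C_neg]
    ring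
  rw [e, rootSum_mul (X_sub_C_ne_zero _) (X_sub_C_ne_zero _), rootSum_X_sub_C, rootSum_X_sub_C,
    norm_neg, Complex.norm_real, Real.norm_of_nonneg (Real.sqrt_nonneg y)]
  ring

/-- The sum `√(μ² + y₁) + √(μ² + y₂)` in terms of `t = y₁ + y₂` and `d = y₁ y₂`. -/
noncomputable def energy (μ t d : ℝ) : ℝ :=
  Real.sqrt (2 * μ ^ 2 + t + 2 * Real.sqrt (μ ^ 4 + μ ^ 2 * t + d))

theorem energy_eq (μ : ℝ) {y₁ y₂ : ℝ} (h₁ : 0 ≤ y₁) (h₂ : 0 ≤ y₂) :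
    energy μ (y₁ + y₂) (y₁ * y₂) = Real.sqrt (μ ^ 2 + y₁) + Real.sqrt (μ ^ 2 + y₂) := by
  have a1 : 0 ≤ μ ^ 2 + y₁ := by positivity
  have a2 : 0 ≤ μ ^ 2 + y₂ := by positivity
  have e : μ ^ 4 + μ ^ 2 * (y₁ + y₂) + y₁ * y₂ = (μ ^ 2 + y₁) * (μ ^ 2 + y₂) := by ring
  -- The outer radicand is the square of the sum: the inner root is `√(μ² + y₁) √(μ² + y₂)`.
  rw [energy, e, Real.sqrt_mul a1, Real.sqrt_eq_iff_mul_self_eq (by positivity) (by positivity)]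
  nlinarith [Real.mul_self_sqrt a1, Real.mul_self_sqrt a2]

/-- The squares of the singular values of a `2 × 2` matrix. -/
theorem exists_singular_values (M : Matrix (Fin 2) (Fin 2) ℂ) : ∃ y₁ y₂ : ℝ, 0 ≤ y₁ ∧ y₁ ≤ y₂ ∧
    (M * Mᴴ).trace = ((y₁ + y₂ : ℝ) : ℂ) ∧ (M * Mᴴ).det = ((y₁ * y₂ : ℝ) : ℂ) := by
  set t : ℝ := ∑ a, ∑ c, ‖M a c‖ ^ 2 with ht
  set d : ℝ := ‖M.det‖ ^ 2 with hd
  have h1 : (M * Mᴴ).trace = (t : ℂ) := by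
    simp only [Matrix.trace, Matrix.diag_apply, Matrix.mul_apply, Matrix.conjTranspose_apply, ht,
      RCLike.star_def, Complex.mul_conj, Complex.normSq_eq_norm_sq]
    push_cast; rfl
  have h2 : (M * Mᴴ).det = (d : ℂ) := by
    rw [Matrix.det_mul, Matrix.det_conjTranspose, RCLike.star_def, Complex.mul_conj,
      Complex.normSq_eq_norm_sq]
  have ht0 : 0 ≤ t := by positivity
  have hd0 : 0 ≤ d := by positivity
  -- The discriminant is non-negative because `2|det M|` is at most the squared Frobenius norm; `y₁,
  -- y₂` are the roots of `y² - t y + d`.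
  have hdisc : 0 ≤ t ^ 2 - 4 * d := by
    have b1 : ‖M.det‖ ≤ ‖M 0 0‖ * ‖M 1 1‖ + ‖M 0 1‖ * ‖M 1 0‖ := by
      rw [Matrix.det_fin_two, ← norm_mul, ← norm_mul]
      exact norm_sub_le _ _
    have b2 : 2 * ‖M.det‖ ≤ t := by
      simp only [ht, Fin.sum_univ_two]
      nlinarith [sq_nonneg (‖M 0 0‖ - ‖M 1 1‖), sq_nonneg (‖M 0 1‖ - ‖M 1 0‖)]
    have : (2 * ‖M.det‖) ^ 2 ≤ t ^ 2 := pow_le_pow_left₀ (by positivity) b2 2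
    rw [hd]; linarith [mul_pow 2 ‖M.det‖ 2]
  have hs := Real.sqrt_nonneg (t ^ 2 - 4 * d)
  have hs2 := Real.sq_sqrt hdisc
  have hst : Real.sqrt (t ^ 2 - 4 * d) ≤ t := by
    rw [← Real.sqrt_sq ht0]
    exact Real.sqrt_le_sqrt (by rw [Real.sqrt_sq ht0]; linarith)
  refine ⟨(t - Real.sqrt (t ^ 2 - 4 * d)) / 2, (t + Real.sqrt (t ^ 2 - 4 * d)) / 2, by linarith,
    by linarith, ?_, ?_⟩
  · rw [h1]; congr 1; ring
  · rw [h2]; congr 1; nlinarith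

theorem rootSum_charpoly_comp (μ : ℝ) (M : Matrix (Fin 2) (Fin 2) ℂ) :
    (M * Mᴴ).charpoly.comp (X ^ 2 - Polynomial.C ((μ : ℂ) ^ 2)) ≠ 0 ∧
    rootSum ((M * Mᴴ).charpoly.comp (X ^ 2 - Polynomial.C ((μ : ℂ) ^ 2)))
      = 2 * energy μ (M * Mᴴ).trace.re (M * Mᴴ).det.re := by
  obtain ⟨y₁, y₂, h1, h12, ht, hd⟩ := exists_singular_values M
  have h2 := h1.trans h12
  have e : (M * Mᴴ).charpoly.comp (X ^ 2 - Polynomial.C ((μ : ℂ) ^ 2))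
      = (X ^ 2 - Polynomial.C ((μ ^ 2 + y₁ : ℝ) : ℂ))
        * (X ^ 2 - Polynomial.C ((μ ^ 2 + y₂ : ℝ) : ℂ)) := by
    rw [Matrix.charpoly_fin_two, ht, hd]
    simp only [sub_comp, add_comp, mul_comp, pow_comp, X_comp, C_comp]
    push_cast
    simp only [Polynomial.C_add, Polynomial.C_mul, Polynomial.C_pow]
    ring
  have n1 : ∀ z : ℂ, (X ^ 2 - Polynomial.C z : ℂ[X]) ≠ 0 := fun z =>
    X_pow_sub_C_ne_zero (by norm_num) z
  rw [e]
  refine ⟨mul_ne_zero (n1 _) (n1 _), ?_⟩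
  rw [rootSum_mul (n1 _) (n1 _), rootSum_sq_sub (by positivity), rootSum_sq_sub (by positivity),
    ht, hd, Complex.ofReal_re, Complex.ofReal_re, energy_eq μ h1 h2]
  ring

end Spectrum

/-! ### The free energy of flat bands -/

section TwoValleys

variable {b : Module.Basis (Fin 2) ℝ Plane}
  {Hp Hm : Type*} [NormedAddCommGroup Hp] [InnerProductSpace ℂ Hp] [CompleteSpace Hp]
  [NormedAddCommGroup Hm] [InnerProductSpace ℂ Hm] [CompleteSpace Hm]
  {Np : Valley b Hp} {Nm : Valley b Hm}

namespace Pairing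

variable (D : Pairing Np Nm)

/-- The spinless intervalley block of the gap matrix in a vector field. -/
noncomputable def block (A k : Plane) : Matrix (Fin 2) (Fin 2) ℂ :=
  Np.overlap (k + A) k * D.Δ k * (Nm.overlap (-k + A) (-k))ᵀ

theorem gapA_eq (A k : Plane) :
    D.gapA A k = Matrix.fromBlocks 0 (D.block A k ⊗ₖ D.Pi) (-((D.block A (-k))ᵀ ⊗ₖ D.Piᵀ)) 0 := by
  simp only [gapA, overlapFull, gap, Matrix.fromBlocks_transpose, Matrix.fromBlocks_multiply,
    ← Matrix.kroneckerMap_transpose, Matrix.transpose_zero, Matrix.transpose_one,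
    Matrix.zero_mul, Matrix.mul_zero, add_zero, zero_add, Matrix.mul_neg, Matrix.neg_mul,
    ← Matrix.mul_kronecker_mul, Matrix.one_mul, Matrix.mul_one, block, neg_neg,
    Matrix.transpose_mul, Matrix.transpose_transpose, mul_assoc, neg_zero]

theorem gapA_mul_conjTranspose (A k : Plane) :
    D.gapA A k * (D.gapA A k)ᴴ = Matrix.fromBlocks
      ((D.block A k * (D.block A k)ᴴ) ⊗ₖ (1 : Matrix (Fin 2) (Fin 2) ℂ)) 0 0
      (((D.block A (-k))ᵀ * ((D.block A (-k))ᵀ)ᴴ) ⊗ₖ (1 : Matrix (Fin 2) (Fin 2) ℂ)) := by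
  have h1 : D.Pi * D.Piᴴ = 1 := mul_eq_one_comm.1 D.Pi_unitary
  have h2 : D.Piᵀ * (D.Piᵀ)ᴴ = 1 := by
    have := congrArg Matrix.transpose D.Pi_unitary
    rw [Matrix.transpose_mul, Matrix.transpose_one] at this
    exact this
  rw [gapA_eq, Matrix.fromBlocks_conjTranspose, Matrix.fromBlocks_multiply]
  simp only [Matrix.conjTranspose_zero, Matrix.zero_mul, Matrix.mul_zero, add_zero, zero_add,
    Matrix.conjTranspose_neg, Matrix.neg_mul, Matrix.mul_neg, neg_neg,
    Matrix.conjTranspose_kronecker, ← Matrix.mul_kronecker_mul, h1, h2, neg_zero]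

/-- The sum of the two non-negative quasiparticle energies of one spin species of the pair of
states at `k` in valley `+` and at `-k` in valley `-`. -/
noncomputable def pairEnergy (μ : ℝ) (A k : Plane) : ℝ :=
  energy μ (D.block A k * (D.block A k)ᴴ).trace.re (D.block A k * (D.block A k)ᴴ).det.re

theorem hFull_eq_zero (flat_p : Np.Flat) (flat_m : Nm.Flat) (k : Plane) : hFull Np Nm k = 0 := by
  rw [hFull, flat_p k, flat_m k, Matrix.zero_kronecker, Matrix.fromBlocks_zero]

/-- The factor 4 is two for the signs of the energies times two for spin. The two valley blocks of
`D D†` give the contributions of `k` and `-k`. -/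
theorem rootSum_bdg (flat_p : Np.Flat) (flat_m : Nm.Flat) (μ : ℝ) (A k : Plane) :
    ((D.bdg μ A k).charpoly.roots.map (fun E => ‖E‖)).sum
      = 4 * (D.pairEnergy μ A k + D.pairEnergy μ A (-k)) := by
  have e : D.bdg μ A k = Matrix.fromBlocks (-((μ : ℂ) • 1)) (D.gapA A k) (D.gapA A k)ᴴ
      ((μ : ℂ) • 1) := by
    rw [bdg, hFull_eq_zero flat_p flat_m, hFull_eq_zero flat_p flat_m, zero_sub, ← Matrix.transpose_neg,
      neg_neg, Matrix.transpose_smul, Matrix.transpose_one]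
  rw [e, charpoly_chiral, gapA_mul_conjTranspose, Matrix.charpoly_fromBlocks_zero₁₂,
    charpoly_kronecker_one, charpoly_kronecker_one, Polynomial.mul_comp, Polynomial.pow_comp,
    Polynomial.pow_comp, Fintype.card_fin, pow_two (Polynomial.comp _ _),
    pow_two (Polynomial.comp _ _)]
  obtain ⟨n1, r1⟩ := rootSum_charpoly_comp μ (D.block A k)
  obtain ⟨n2, r2⟩ := rootSum_charpoly_comp μ (D.block A (-k))ᵀ
  have et : ((D.block A (-k))ᵀ * ((D.block A (-k))ᵀ)ᴴ).trace
      = (D.block A (-k) * (D.block A (-k))ᴴ).trace := by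
    simp only [Matrix.trace_fin_two, Matrix.mul_apply, Fin.sum_univ_two, Matrix.transpose_apply,
      Matrix.conjTranspose_apply]
    ring
  have ed : ((D.block A (-k))ᵀ * ((D.block A (-k))ᵀ)ᴴ).det
      = (D.block A (-k) * (D.block A (-k))ᴴ).det := by
    rw [Matrix.det_mul, Matrix.det_mul, Matrix.det_transpose, Matrix.det_conjTranspose,
      Matrix.det_conjTranspose, Matrix.det_transpose]
  rw [et, ed] at r2
  change rootSum _ = _
  rw [rootSum_mul (mul_ne_zero n1 n1) (mul_ne_zero n2 n2), rootSum_mul n1 n1, rootSum_mul n2 n2,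
    r1, r2, pairEnergy, pairEnergy]
  ring

theorem _root_.FlatSC.Valley.overlap_periodic {H : Type*} [NormedAddCommGroup H]
    [InnerProductSpace ℂ H] [CompleteSpace H] (N : Valley b H) (k' k : Plane) (G : recip b) :
    N.overlap (k' + (G : Plane)) (k + (G : Plane)) = N.overlap k' k := by
  ext a c
  simp only [Valley.overlap, Matrix.of_apply, N.u_periodic, LinearIsometryEquiv.inner_map_map]

theorem block_periodic (A k : Plane) (G : recip b) :
    D.block A (k + (G : Plane)) = D.block A k := by
  have h1 := Np.overlap_periodic (k + A) k G
  have h2 := Nm.overlap_periodic (-k + A) (-k) (-G)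
  have e1 : k + A + (G : Plane) = k + (G : Plane) + A := by abel
  have e2 : -k + A + ((-G : recip b) : Plane) = -(k + (G : Plane)) + A := by
    rw [Submodule.coe_neg]; abel
  have e3 : -k + ((-G : recip b) : Plane) = -(k + (G : Plane)) := by
    rw [Submodule.coe_neg]; abel
  rw [e1] at h1
  rw [e2, e3] at h2
  rw [block, block, h1, h2, D.periodic]

theorem pairEnergy_periodic (μ : ℝ) (A k : Plane) (G : recip b) :
    D.pairEnergy μ A (k + (G : Plane)) = D.pairEnergy μ A k := by
  rw [pairEnergy, pairEnergy, block_periodic]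

/-- The contribution of `-k` integrates to that of `k` by periodicity. The constant `4μ` is half of
`μ` times the eight flat-band indices. -/
theorem freeEnergy_eq (flat_p : Np.Flat) (flat_m : Nm.Flat) (μ : ℝ) (A : Plane)
    (hc : Continuous (D.pairEnergy μ A)) :
    D.freeEnergy μ A
      = (1 / (2 * Real.pi) ^ 2) * ∫ k in cell b, (-2 * D.pairEnergy μ A k - 4 * μ) := by
  have e : ∀ k, (-(1 / 4) * ((D.bdg μ A k).charpoly.roots.map (fun E => ‖E‖)).sum
      + (1 / 2) * (Matrix.trace (hFull Np Nm (k + A) - (μ : ℂ) • (1 : Matrix Ix Ix ℂ))).re)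
      = -D.pairEnergy μ A k + (-D.pairEnergy μ A (-k) - 4 * μ) := fun k => by
    rw [rootSum_bdg D flat_p flat_m, hFull_eq_zero flat_p flat_m, zero_sub, Matrix.trace_neg,
      Matrix.trace_smul, Matrix.trace_one]
    have : ((Fintype.card Ix : ℕ) : ℂ) = 8 := by norm_num [Ix]
    rw [this]
    simp
    ring
  have i1 : IntegrableOn (D.pairEnergy μ A) (cell b) :=
    integrableOn_of_continuous_of_isBounded hc (isBounded_cell b)
  have i2 : IntegrableOn (fun k => D.pairEnergy μ A (-k)) (cell b) :=
    integrableOn_of_continuous_of_isBounded (hc.comp continuous_neg) (isBounded_cell b)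
  have i3 : IntegrableOn (fun _ : Plane => 4 * μ) (cell b) :=
    integrableOn_of_continuous_of_isBounded continuous_const (isBounded_cell b)
  have h := setIntegral_cell_comp_neg b (f := D.pairEnergy μ A) (D.pairEnergy_periodic μ A)
  rw [freeEnergy]
  simp only [e]
  congr 1
  have i1n : IntegrableOn (fun k => -D.pairEnergy μ A k) (cell b) := i1.neg
  have i2n : IntegrableOn (fun k => -D.pairEnergy μ A (-k)) (cell b) := i2.neg
  have i2s : IntegrableOn (fun k => -D.pairEnergy μ A (-k) - 4 * μ) (cell b) := i2n.sub i3
  rw [integral_add i1n i2s, integral_sub i2n i3, integral_neg, integral_neg, h,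
    integral_sub (i1.const_mul (-2)) i3, integral_const_mul (-2 : ℝ)]
  ring

end Pairing

end TwoValleys

end FlatSC

namespace FlatSC

/-! ### Smooth dependence on the vector field, with everything carried to valley `+` -/

section TwoValleys

variable {b : Module.Basis (Fin 2) ℝ Plane}
  {Hp Hm : Type*} [NormedAddCommGroup Hp] [InnerProductSpace ℂ Hp] [CompleteSpace Hp]
  [NormedAddCommGroup Hm] [InnerProductSpace ℂ Hm] [CompleteSpace Hm]
  {Np : Valley b Hp} {Nm : Valley b Hm}

/-- The linear map `x ⊗ y ↦ |x⟩⟨K y|`. -/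
noncomputable def tensorToOp (K : Hm →ₛₗᵢ[starRingEnd ℂ] Hm) :
    (Hp ⊗[ℂ] Hm) →ₗ[ℂ] (Hm →L[ℂ] Hp) :=
  TensorProduct.lift (LinearMap.mk₂ ℂ (fun x y => (ketbra x (K y) : Hm →L[ℂ] Hp))
    (fun x x' y => by ext v; simp) (fun z x y => by ext v; simp [smul_smul, mul_comm])
    (fun x y y' => by ext v; simp)
    (fun z x y => by ext v; simp [LinearIsometry.map_smulₛₗ, smul_smul]))

theorem tensorToOp_tmul (K : Hm →ₛₗᵢ[starRingEnd ℂ] Hm) (x : Hp) (y : Hm) :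
    tensorToOp K (x ⊗ₜ[ℂ] y) = ketbra x (K y) := rfl

theorem inner_tensorToOp (K : Hm →ₛₗᵢ[starRingEnd ℂ] Hm) (hK : ∀ x, K (K x) = x)
    (Ψ : Hp ⊗[ℂ] Hm) (w : Hp) (v : Hm) :
    inner ℂ w (tensorToOp K Ψ v) = inner ℂ (w ⊗ₜ[ℂ] K v) Ψ := by
  induction Ψ using TensorProduct.induction_on with
  | zero => simp
  | tmul x y =>
    rw [tensorToOp_tmul, InnerProductSpace.rankOne_apply, inner_smul_right,
      TensorProduct.inner_tmul, mul_comm]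
    congr 1
    have h := inner_antiunitary K y (K v)
    rwa [hK] at h
  | add x y hx hy => rw [map_add, _root_.add_apply, inner_add_right, hx, hy,
      inner_add_right]

/-- Smoothness is assumed for the two-particle vector; boundedness of this map transfers it to the
operator `P_Δ`. The bound follows by testing the output against itself. -/
theorem norm_tensorToOp_le (K : Hm →ₛₗᵢ[starRingEnd ℂ] Hm) (hK : ∀ x, K (K x) = x)
    (Ψ : Hp ⊗[ℂ] Hm) : ‖tensorToOp K Ψ‖ ≤ 1 * ‖Ψ‖ := by
  rw [one_mul]
  refine ContinuousLinearMap.opNorm_le_bound _ (norm_nonneg _) fun v => ?_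
  set w := tensorToOp K Ψ v with hw
  have h1 : ‖w‖ ^ 2 ≤ ‖w‖ * ‖v‖ * ‖Ψ‖ := by
    have h2 : (inner ℂ w w : ℂ) = inner ℂ (w ⊗ₜ[ℂ] K v) Ψ := inner_tensorToOp K hK Ψ w v
    have h3 : ‖(inner ℂ w w : ℂ)‖ = ‖w‖ ^ 2 := by
      rw [inner_self_eq_norm_sq_to_K (𝕜 := ℂ)]; simp
    rw [← h3, h2]
    refine (norm_inner_le_norm (𝕜 := ℂ) (w ⊗ₜ[ℂ] K v) Ψ).trans (le_of_eq ?_)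
    rw [TensorProduct.norm_tmul, K.norm_map]
  rcases (norm_nonneg w).eq_or_lt with h0 | h0
  · rw [← h0]; positivity
  · nlinarith

namespace Pairing

variable (D : Pairing Np Nm)

theorem contDiff_PΔ : ContDiff ℝ ∞ D.PΔ := by
  set Θ : (Hp ⊗[ℂ] Hm) →L[ℂ] (Hm →L[ℂ] Hp) :=
    (tensorToOp Nm.C2T).mkContinuous 1 (norm_tensorToOp_le Nm.C2T Nm.C2T_sq) with hΘ
  have h := ((Θ.restrictScalars ℝ).contDiff (n := ∞)).comp D.smooth
  have e : D.PΔ = (Θ.restrictScalars ℝ) ∘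
      fun k => ∑ a, ∑ c, D.Δ k a c • (Np.u k a ⊗ₜ[ℂ] Nm.u (-k) c) := by
    funext k
    simp only [Function.comp_apply, ContinuousLinearMap.coe_restrictScalars', map_sum, map_smul]
    rfl
  rw [e]
  exact h

variable (σ : C2zSymmetry Np Nm)

/-- The pairing as an operator on the orbitals of valley `+`. -/
noncomputable def op (k : Plane) : Hp →L[ℂ] Hp :=
  D.PΔ k ∘L (σ.C.toContinuousLinearEquiv : Hp →L[ℂ] Hm)

theorem contDiff_op : ContDiff ℝ ∞ (D.op σ) :=
  ((((ContinuousLinearMap.compL ℂ Hp Hm Hp).flip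
    (σ.C.toContinuousLinearEquiv : Hp →L[ℂ] Hm)).restrictScalars ℝ).contDiff).comp D.contDiff_PΔ

theorem _root_.FlatSC.C2zSymmetry.conjL_P (k : Plane) : conjL σ.C (Np.P k) = Nm.P (-k) := by
  have hU : (σ.U k : Matrix (Fin 2) (Fin 2) ℂ) * (σ.U k : Matrix (Fin 2) (Fin 2) ℂ)ᴴ = 1 :=
    Matrix.mem_unitaryGroup_iff.1 (σ.U k).2
  have h : ∀ c d : Fin 2, ∑ a, (σ.U k : Matrix (Fin 2) (Fin 2) ℂ) c a
      * conj ((σ.U k : Matrix (Fin 2) (Fin 2) ℂ) d a) = if c = d then 1 else 0 := fun c d => by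
    rw [← Matrix.one_apply, ← hU]; rfl
  simp only [Valley.P, map_sum, conjL_ketbra, σ.C_u]
  ext x
  have h00 := h 0 0
  have h01 := h 0 1
  have h10 := h 1 0
  have h11 := h 1 1
  simp only [Fin.sum_univ_two, Fin.isValue, if_true, zero_ne_one, one_ne_zero, if_false] at h00 h01 h10 h11
  simp only [Fin.sum_univ_two, _root_.add_apply, InnerProductSpace.rankOne_apply, inner_smul_left]
  set U := (σ.U k : Matrix (Fin 2) (Fin 2) ℂ)
  set p := inner ℂ (Nm.u (-k) 0) x
  set q := inner ℂ (Nm.u (-k) 1) x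
  calc _ = ((U 0 0 * conj (U 0 0) + U 0 1 * conj (U 0 1)) * p
          + (U 0 0 * conj (U 1 0) + U 0 1 * conj (U 1 1)) * q) • Nm.u (-k) 0
        + ((U 1 0 * conj (U 0 0) + U 1 1 * conj (U 0 1)) * p
          + (U 1 0 * conj (U 1 0) + U 1 1 * conj (U 1 1)) * q) • Nm.u (-k) 1 := by module
    _ = _ := by rw [h00, h01, h10, h11]; module

/-- The overlaps `⟨u^{C₂z𝒯}_{-,-k}|C₂z u_{+,k}⟩`. -/
noncomputable def _root_.FlatSC.C2zSymmetry.link (k : Plane) : Matrix (Fin 2) (Fin 2) ℂ :=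
  Matrix.of fun c a => inner ℂ (Nm.C2T (Nm.u (-k) c)) (σ.C (Np.u k a))

theorem mat_op (k : Plane) : Np.mat k (D.op σ k) = D.Δ k * σ.link k := by
  ext a c
  have hn := (Np.u_orthonormal k).1
  simp only [Valley.mat_apply, op, PΔ, C2zSymmetry.link, Matrix.mul_apply, Matrix.of_apply,
    ContinuousLinearMap.comp_apply, _root_.sum_apply, _root_.smul_apply,
    InnerProductSpace.rankOne_apply, inner_sum, inner_smul_right, Valley.inner_u]
  fin_cases a <;> simp

theorem P_mul_op (k : Plane) : Np.P k * D.op σ k = D.op σ k := by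
  ext x
  simp only [mul_apply_eq_comp, op, PΔ, ContinuousLinearMap.comp_apply, _root_.sum_apply,
    _root_.smul_apply, InnerProductSpace.rankOne_apply, map_sum, map_smul, Valley.P_u]

theorem op_mul_P (k : Plane) : D.op σ k * Np.P k = D.op σ k := by
  ext x
  have h : σ.C (Np.P k x) = Nm.P (-k) (σ.C x) := by
    rw [← σ.conjL_P, conjL_apply, LinearIsometryEquiv.symm_apply_apply]
  simp only [mul_apply_eq_comp, op, PΔ, ContinuousLinearMap.comp_apply, _root_.sum_apply,
    _root_.smul_apply, InnerProductSpace.rankOne_apply]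
  have h2 : ((σ.C.toContinuousLinearEquiv : Hp →L[ℂ] Hm)) (Np.P k x) = Nm.P (-k) (σ.C x) := h
  rw [h2]
  simp only [← Nm.inner_P_left, ← Nm.C2T_P, Valley.P_u]
  rfl

theorem _root_.FlatSC.Valley.overlap_conjTranspose_mul {H : Type*} [NormedAddCommGroup H]
    [InnerProductSpace ℂ H] [CompleteSpace H] (N : Valley b H) (k' k : Plane) :
    (N.overlap k' k)ᴴ * N.overlap k' k = N.mat k (N.P k') := by
  ext a c
  simp [Valley.overlap, Valley.mat_apply, Valley.P_apply, Matrix.mul_apply, mul_comm]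

/-- C₂z𝒯 reverses inner products, which accounts for the transpose, and C₂z reverses momenta, so
valley `-` at `-k + A` becomes valley `+` at `k - A`. The pair thus probes the projector at both `k
+ A` and `k - A`. -/
theorem _root_.FlatSC.C2zSymmetry.transpose_mat_P (A k : Plane) :
    (Nm.mat (-k) (Nm.P (-k + A)))ᵀ
      = σ.link k * Np.mat k (Np.P (k + -A)) * (σ.link k)ᴴ := by
  have e : -k + A = -(k + -A) := by abel
  set v : Fin 2 → Hp := fun c => σ.C.symm (Nm.C2T (Nm.u (-k) c)) with hv
  have hPv : ∀ c, Np.P k (v c) = v c := fun c => by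
    apply σ.C.injective
    have := congrArg (fun Z => Z (Nm.C2T (Nm.u (-k) c))) (σ.conjL_P k)
    simp only [conjL_apply] at this
    rw [hv, this, ← Nm.C2T_P, Valley.P_u, LinearIsometryEquiv.apply_symm_apply]
  have hX : ∀ c a, σ.link k c a = inner ℂ (v c) (Np.u k a) := fun c a => by
    rw [C2zSymmetry.link, Matrix.of_apply, hv, ← σ.C.inner_map_map,
      LinearIsometryEquiv.apply_symm_apply]
  ext c c'
  have lhs : (Nm.mat (-k) (Nm.P (-k + A)))ᵀ c c' = inner ℂ (v c) (Np.P (k + -A) (v c')) := by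
    rw [Matrix.transpose_apply, Valley.mat_apply, ← Nm.inner_C2T, Nm.C2T_P, Nm.inner_P_left, e,
      ← σ.conjL_P, conjL_apply, ← σ.C.inner_map_map, LinearIsometryEquiv.apply_symm_apply]
  rw [lhs, ← hPv c, ← hPv c', Np.inner_P_left, Np.P_apply k (v c'), map_sum, Np.P_apply, inner_sum]
  simp only [Matrix.mul_apply, Matrix.conjTranspose_apply, hX, Valley.mat_apply, RCLike.star_def,
    inner_conj_symm, map_smul, inner_smul_right, Fin.sum_univ_two,
    inner_add_right]
  ring

/-- Trace and determinant of the squared intervalley block, in terms of the pairing operator. -/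
theorem block_mul_conjTranspose (A k : Plane) :
    (D.block A k * (D.block A k)ᴴ).trace
      = (Np.mat k (Np.P (k + A)) * Np.mat k (D.op σ k) * Np.mat k (Np.P (k + -A))
          * (Np.mat k (D.op σ k))ᴴ).trace ∧
    (D.block A k * (D.block A k)ᴴ).det
      = (Np.mat k (Np.P (k + A)) * Np.mat k (D.op σ k) * Np.mat k (Np.P (k + -A))
          * (Np.mat k (D.op σ k))ᴴ).det := by
  have h1 : (Nm.overlap (-k + A) (-k))ᵀ * ((Nm.overlap (-k + A) (-k))ᵀ)ᴴ
      = σ.link k * Np.mat k (Np.P (k + -A)) * (σ.link k)ᴴ := by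
    rw [← σ.transpose_mat_P, ← Valley.overlap_conjTranspose_mul, Matrix.transpose_mul]
    rfl
  have h2 : D.block A k * (D.block A k)ᴴ = Np.overlap (k + A) k *
      (Np.mat k (D.op σ k) * Np.mat k (Np.P (k + -A)) * (Np.mat k (D.op σ k))ᴴ
        * (Np.overlap (k + A) k)ᴴ) := by
    calc _ = Np.overlap (k + A) k * (D.Δ k * ((Nm.overlap (-k + A) (-k))ᵀ
          * ((Nm.overlap (-k + A) (-k))ᵀ)ᴴ) * (D.Δ k)ᴴ * (Np.overlap (k + A) k)ᴴ) := by
          simp only [block, Matrix.conjTranspose_mul, mul_assoc]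
      _ = _ := by
          rw [h1, mat_op, Matrix.conjTranspose_mul]
          simp only [mul_assoc]
  rw [h2]
  constructor
  · rw [Matrix.trace_mul_comm, mul_assoc, Valley.overlap_conjTranspose_mul, Matrix.trace_mul_comm]
    simp only [mul_assoc]
  · rw [← Np.overlap_conjTranspose_mul (k + A) k]
    simp only [Matrix.det_mul]
    ring

/-- The pairing operator starts and ends in the bands at `k`, so the inserted copies of `P(k)`
disappear. What remains is the compression of one smooth operator, suitable for
`contDiff_trace_mat`. -/
theorem mat_pairing_product (A k : Plane) :
    Np.mat k (Np.P (k + A)) * Np.mat k (D.op σ k) * Np.mat k (Np.P (k + -A))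
          * (Np.mat k (D.op σ k))ᴴ
      = Np.mat k (Np.P (k + A) * D.op σ k * Np.P (k + -A) * star (D.op σ k)) := by
  rw [← Valley.mat_star, ← Valley.mat_mul_P_mul, ← Valley.mat_mul_P_mul, ← Valley.mat_mul_P_mul]
  have h : Np.P k * star (D.op σ k) = star (D.op σ k) := by
    conv_rhs => rw [← D.op_mul_P σ, star_mul, Np.star_P]
  have e1 : Np.P (k + A) * Np.P k * D.op σ k = Np.P (k + A) * D.op σ k := by
    rw [mul_assoc, P_mul_op]
  rw [e1, mul_assoc (Np.P (k + A)) (D.op σ k) (Np.P k), op_mul_P, mul_assoc _ (Np.P k), h]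

theorem contDiff_pairing_product :
    ContDiff ℝ ∞ (fun q : Plane × Plane =>
      Np.P (q.2 + q.1) * D.op σ q.2 * Np.P (q.2 + -q.1) * star (D.op σ q.2)) := by
  have h1 : ContDiff ℝ ∞ (fun q : Plane × Plane => Np.P (q.2 + q.1)) :=
    Np.contDiff_P.comp (contDiff_snd.add contDiff_fst)
  have h2 : ContDiff ℝ ∞ (fun q : Plane × Plane => Np.P (q.2 + -q.1)) :=
    Np.contDiff_P.comp (contDiff_snd.add contDiff_fst.neg)
  have h3 : ContDiff ℝ ∞ (fun q : Plane × Plane => D.op σ q.2) :=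
    (D.contDiff_op σ).comp contDiff_snd
  have h4 : ContDiff ℝ ∞ (fun q : Plane × Plane => star (D.op σ q.2)) :=
    ((starL' ℝ : (Hp →L[ℂ] Hp) ≃L[ℝ] (Hp →L[ℂ] Hp)).contDiff).comp h3
  exact ((h1.mul h3).mul h2).mul h4

/-- A nonzero `μ` keeps both radicands away from zero, so closing of the gap or coincidence of
singular values does no harm. -/
theorem contDiff_energy {E : Type*} [NormedAddCommGroup E] [NormedSpace ℝ E] {μ : ℝ}
    (hμ : μ ≠ 0) {t d : E → ℝ} (ht : ContDiff ℝ ∞ t) (hd : ContDiff ℝ ∞ d) (ht0 : ∀ x, 0 ≤ t x)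
    (hd0 : ∀ x, 0 ≤ d x) : ContDiff ℝ ∞ fun x => energy μ (t x) (d x) := by
  have h2 : 0 < μ ^ 2 := by positivity
  have h4 : 0 < μ ^ 4 := by positivity
  have c1 : ContDiff ℝ ∞ fun x => Real.sqrt (μ ^ 4 + μ ^ 2 * t x + d x) := by
    refine ContDiff.sqrt ((contDiff_const.add (contDiff_const.mul ht)).add hd) fun x => ?_
    have := ht0 x
    have := hd0 x
    positivity
  refine ContDiff.sqrt ((contDiff_const.add ht).add (contDiff_const.mul c1)) fun x => ?_
  have := ht0 x
  positivity

theorem block_trace_det_nonneg (A k : Plane) :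
    0 ≤ (D.block A k * (D.block A k)ᴴ).trace.re ∧ 0 ≤ (D.block A k * (D.block A k)ᴴ).det.re := by
  obtain ⟨y₁, y₂, h1, h12, ht, hd⟩ := exists_singular_values (D.block A k)
  rw [ht, hd, Complex.ofReal_re, Complex.ofReal_re]
  have := h1.trans h12
  constructor <;> positivity

theorem contDiff_block_trace (σ : C2zSymmetry Np Nm) :
    ContDiff ℝ ∞ fun q : Plane × Plane => (D.block q.1 q.2 * (D.block q.1 q.2)ᴴ).trace.re := by
  simp only [D.block_mul_conjTranspose σ, mat_pairing_product]
  exact Complex.reCLM.contDiff.comp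
    (Np.contDiff_trace_mat contDiff_snd (D.contDiff_pairing_product σ))

theorem contDiff_block_det (σ : C2zSymmetry Np Nm) :
    ContDiff ℝ ∞ fun q : Plane × Plane => (D.block q.1 q.2 * (D.block q.1 q.2)ᴴ).det.re := by
  simp only [D.block_mul_conjTranspose σ, mat_pairing_product]
  exact Complex.reCLM.contDiff.comp
    (Np.contDiff_det_mat contDiff_snd (D.contDiff_pairing_product σ))

theorem contDiff_pairEnergy (σ : C2zSymmetry Np Nm) {μ : ℝ} (hμ : μ ≠ 0) :
    ContDiff ℝ ∞ fun q : Plane × Plane => D.pairEnergy μ q.1 q.2 :=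
  contDiff_energy hμ (D.contDiff_block_trace σ) (D.contDiff_block_det σ)
    (fun q => (D.block_trace_det_nonneg q.1 q.2).1) (fun q => (D.block_trace_det_nonneg q.1 q.2).2)

end Pairing

end TwoValleys

end FlatSC

/-! ### The second derivative in the vector field -/

namespace FlatSC

/-- Entrywise jets of a matrix-valued function. -/
def MatJet (F : ℝ → Matrix (Fin 2) (Fin 2) ℂ) (A C : Matrix (Fin 2) (Fin 2) ℂ) : Prop :=
  ∀ i j, HasJet (fun s => F s i j) (A i j) (C i j)

namespace MatJet

variable {F F' : ℝ → Matrix (Fin 2) (Fin 2) ℂ} {A C A' C' : Matrix (Fin 2) (Fin 2) ℂ}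

theorem const (A : Matrix (Fin 2) (Fin 2) ℂ) : MatJet (fun _ => A) A 0 := fun i j =>
  HasJet.const (A i j)

theorem comp_neg (h : MatJet F A C) : MatJet (fun s => F (-s)) A C := fun i j => (h i j).comp_neg

theorem mul (h : MatJet F A C) (h' : MatJet F' A' C') :
    MatJet (fun s => F s * F' s) (A * A') (C * A' + A * C') := fun i j => by
  refine (HasJet.sum Finset.univ fun l _ => (h i l).mul (h' l j)).congr rfl ?_
  simp [Matrix.mul_apply, Finset.sum_add_distrib]

theorem trace (h : MatJet F A C) : HasJet (fun s => (F s).trace) A.trace C.trace :=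
  HasJet.sum Finset.univ fun i _ => h i i

theorem det (h : MatJet F A C) : HasJet (fun s => (F s).det) A.det
    (C 0 0 * A 1 1 + A 0 0 * C 1 1 - (C 0 1 * A 1 0 + A 0 1 * C 1 0)) := by
  have h1 := ((h 0 0).mul (h 1 1)).add ((((h 0 1).mul (h 1 0)).mul (HasJet.const (-1 : ℂ))))
  have e : (fun s => (F s).det) = fun s => F s 0 0 * F s 1 1 + F s 0 1 * F s 1 0 * -1 := by
    funext s
    rw [Matrix.det_fin_two]; ring
  rw [e]
  refine h1.congr ?_ ?_
  · rw [Matrix.det_fin_two]; ring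
  · ring

end MatJet

theorem HasJet.re {f : ℝ → ℂ} {a c : ℂ} (h : HasJet f a c) :
    HasJet (fun s => (f s).re) a.re c.re := h.clm_comp Complex.reCLM

namespace Valley

variable {b : Module.Basis (Fin 2) ℝ Plane} {H : Type*} [NormedAddCommGroup H]
  [InnerProductSpace ℂ H] [CompleteSpace H] (N : Valley b H)

theorem mat_mul_P (k : Plane) (Z : H →L[ℂ] H) : N.mat k (Z * N.P k) = N.mat k Z := by
  have := N.mat_mul_P_mul k Z 1
  rw [mul_one] at this
  rw [this]
  have h1 : N.mat k (1 : H →L[ℂ] H) = 1 := by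
    ext a c
    simp [mat_apply, inner_u, Matrix.one_apply]
  rw [h1, mul_one]

theorem mat_P_mul (k : Plane) (Z : H →L[ℂ] H) : N.mat k (N.P k * Z) = N.mat k Z := by
  ext a c
  rw [mat_apply, mul_apply_eq_comp, ← inner_P_left, P_u, mat_apply]

theorem mat_add (k : Plane) (Z W : H →L[ℂ] H) :
    N.mat k (Z + W) = N.mat k Z + N.mat k W := by
  ext a c
  simp [mat_apply]

/-- The second-order expansion of the overlaps of the bands at `k` and `k + s v`. -/
theorem matJet_P (k v : Plane) : MatJet (fun s : ℝ => N.mat k (N.P (k + s • v))) 1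
    ((-2 : ℂ) • N.mat k (fderiv ℝ N.P k v * fderiv ℝ N.P k v)) := by
  obtain ⟨P2, hP2⟩ := N.hasDerivAt_fderiv_P_line k v
  have hP := N.hasDerivAt_P_line k v
  set p : ℝ → H →L[ℂ] H := fun s => N.P (k + s • v) with hp
  set p' : ℝ → H →L[ℂ] H := fun s => fderiv ℝ N.P (k + s • v) v with hp'
  have hp0 : p 0 = N.P k := by simp [hp]
  have hp0' : p' 0 = fderiv ℝ N.P k v := by simp [hp']
  have e1 : p' = p' * p + p * p' := by
    funext s
    exact N.fderiv_P_mul (k + s • v) v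
  have h2 : HasDerivAt (p' * p + p * p') ((P2 * p 0 + p' 0 * p' 0) + (p' 0 * p' 0 + p 0 * P2)) 0 :=
    (hP2.mul (hP 0)).add ((hP 0).mul hP2)
  rw [← e1] at h2
  have h3 := hP2.unique h2
  rw [hp0, hp0'] at h3
  -- Compressing the derivative of `P' = P'P + PP'` to the bands gives `x = 2x + 2Y`, hence `x =
  -- -2Y`.
  have h4 : N.mat k P2
      = (-2 : ℂ) • N.mat k (fderiv ℝ N.P k v * fderiv ℝ N.P k v) := by
    have h5 := congrArg (N.mat k) h3
    rw [mat_add, mat_add, mat_add, mat_mul_P, mat_P_mul] at h5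
    ext i j
    have h6 := congrFun (congrFun h5 i) j
    simp only [Matrix.add_apply, Matrix.smul_apply, smul_eq_mul] at h6 ⊢
    linear_combination -h6
  have happ : ∀ {Z : ℝ → H →L[ℂ] H} {Z' : H →L[ℂ] H} {s : ℝ}, HasDerivAt Z Z' s → ∀ a c,
      HasDerivAt (fun s => N.mat k (Z s) a c) (N.mat k Z' a c) s := fun {Z Z' s} hZ a c => by
    have h := HasDerivAt.clm_apply_real hZ (N.u k c)
    exact ((innerSL ℂ (N.u k a)).restrictScalars ℝ).hasFDerivAt.comp_hasDerivAt s h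
  intro a c
  refine ⟨fun s => N.mat k (p' s) a c, fun s => happ (hP s) a c, ?_, ?_, ?_⟩
  · simp [mat_P]
  · have h7 : N.mat k (fderiv ℝ N.P k v) = 0 := by
      rw [← mat_P_mul, ← mat_mul_P, P_fderiv_P]
      ext; simp [mat_apply]
    simp only [hp0', h7, Matrix.zero_apply]
  · rw [← h4]
    exact happ hP2 a c

end Valley

open scoped ComplexOrder in
/-- A positive semidefinite weight of a positive `2 × 2` matrix is bounded by its lowest
eigenvalue. -/
theorem le_trace_mul {Y M : Matrix (Fin 2) (Fin 2) ℂ} {y₁ y₂ : ℝ} (h12 : y₁ ≤ y₂)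
    (ht : (M * Mᴴ).trace = ((y₁ + y₂ : ℝ) : ℂ)) (hd : (M * Mᴴ).det = ((y₁ * y₂ : ℝ) : ℂ))
    (hY : Y.PosSemidef) : y₁ * Y.trace.re ≤ (Y * (M * Mᴴ)).trace.re := by
  set R := M * Mᴴ with hR
  have hRh : Rᴴ = R := by rw [hR, Matrix.conjTranspose_mul, Matrix.conjTranspose_conjTranspose]
  have r10 : R 1 0 = conj (R 0 1) := by
    conv_lhs => rw [← hRh]
    rfl
  have r00 : (R 0 0).im = 0 := by
    have : conj (R 0 0) = R 0 0 := congrFun (congrFun hRh 0) 0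
    exact Complex.conj_eq_iff_im.1 this
  have r11 : (R 1 1).im = 0 := by
    have : conj (R 1 1) = R 1 1 := congrFun (congrFun hRh 1) 1
    exact Complex.conj_eq_iff_im.1 this
  have y10 : Y 1 0 = conj (Y 0 1) := by
    conv_lhs => rw [← hY.isHermitian.eq]
    rfl
  have y00 : (Y 0 0).im = 0 := by
    have : conj (Y 0 0) = Y 0 0 := congrFun (congrFun hY.isHermitian.eq 0) 0
    exact Complex.conj_eq_iff_im.1 this
  have y11 : (Y 1 1).im = 0 := by
    have : conj (Y 1 1) = Y 1 1 := congrFun (congrFun hY.isHermitian.eq 1) 1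
    exact Complex.conj_eq_iff_im.1 this
  have p0 : 0 ≤ (Y 0 0).re := (Complex.le_def.1 (hY.diag_nonneg (i := 0))).1
  have q0 : 0 ≤ (Y 1 1).re := (Complex.le_def.1 (hY.diag_nonneg (i := 1))).1
  have dY : 0 ≤ (Y 0 0).re * (Y 1 1).re - ((Y 0 1).re ^ 2 + (Y 0 1).im ^ 2) := by
    have h := (Complex.le_def.1 hY.det_nonneg).1
    rw [Matrix.det_fin_two, y10] at h
    simp only [Complex.zero_re, Complex.sub_re, Complex.mul_re, Complex.conj_re, Complex.conj_im,
      y00, y11] at h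
    nlinarith
  have tR : (R 0 0).re + (R 1 1).re = y₁ + y₂ := by
    have h := congrArg Complex.re ht
    rwa [Matrix.trace_fin_two, Complex.add_re, Complex.ofReal_re] at h
  have dR : (R 0 0).re * (R 1 1).re - ((R 0 1).re ^ 2 + (R 0 1).im ^ 2) = y₁ * y₂ := by
    have h := congrArg Complex.re hd
    rw [Matrix.det_fin_two, r10] at h
    simp only [Complex.sub_re, Complex.mul_re, Complex.conj_re, Complex.conj_im,
      r00, r11, Complex.ofReal_re] at h
    nlinarith
  rw [Matrix.trace_fin_two, Matrix.trace_fin_two, Matrix.mul_apply, Matrix.mul_apply,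
    Fin.sum_univ_two, Fin.sum_univ_two, r10, y10]
  simp only [Complex.add_re, Complex.mul_re, Complex.conj_re, Complex.conj_im, r00, r11, y00, y11]
  set p := (Y 0 0).re
  set q := (Y 1 1).re
  set w := (Y 0 1).re
  set w' := (Y 0 1).im
  set z := (R 0 1).re
  set z' := (R 0 1).im
  -- Subtracting the lowest eigenvalue leaves a positive matrix of determinant zero, `r r' =
  -- |R₀₁|²`; it remains to show that its trace against `Y` is non-negative, by Cauchy–Schwarz and
  -- the arithmetic-geometric mean inequality.
  obtain ⟨r, hr⟩ : ∃ r, r = (R 0 0).re - y₁ := ⟨_, rfl⟩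
  obtain ⟨r', hr'⟩ : ∃ r', r' = (R 1 1).re - y₁ := ⟨_, rfl⟩
  have e0 : (R 0 0).re = r + y₁ := by linarith
  have e1 : (R 1 1).re = r' + y₁ := by linarith
  rw [e0, e1] at tR dR ⊢
  have hs : 0 ≤ r + r' := by linarith
  have hp : r * r' = z ^ 2 + z' ^ 2 := by
    have : y₂ = r + r' + y₁ := by linarith
    rw [this] at dR
    linarith
  have hr0 : 0 ≤ r := by nlinarith [sq_nonneg z, sq_nonneg z', sq_nonneg r]
  have hr0' : 0 ≤ r' := by nlinarith [sq_nonneg z, sq_nonneg z', sq_nonneg r']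
  have hcs : (w * z + w' * z') ^ 2 ≤ (p * r) * (q * r') := by
    have c1 : (w * z + w' * z') ^ 2 ≤ (w ^ 2 + w' ^ 2) * (z ^ 2 + z' ^ 2) := by
      nlinarith [sq_nonneg (w * z' - w' * z)]
    have c2 : (w ^ 2 + w' ^ 2) * (z ^ 2 + z' ^ 2) ≤ (p * q) * (r * r') := by
      rw [← hp]
      exact mul_le_mul_of_nonneg_right (by linarith) (mul_nonneg hr0 hr0')
    calc _ ≤ _ := c1
      _ ≤ _ := c2
      _ = _ := by ring
  have hfin : -(2 * (w * z + w' * z')) ≤ p * r + q * r' := by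
    refine (neg_le_abs _).trans (abs_le_of_sq_le_sq ?_ (by positivity))
    nlinarith [sq_nonneg (p * r - q * r')]
  nlinarith

theorem HasJet.energy {t d : ℝ → ℝ} {t0 t2 d0 d2 μ : ℝ} (hμ : μ ≠ 0) (ht : HasJet t t0 t2)
    (hd : HasJet d d0 d2) (ht' : ∀ s, 0 ≤ t s) (hd' : ∀ s, 0 ≤ d s) :
    HasJet (fun s => energy μ (t s) (d s)) (FlatSC.energy μ t0 d0)
      ((t2 + (μ ^ 2 * t2 + d2) / Real.sqrt (μ ^ 4 + μ ^ 2 * t0 + d0))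
        / (2 * FlatSC.energy μ t0 d0)) := by
  have hμ2 : 0 < μ ^ 2 := by positivity
  have hμ4 : 0 < μ ^ 4 := by positivity
  have h1 := (((HasJet.const (μ ^ 4)).add ((HasJet.const (μ ^ 2)).mul ht)).add hd).sqrt
    (fun s => by
      have := ht' s
      have := hd' s
      positivity)
  have h2 := (((HasJet.const (2 * μ ^ 2)).add ht).add ((HasJet.const 2).mul h1)).sqrt
    (fun s => by
      have := ht' s
      positivity)
  refine h2.congr rfl ?_
  rw [FlatSC.energy]
  congr 1
  have hne : Real.sqrt (μ ^ 4 + μ ^ 2 * t0 + d0) ≠ 0 := by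
    have a1 : 0 ≤ t0 := by obtain ⟨_, _, h, _⟩ := ht; rw [← h]; exact ht' 0
    have a2 : 0 ≤ d0 := by obtain ⟨_, _, h, _⟩ := hd; rw [← h]; exact hd' 0
    exact (Real.sqrt_pos.2 (by positivity)).ne'
  field_simp
  ring

namespace Pairing

variable {b : Module.Basis (Fin 2) ℝ Plane}
  {Hp Hm : Type*} [NormedAddCommGroup Hp] [InnerProductSpace ℂ Hp] [CompleteSpace Hp]
  [NormedAddCommGroup Hm] [InnerProductSpace ℂ Hm] [CompleteSpace Hm]
  {Np : Valley b Hp} {Nm : Valley b Hm} (D : Pairing Np Nm) (σ : C2zSymmetry Np Nm)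

theorem hasJet_block_trace (k v : Plane) :
    HasJet (fun s : ℝ => (D.block (s • v) k * (D.block (s • v) k)ᴴ).trace.re)
      (Np.mat k (D.op σ k) * (Np.mat k (D.op σ k))ᴴ).trace.re
      (-2 * ((Np.mat k (fderiv ℝ Np.P k v * fderiv ℝ Np.P k v)
          * (Np.mat k (D.op σ k) * (Np.mat k (D.op σ k))ᴴ)).trace.re
        + (Np.mat k (fderiv ℝ Np.P k v * fderiv ℝ Np.P k v)
          * ((Np.mat k (D.op σ k))ᴴ * (Np.mat k (D.op σ k)))).trace.re)) := by
  set τ := Np.mat k (D.op σ k) with hτ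
  set Y := Np.mat k (fderiv ℝ Np.P k v * fderiv ℝ Np.P k v) with hY
  have hG := Np.matJet_P k v
  have h := (((hG.mul (MatJet.const τ)).mul hG.comp_neg).mul (MatJet.const τᴴ)).trace.re
  simp only [(D.block_mul_conjTranspose σ _ k).1, ← hτ, ← neg_smul]
  refine h.congr ?_ ?_
  · simp
  · have e : (τ * (Y * τᴴ)).trace = (Y * (τᴴ * τ)).trace := by
      rw [Matrix.trace_mul_comm, mul_assoc]
    simp only [one_mul, mul_one, mul_zero, add_zero, add_mul, Matrix.trace_add, Complex.add_re,
      ← hY, smul_mul_assoc, mul_smul_comm, Matrix.trace_smul, e, smul_eq_mul, mul_assoc]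
    simp
    ring

/-- The determinant factorizes, and each of `det G(sv)` and `det G(-sv)` has second derivative `-2
Tr Y`, which together give the factor `-4`. -/
theorem hasJet_block_det (k v : Plane) :
    HasJet (fun s : ℝ => (D.block (s • v) k * (D.block (s • v) k)ᴴ).det.re)
      (Np.mat k (D.op σ k) * (Np.mat k (D.op σ k))ᴴ).det.re
      (-4 * ((Np.mat k (fderiv ℝ Np.P k v * fderiv ℝ Np.P k v)).trace
        * (Np.mat k (D.op σ k) * (Np.mat k (D.op σ k))ᴴ).det).re) := by
  set τ := Np.mat k (D.op σ k) with hτ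
  set Y := Np.mat k (fderiv ℝ Np.P k v * fderiv ℝ Np.P k v) with hY
  have hG := Np.matJet_P k v
  have h := (((hG.det.mul (HasJet.const τ.det)).mul hG.comp_neg.det).mul
    (HasJet.const τᴴ.det)).re
  simp only [(D.block_mul_conjTranspose σ _ k).2, ← hτ, ← neg_smul, Matrix.det_mul]
  refine h.congr ?_ ?_
  · simp
  · rw [← Complex.re_ofReal_mul]
    congr 1
    simp [Matrix.trace_fin_two]
    ring

open scoped ComplexOrder in
/-- The concavity of the quasiparticle energies in the vector field. -/
theorem exists_hasJet_pairEnergy {μ : ℝ} (hμ : μ ≠ 0) (k v : Plane) {y₁ y₂ : ℝ} (h1 : 0 ≤ y₁)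
    (h12 : y₁ ≤ y₂)
    (ht : (Np.mat k (D.op σ k) * (Np.mat k (D.op σ k))ᴴ).trace = ((y₁ + y₂ : ℝ) : ℂ))
    (hd : (Np.mat k (D.op σ k) * (Np.mat k (D.op σ k))ᴴ).det = ((y₁ * y₂ : ℝ) : ℂ)) :
    ∃ a c : ℝ, HasJet (fun s : ℝ => D.pairEnergy μ (s • v) k) a c ∧
      c ≤ -2 * (y₁ / Real.sqrt (y₁ + μ ^ 2))
        * (Np.mat k (fderiv ℝ Np.P k v * fderiv ℝ Np.P k v)).trace.re := by
  have j1 := D.hasJet_block_trace σ k v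
  have j2 := D.hasJet_block_det σ k v
  have j := j1.energy hμ j2 (fun s => (D.block_trace_det_nonneg _ k).1)
    (fun s => (D.block_trace_det_nonneg _ k).2)
  refine ⟨_, _, j, ?_⟩
  set τ := Np.mat k (D.op σ k) with hτ
  set X := fderiv ℝ Np.P k v with hX
  -- Because `∂P` is self-adjoint, this is the Gram matrix of the vectors `∂P|u⟩`.
  have hY : (Np.mat k (X * X)).PosSemidef := by
    have e : Np.mat k (X * X) = Matrix.gram ℂ (fun a => X (Np.u k a)) := by
      ext a c
      rw [Valley.mat_apply, mul_apply_eq_comp, ← Np.inner_fderiv_P]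
      rfl
    rw [e]
    exact Matrix.posSemidef_gram ℂ _
  have hT : (Np.mat k (X * X)).trace = (((Np.mat k (X * X)).trace.re : ℝ) : ℂ) := by
    rw [hX, Np.trace_mat_fderiv_sq, Complex.ofReal_re]
  have hT0 : 0 ≤ (Np.mat k (X * X)).trace.re := by
    rw [hX, Np.trace_mat_fderiv_sq, Complex.ofReal_re]
    positivity
  have b1 := le_trace_mul h12 ht hd hY
  have b2 : y₁ * (Np.mat k (X * X)).trace.re ≤ (Np.mat k (X * X) * (τᴴ * τ)).trace.re := by
    have := le_trace_mul (M := τᴴ) (Y := Np.mat k (X * X)) h12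
      (by rw [Matrix.conjTranspose_conjTranspose, Matrix.trace_mul_comm]; exact ht)
      (by rw [Matrix.conjTranspose_conjTranspose, Matrix.det_mul_comm]; exact hd) hY
    rwa [Matrix.conjTranspose_conjTranspose] at this
  have ed : ((Np.mat k (X * X)).trace * (τ * τᴴ).det).re
      = (Np.mat k (X * X)).trace.re * (y₁ * y₂) := by
    rw [hd, Complex.re_mul_ofReal]
  rw [ed, ht, hd, Complex.ofReal_re, Complex.ofReal_re, energy_eq μ h1 (h1.trans h12)]
  set T := (Np.mat k (X * X)).trace.re
  set w1 := (Np.mat k (X * X) * (τ * τᴴ)).trace.re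
  set w2 := (Np.mat k (X * X) * (τᴴ * τ)).trace.re
  have a1 : 0 < μ ^ 2 + y₁ := by positivity
  have a2 : 0 < μ ^ 2 + y₂ := by have := h1.trans h12; positivity
  have e : μ ^ 4 + μ ^ 2 * (y₁ + y₂) + y₁ * y₂ = (μ ^ 2 + y₁) * (μ ^ 2 + y₂) := by ring
  rw [e, Real.sqrt_mul a1.le, add_comm y₁ (μ ^ 2)]
  have s1 := Real.sqrt_pos.2 a1
  have s2 := Real.sqrt_pos.2 a2
  have q1 := Real.mul_self_sqrt a1.le
  have q2 := Real.mul_self_sqrt a2.le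
  set e1 := Real.sqrt (μ ^ 2 + y₁)
  set e2 := Real.sqrt (μ ^ 2 + y₂)
  have hμ2 : 0 ≤ μ ^ 2 := sq_nonneg μ
  have c1 : -2 * (w1 + w2) + (μ ^ 2 * (-2 * (w1 + w2)) + -4 * (T * (y₁ * y₂))) / (e1 * e2)
      ≤ -4 * (y₁ * T) + (μ ^ 2 * (-4 * (y₁ * T)) + -4 * (T * (y₁ * y₂))) / (e1 * e2) := by
    refine add_le_add (by linarith) (div_le_div_of_nonneg_right ?_ (mul_pos s1 s2).le)
    have : μ ^ 2 * (-2 * (w1 + w2)) ≤ μ ^ 2 * (-4 * (y₁ * T)) :=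
      mul_le_mul_of_nonneg_left (by linarith) hμ2
    linarith
  -- With `μ² + y₂ = e2²`, the expression equals `-4 y₁ T (1 + e2/e1)`, so division by `2(e1 + e2)`
  -- leaves only the smaller singular value.
  have c2 : -4 * (y₁ * T) + (μ ^ 2 * (-4 * (y₁ * T)) + -4 * (T * (y₁ * y₂))) / (e1 * e2)
      = (-2 * (y₁ / e1) * T) * (2 * (e1 + e2)) := by
    have : μ ^ 2 * (-4 * (y₁ * T)) + -4 * (T * (y₁ * y₂)) = -4 * (y₁ * T) * (e2 * e2) := by
      rw [q2]; ring
    rw [this]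
    field_simp
    ring
  rw [div_le_iff₀ (by positivity), ← c2]
  exact c1

end Pairing

end FlatSC

/-! ### The two channels and the smallest singular value -/

namespace FlatSC

/-- The Frobenius norms of the two combinations `M / 2 ∓ w` with `w` the rotated conjugate of
`M`. -/
theorem trace_channel (M : Matrix (Fin 2) (Fin 2) ℂ) {c : ℂ} (hc : ‖c‖ = 1 / 2)
    {z : ℝ} (hz : -2 * conj c * M.det = (z : ℂ)) {s : ℝ} (hs : s ^ 2 = 1) :
    ((((1 / 2 : ℂ) • M - (s : ℂ) • (c • (eps * M.map conj * eps)))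
      * ((1 / 2 : ℂ) • M - (s : ℂ) • (c • (eps * M.map conj * eps)))ᴴ).trace).re
      = (M * Mᴴ).trace.re / 2 - s * z := by
  have hc2 : c.re ^ 2 + c.im ^ 2 = 1 / 4 := by
    have := Complex.sq_norm c
    rw [hc, Complex.normSq_apply] at this
    nlinarith
  have hz1 := congrArg Complex.re hz
  rw [Matrix.det_fin_two] at hz1
  have e : eps * M.map conj * eps
      = !![-conj (M 1 1), conj (M 1 0); conj (M 0 1), -conj (M 0 0)] := by
    ext i j
    fin_cases i <;> fin_cases j <;>
      simp [eps, Matrix.mul_apply, Matrix.vecMul, dotProduct, Fin.sum_univ_two]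
  rw [e]
  simp [Matrix.trace_fin_two, Matrix.mul_apply, Fin.sum_univ_two] at hz1 ⊢
  rw [← hz1]
  ring_nf
  rw [hs]
  have : c.im ^ 2 = 1 / 4 - c.re ^ 2 := by linarith
  rw [this]
  ring

/-- The amplitudes of the two channels in terms of the singular values. -/
theorem sub_sq_of_singular_values {y₁ y₂ z : ℝ} (h1 : 0 ≤ y₁) (h12 : y₁ ≤ y₂)
    (hz : z ^ 2 = y₁ * y₂) :
    (Real.sqrt (1 / 2 * ((y₁ + y₂) / 2 - z)) - Real.sqrt (1 / 2 * ((y₁ + y₂) / 2 + z))) ^ 2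
      = y₁ := by
  have hb : |z| ≤ (y₁ + y₂) / 2 := by
    refine abs_le_of_sq_le_sq ?_ (by linarith)
    rw [hz]; nlinarith [sq_nonneg (y₁ - y₂)]
  obtain ⟨l, r⟩ := abs_le.1 hb
  have p1 : 0 ≤ 1 / 2 * ((y₁ + y₂) / 2 - z) := by linarith
  have p2 : 0 ≤ 1 / 2 * ((y₁ + y₂) / 2 + z) := by linarith
  -- Since `z² = y₁y₂`, the product of the radicands is `((y₂ - y₁)/4)²`.
  have e : Real.sqrt (1 / 2 * ((y₁ + y₂) / 2 - z)) * Real.sqrt (1 / 2 * ((y₁ + y₂) / 2 + z))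
      = (y₂ - y₁) / 4 := by
    rw [← Real.sqrt_mul p1, Real.sqrt_eq_iff_mul_self_eq (mul_nonneg p1 p2) (by linarith)]
    nlinarith
  rw [sub_sq, Real.sq_sqrt p1, Real.sq_sqrt p2, mul_assoc, e]
  ring

namespace Pairing

variable {b : Module.Basis (Fin 2) ℝ Plane}
  {Hp Hm : Type*} [NormedAddCommGroup Hp] [InnerProductSpace ℂ Hp] [CompleteSpace Hp]
  [NormedAddCommGroup Hm] [InnerProductSpace ℂ Hm] [CompleteSpace Hm]
  {Np : Valley b Hp} {Nm : Valley b Hm} (D : Pairing Np Nm) (σ : C2zSymmetry Np Nm)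

/-- The spin part is separately invariant, and a nonzero entry of the unitary `Π` allows it to be
cancelled from the Kronecker product. -/
theorem sew_mul_conj (k : Plane) :
    Np.sew k * (D.Δ k).map conj * (Nm.sew (-k))ᵀ = D.Δ k := by
  have h := D.C2T_inv k
  have e1 : (D.Δ k ⊗ₖ D.Pi).map conj = (D.Δ k).map conj ⊗ₖ D.Pi.map conj := by
    ext ⟨a, c⟩ ⟨a', c'⟩
    simp [Matrix.kroneckerMap_apply]
  have e2 : Complex.I • sy * D.Pi.map conj * (Complex.I • sy)ᵀ = D.Pi := by
    have : (Complex.I • sy)ᵀ = -(Complex.I • sy) := by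
      ext i j
      fin_cases i <;> fin_cases j <;> simp [sy]
    rw [this]
    conv_rhs => rw [← D.Pi_real]
    simp [smul_smul]
  rw [e1, ← Matrix.kroneckerMap_transpose, ← Matrix.mul_kronecker_mul, ← Matrix.mul_kronecker_mul,
    e2] at h
  have hPi : ∃ i j, D.Pi i j ≠ 0 := by
    by_contra! hn
    have h0 : D.Pi = 0 := by ext i j; exact hn i j
    have := D.Pi_unitary
    rw [h0, Matrix.mul_zero] at this
    exact one_ne_zero this.symm
  obtain ⟨i, j, hij⟩ := hPi
  ext a c
  have := congrFun (congrFun h (a, i)) (c, j)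
  rw [Matrix.kroneckerMap_apply, Matrix.kroneckerMap_apply] at this
  exact mul_right_cancel₀ hij this

theorem conjTranspose_sew_mul (k : Plane) :
    (Np.sew k)ᴴ * D.Δ k * (Nm.sew (-k))ᴴ = (D.Δ k).map conj := by
  conv_lhs => rw [← D.sew_mul_conj k]
  calc _ = ((Np.sew k)ᴴ * Np.sew k) * (D.Δ k).map conj
        * (Nm.sew (-k) * (Nm.sew (-k))ᴴ) := by rw [Nm.sew_symm]; simp only [mul_assoc]
    _ = _ := by
      rw [Valley.conjTranspose_sew_mul_sew, Valley.sew_mul_conjTranspose_sew, one_mul, mul_one]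

theorem PΔ_C2T_u (k : Plane) (c : Fin 2) :
    D.PΔ k (Nm.C2T (Nm.u (-k) c)) = ∑ a, D.Δ k a c • Np.u k a := by
  simp only [PΔ, _root_.sum_apply, _root_.smul_apply, InnerProductSpace.rankOne_apply,
    Nm.inner_C2T, Nm.inner_u]
  refine Finset.sum_congr rfl fun a _ => ?_
  fin_cases c <;> simp

theorem PΔ_u (k : Plane) (c : Fin 2) :
    D.PΔ k (Nm.u (-k) c) = ∑ a, (D.Δ k * (Nm.sew (-k))ᴴ) a c • Np.u k a := by
  simp only [PΔ, _root_.sum_apply, _root_.smul_apply, InnerProductSpace.rankOne_apply,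
    Nm.inner_C2T_u, Matrix.mul_apply, Finset.sum_smul, smul_smul]

theorem _root_.FlatSC.Valley.area_C2T_u {H : Type*} [NormedAddCommGroup H]
    [InnerProductSpace ℂ H] [CompleteSpace H] (N : Valley b H) (k : Plane) (c : Fin 2) :
    N.area k (N.C2T (N.u k c)) = ∑ a, eps a c • N.u k a := by
  simp only [Valley.area, _root_.sum_apply, _root_.smul_apply, InnerProductSpace.rankOne_apply,
    N.inner_C2T, N.inner_u]
  refine Finset.sum_congr rfl fun a _ => ?_
  fin_cases c <;> simp

/-- The product of the normalizations of `Q_+(k)` and `Q_-(-k)`. -/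
noncomputable def channelPhase (Np : Valley b Hp) (Nm : Valley b Hm) (kp km k : Plane) : ℂ :=
  Np.eulerAt kp / (Np.eulerNumber kp : ℂ) * Np.phase kp k
    * (Nm.eulerAt km / (Nm.eulerNumber km : ℂ) * Nm.phase km (-k))

/-- The two sewing matrices in `Q_+` and `Q_-` enclose `Δ`, and C₂z𝒯 invariance converts that
product into the entrywise conjugate of `Δ`. -/
theorem Δch_eq (kp km : Plane) (ch : Channel) (k : Plane) :
    D.Δch kp km ch k = (1 / 2 : ℂ) • D.Δ k - ch.sign •
      (channelPhase Np Nm kp km k • (eps * (D.Δ k).map conj * eps)) := by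
  have hw : ∀ a c, inner ℂ (Np.u k a) (Np.area k (D.PΔ k (Nm.area (-k) (Nm.C2T (Nm.u (-k) c)))))
      = (eps * (D.Δ k).map conj * eps) a c := fun a c => by
    rw [← D.conjTranspose_sew_mul k]
    have e : eps * ((Np.sew k)ᴴ * D.Δ k * (Nm.sew (-k))ᴴ) * eps
        = (eps * (Np.sew k)ᴴ) * ((D.Δ k * (Nm.sew (-k))ᴴ) * eps) := by simp only [mul_assoc]
    rw [e, ← Np.mat_area, Valley.area_C2T_u]
    simp only [map_sum, map_smul, PΔ_u, inner_sum, inner_smul_right, ← Valley.mat_apply]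
    generalize D.Δ k * (Nm.sew (-k))ᴴ = B
    simp only [Matrix.mul_apply, Fin.sum_univ_two]
    ring
  ext a c
  have h1 : inner ℂ (Np.u k a) (D.PΔ k (Nm.C2T (Nm.u (-k) c))) = D.Δ k a c := by
    rw [PΔ_C2T_u, inner_sum]
    simp [inner_smul_right, Np.inner_u]
  simp only [Δch, Pch, Matrix.of_apply, Valley.Q, Valley.Q₀_eq_phase, _root_.sub_apply,
    _root_.smul_apply, ContinuousLinearMap.comp_apply, map_smul, inner_sub_right, inner_smul_right,
    h1, hw, Matrix.sub_apply, Matrix.smul_apply, smul_eq_mul, channelPhase]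
  ring

theorem link_mul_conjTranspose (k : Plane) : σ.link k * (σ.link k)ᴴ = 1 := by
  have h := σ.transpose_mat_P 0 k
  rw [neg_zero, add_zero, add_zero, Nm.mat_P, Np.mat_P, mul_one, Matrix.transpose_one] at h
  exact h.symm

theorem mat_op_mul_conjTranspose (k : Plane) :
    Np.mat k (D.op σ k) * (Np.mat k (D.op σ k))ᴴ = D.Δ k * (D.Δ k)ᴴ := by
  rw [mat_op, Matrix.conjTranspose_mul]
  calc _ = D.Δ k * (σ.link k * (σ.link k)ᴴ) * (D.Δ k)ᴴ := by simp only [mul_assoc]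
    _ = _ := by rw [link_mul_conjTranspose, mul_one]

/-- The Euler signs and the base points disappear on squaring, so only the sewing determinants
remain. -/
theorem channelPhase_sq (kp km : Plane) (euler_p : Np.eulerNumber kp ≠ 0)
    (euler_m : Nm.eulerNumber km ≠ 0) (k : Plane) :
    channelPhase Np Nm kp km k ^ 2 = (Np.sew k).det * (Nm.sew (-k)).det / 4 := by
  rw [channelPhase, mul_pow, mul_pow, mul_pow, Np.eulerSign_sq kp euler_p,
    Nm.eulerSign_sq km euler_m, Np.phase_sq, Nm.phase_sq]
  ring

theorem norm_channelPhase (kp km : Plane) (euler_p : Np.eulerNumber kp ≠ 0)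
    (euler_m : Nm.eulerNumber km ≠ 0) (k : Plane) : ‖channelPhase Np Nm kp km k‖ = 1 / 2 := by
  have h := congrArg norm (channelPhase_sq kp km euler_p euler_m k)
  rw [norm_pow, norm_div, norm_mul, Np.norm_det_sew, Nm.norm_det_sew] at h
  norm_num at h
  nlinarith [norm_nonneg (channelPhase Np Nm kp km k)]

theorem absΔ_eq (kp km : Plane) (euler_p : Np.eulerNumber kp ≠ 0)
    (euler_m : Nm.eulerNumber km ≠ 0) (k : Plane) {z : ℝ}
    (hz : -2 * conj (channelPhase Np Nm kp km k) * (D.Δ k).det = (z : ℂ)) :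
    D.absΔ kp km .perp k = Real.sqrt (1 / 2 * ((D.Δ k * (D.Δ k)ᴴ).trace.re / 2 - z)) ∧
    D.absΔ kp km .par k = Real.sqrt (1 / 2 * ((D.Δ k * (D.Δ k)ᴴ).trace.re / 2 + z)) := by
  have cn := norm_channelPhase kp km euler_p euler_m k
  have hp := trace_channel (D.Δ k) cn hz (s := 1) (by norm_num)
  have hm := trace_channel (D.Δ k) cn hz (s := -1) (by norm_num)
  have e1 : Channel.sign .perp = ((1 : ℝ) : ℂ) := by simp [Channel.sign]
  have e2 : Channel.sign .par = ((-1 : ℝ) : ℂ) := by simp [Channel.sign]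
  rw [absΔ, absΔ, Δch_eq, Δch_eq, e1, e2, hp, hm, one_mul, neg_one_mul, sub_neg_eq_add]
  exact ⟨rfl, rfl⟩

/-- The difference of the amplitudes of the channels is the smallest singular value of the
pairing. -/
theorem absΔ_sub_sq (kp km : Plane) (euler_p : Np.eulerNumber kp ≠ 0)
    (euler_m : Nm.eulerNumber km ≠ 0) (k : Plane) {y₁ y₂ : ℝ} (h1 : 0 ≤ y₁) (h12 : y₁ ≤ y₂)
    (ht : (D.Δ k * (D.Δ k)ᴴ).trace = ((y₁ + y₂ : ℝ) : ℂ))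
    (hd : (D.Δ k * (D.Δ k)ᴴ).det = ((y₁ * y₂ : ℝ) : ℂ)) :
    (D.absΔ kp km .perp k - D.absΔ kp km .par k) ^ 2 = y₁ := by
  have c2 := channelPhase_sq kp km euler_p euler_m k
  have hdet : (Np.sew k).det * conj (D.Δ k).det * (Nm.sew (-k)).det = (D.Δ k).det := by
    have h := congrArg Matrix.det (D.sew_mul_conj k)
    have e : ((D.Δ k).map conj).det = conj (D.Δ k).det := ((starRingEnd ℂ).map_det _).symm
    rwa [Matrix.det_mul, Matrix.det_mul, Matrix.det_transpose, e] at h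
  have hd' : (D.Δ k).det * conj (D.Δ k).det = ((y₁ * y₂ : ℝ) : ℂ) := by
    rw [← hd, Matrix.det_mul, Matrix.det_conjTranspose]; rfl
  -- Invariance fixes the phase of `det Δ` against the sewing determinants, so the square is `|det
  -- Δ|² = y₁y₂`. Being real and non-negative, it forces the number itself to be real.
  have hz2 : (-2 * conj (channelPhase Np Nm kp km k) * (D.Δ k).det) ^ 2
      = ((y₁ * y₂ : ℝ) : ℂ) := by
    have c2' : conj (channelPhase Np Nm kp km k) ^ 2
        = conj (Np.sew k).det * conj (Nm.sew (-k)).det / 4 := by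
      rw [← map_pow, c2, map_div₀, map_mul, map_ofNat]
    have hdc := congrArg (starRingEnd ℂ) hdet
    simp only [map_mul, Complex.conj_conj] at hdc
    rw [← hd', mul_pow, mul_pow, c2', ← hdc]
    ring
  obtain ⟨z, hz⟩ : ∃ z : ℝ, -2 * conj (channelPhase Np Nm kp km k) * (D.Δ k).det = (z : ℂ) := by
    set w := -2 * conj (channelPhase Np Nm kp km k) * (D.Δ k).det
    refine ⟨w.re, ?_⟩
    have y0 : 0 ≤ y₁ * y₂ := mul_nonneg h1 (h1.trans h12)
    have e : (w - (Real.sqrt (y₁ * y₂) : ℂ)) * (w + (Real.sqrt (y₁ * y₂) : ℂ)) = 0 := by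
      have : ((Real.sqrt (y₁ * y₂) : ℝ) : ℂ) ^ 2 = ((y₁ * y₂ : ℝ) : ℂ) := by
        rw [← Complex.ofReal_pow, Real.sq_sqrt y0]
      linear_combination hz2 - this
    rcases mul_eq_zero.1 e with h | h
    · rw [sub_eq_zero.1 h, Complex.ofReal_re]
    · rw [eq_neg_of_add_eq_zero_left h]; simp
  have hzr : z ^ 2 = y₁ * y₂ := by
    rw [hz] at hz2
    exact_mod_cast hz2
  obtain ⟨ep, em⟩ := D.absΔ_eq kp km euler_p euler_m k hz
  rw [ht, Complex.ofReal_re] at ep em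
  rw [ep, em]
  exact sub_sq_of_singular_values h1 h12 hzr

theorem boundDensity_eq (kp km : Plane) (euler_p : Np.eulerNumber kp ≠ 0)
    (euler_m : Nm.eulerNumber km ≠ 0) (μ : ℝ) (k : Plane) {y₁ y₂ : ℝ} (h1 : 0 ≤ y₁)
    (h12 : y₁ ≤ y₂)
    (ht : (D.Δ k * (D.Δ k)ᴴ).trace = ((y₁ + y₂ : ℝ) : ℂ))
    (hd : (D.Δ k * (D.Δ k)ᴴ).det = ((y₁ * y₂ : ℝ) : ℂ)) :
    D.boundDensity kp km μ k = y₁ / Real.sqrt (y₁ + μ ^ 2) := by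
  rw [boundDensity, D.absΔ_sub_sq kp km euler_p euler_m k h1 h12 ht hd]

theorem block_zero (k : Plane) : D.block 0 k = D.Δ k := by
  have h1 : Np.overlap (k + 0) k = 1 := by
    ext a c; simp [Valley.overlap, Valley.inner_u, Matrix.one_apply]
  have h2 : Nm.overlap (-k + 0) (-k) = 1 := by
    ext a c; simp [Valley.overlap, Valley.inner_u, Matrix.one_apply]
  rw [block, h1, h2, Matrix.transpose_one, one_mul, mul_one]

/-- The lower eigenvalue is `(t - √(t² - 4d))/2` in terms of the smooth trace and determinant, so
continuity does not depend on any choice made in `Q`. -/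
theorem continuous_boundDensity (σ : C2zSymmetry Np Nm) (kp km : Plane) (euler_p : Np.eulerNumber kp ≠ 0)
    (euler_m : Nm.eulerNumber km ≠ 0) {μ : ℝ} (hμ : μ ≠ 0) :
    Continuous (D.boundDensity kp km μ) := by
  have hl : Continuous fun k : Plane => ((0 : Plane), k) := by fun_prop
  have ct := (D.contDiff_block_trace σ).continuous.comp hl
  have cd := (D.contDiff_block_det σ).continuous.comp hl
  simp only [Function.comp_def, block_zero] at ct cd
  set t : Plane → ℝ := fun k => (D.Δ k * (D.Δ k)ᴴ).trace.re
  set d : Plane → ℝ := fun k => (D.Δ k * (D.Δ k)ᴴ).det.re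
  set y : Plane → ℝ := fun k => (t k - Real.sqrt (t k ^ 2 - 4 * d k)) / 2 with hy
  have key : ∀ k, 0 ≤ y k ∧ D.boundDensity kp km μ k = y k / Real.sqrt (y k + μ ^ 2) := fun k => by
    obtain ⟨y₁, y₂, h1, h12, ht, hd⟩ := exists_singular_values (D.Δ k)
    have : y k = y₁ := by
      simp only [hy, t, d, ht, hd, Complex.ofReal_re]
      have : (y₁ + y₂) ^ 2 - 4 * (y₁ * y₂) = (y₂ - y₁) ^ 2 := by ring
      rw [this, Real.sqrt_sq (by linarith)]
      ring
    rw [this]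
    exact ⟨h1, D.boundDensity_eq kp km euler_p euler_m μ k h1 h12 ht hd⟩
  have hf : D.boundDensity kp km μ = fun k => y k / Real.sqrt (y k + μ ^ 2) :=
    funext fun k => (key k).2
  have cy : Continuous y := by fun_prop
  rw [hf]
  refine cy.div (by fun_prop) fun k => ?_
  have := (key k).1
  positivity

end Pairing

end FlatSC

/-! ### Integration of the pointwise bound -/

namespace FlatSC

theorem continuous_slice {X Y F : Type*} [TopologicalSpace X] [TopologicalSpace Y]
    [TopologicalSpace F] {f : X → Y → F} (h : Continuous fun q : X × Y => f q.1 q.2) (x : X) :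
    Continuous fun y => f x y :=
  h.comp (Continuous.prodMk_right x)

namespace Pairing

variable {b : Module.Basis (Fin 2) ℝ Plane}
  {Hp Hm : Type*} [NormedAddCommGroup Hp] [InnerProductSpace ℂ Hp] [CompleteSpace Hp]
  [NormedAddCommGroup Hm] [InnerProductSpace ℂ Hm] [CompleteSpace Hm]
  {Np : Valley b Hp} {Nm : Valley b Hm} (D : Pairing Np Nm) (σ : C2zSymmetry Np Nm)

/-- The integrand of the free energy in the flat-band limit. -/
noncomputable def density (μ : ℝ) (A k : Plane) : ℝ :=
  1 / (2 * Real.pi) ^ 2 * (-2 * D.pairEnergy μ A k - 4 * μ)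

theorem contDiff_density (σ : C2zSymmetry Np Nm) {μ : ℝ} (hμ : μ ≠ 0) :
    ContDiff ℝ ∞ fun q : Plane × Plane => D.density μ q.1 q.2 :=
  contDiff_const.mul ((contDiff_const.mul (D.contDiff_pairEnergy σ hμ)).sub contDiff_const)

theorem freeEnergy_eq_integral_density (σ : C2zSymmetry Np Nm) (flat_p : Np.Flat)
    (flat_m : Nm.Flat) {μ : ℝ} (hμ : μ ≠ 0) :
    D.freeEnergy μ = fun A => ∫ k in cell b, D.density μ A k := by
  funext A
  have hc : Continuous (D.pairEnergy μ A) :=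
    continuous_slice (D.contDiff_pairEnergy σ hμ).continuous A
  rw [D.freeEnergy_eq flat_p flat_m μ A hc, ← integral_const_mul]
  rfl

theorem contDiff_freeEnergy (σ : C2zSymmetry Np Nm) (flat_p : Np.Flat)
    (flat_m : Nm.Flat) {μ : ℝ} (hμ : μ ≠ 0) : ContDiff ℝ 2 (D.freeEnergy μ) := by
  rw [D.freeEnergy_eq_integral_density σ flat_p flat_m hμ]
  exact contDiff_setIntegral 2 (D.contDiff_density σ hμ) (isBounded_cell b) (measurableSet_cell b)

/-- The constant is `(-2)(-2)/(2π)² = 1/π²`: one factor from the free-energy density, the other from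
the concavity bound of the pair energy. -/
theorem sum_fderiv_fderiv_density_ge (σ : C2zSymmetry Np Nm) (kp km : Plane)
    (euler_p : Np.eulerNumber kp ≠ 0) (euler_m : Nm.eulerNumber km ≠ 0) {μ : ℝ} (hμ : μ ≠ 0)
    (k : Plane) :
    1 / Real.pi ^ 2 * (D.boundDensity kp km μ k * (Np.metric k).trace)
      ≤ ∑ i : Fin 2, fderiv ℝ (fun A => fderiv ℝ (fun A => D.density μ A k) A
        (EuclideanSpace.single i 1)) 0 (EuclideanSpace.single i 1) := by
  obtain ⟨y₁, y₂, h1, h12, ht, hd⟩ := exists_singular_values (D.Δ k)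
  have hs : ContDiff ℝ 2 fun A => D.density μ A k :=
    ((D.contDiff_density σ hμ).comp
      (contDiff_id.prodMk contDiff_const : ContDiff ℝ ∞ fun A : Plane => (A, k))).of_le
        (by norm_cast)
  rw [D.boundDensity_eq kp km euler_p euler_m μ k h1 h12 ht hd, Np.metric_trace_eq_mat,
    Finset.mul_sum, Finset.mul_sum]
  refine Finset.sum_le_sum fun i _ => ?_
  obtain ⟨a, c, hj, hle⟩ := D.exists_hasJet_pairEnergy σ hμ k (EuclideanSpace.single i 1) h1 h12
    (by rw [mat_op_mul_conjTranspose]; exact ht) (by rw [mat_op_mul_conjTranspose]; exact hd)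
  have hj2 := (HasJet.const (1 / (2 * Real.pi) ^ 2)).mul
    (((HasJet.const (-2 : ℝ)).mul hj).add (HasJet.const (-(4 * μ))))
  have e : (fun s : ℝ => 1 / (2 * Real.pi) ^ 2
      * (-2 * D.pairEnergy μ (s • EuclideanSpace.single i 1) k + -(4 * μ)))
      = fun s : ℝ => D.density μ (s • EuclideanSpace.single i 1) k := by
    funext s
    rw [density, sub_eq_add_neg]
  rw [e] at hj2
  rw [hj2.fderiv_fderiv hs]
  have hpi := Real.pi_pos
  have e2 : 1 / (2 * Real.pi) ^ 2 = 1 / 4 * (1 / Real.pi ^ 2) := by field_simp; norm_num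
  rw [e2]
  have hp : 0 ≤ 1 / Real.pi ^ 2 := by positivity
  have := mul_le_mul_of_nonneg_left hle hp
  simp only [pderivOp] at this ⊢
  nlinarith

theorem continuous_fderiv_fderiv_density (σ : C2zSymmetry Np Nm) {μ : ℝ} (hμ : μ ≠ 0)
    (v w : Plane) :
    Continuous fun k => fderiv ℝ (fun A => fderiv ℝ (fun A => D.density μ A k) A v) 0 w := by
  have h1 : ContDiff ℝ ∞ (fun q : Plane × Plane =>
      fderiv ℝ (fun A => D.density μ A q.2) q.1 v) :=
    (contDiff_fderiv_of_contDiff_prod (D.contDiff_density σ hμ)).clm_apply contDiff_const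
  have h2 : ContDiff ℝ ∞ (fun q : Plane × Plane =>
      fderiv ℝ (fun A => fderiv ℝ (fun A => D.density μ A q.2) A v) q.1 w) :=
    (contDiff_fderiv_of_contDiff_prod (f := fun A k => fderiv ℝ (fun A => D.density μ A k) A v)
      h1).clm_apply contDiff_const
  exact continuous_slice (f := fun A' k => fderiv ℝ (fun A =>
    fderiv ℝ (fun A => D.density μ A k) A v) A' w) h2.continuous 0

theorem integrableOn_boundDensity_mul (σ : C2zSymmetry Np Nm) (kp km : Plane)
    (euler_p : Np.eulerNumber kp ≠ 0) (euler_m : Nm.eulerNumber km ≠ 0) {μ : ℝ} (hμ : μ ≠ 0) :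
    IntegrableOn (fun k => D.boundDensity kp km μ k * (Np.metric k).trace) (cell b) :=
  integrableOn_of_continuous_of_isBounded
    ((D.continuous_boundDensity σ kp km euler_p euler_m hμ).mul
      Np.contDiff_metric_trace.continuous) (isBounded_cell b)

theorem boundDensity_nonneg (kp km : Plane) (μ : ℝ) (k : Plane) :
    0 ≤ D.boundDensity kp km μ k := by
  rw [boundDensity]
  positivity

theorem _root_.FlatSC.Valley.integral_metric_trace_pos {H : Type*} [NormedAddCommGroup H]
    [InnerProductSpace ℂ H] [CompleteSpace H] (N : Valley b H) (k₀ : Plane)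
    (h : N.eulerNumber k₀ ≠ 0) : 0 < ∫ k in cell b, (N.metric k).trace := by
  have h0 : 0 < N.eulerNumber k₀ := lt_of_le_of_ne (norm_nonneg _) (Ne.symm h)
  have := Real.pi_pos
  exact lt_of_lt_of_le (by positivity) (N.eulerNumber_le k₀)

/-- The lower bound on the superfluid weight. -/
theorem le_trace_superfluidWeight (σ : C2zSymmetry Np Nm) (flat_p : Np.Flat) (flat_m : Nm.Flat)
    (kp km : Plane) (euler_p : Np.eulerNumber kp ≠ 0) (euler_m : Nm.eulerNumber km ≠ 0)
    (e : ℝ) {μ : ℝ} (hμ : μ ≠ 0) :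
    4 * e ^ 2 / Real.pi * Np.eulerNumber kp * Np.average (D.boundDensity kp km μ)
      ≤ (D.superfluidWeight e μ).trace := by
  have hpi := Real.pi_pos
  have hT : (D.superfluidWeight e μ).trace = e ^ 2 * ∫ k in cell b,
      ∑ i : Fin 2, fderiv ℝ (fun A => fderiv ℝ (fun A => D.density μ A k) A
        (EuclideanSpace.single i 1)) 0 (EuclideanSpace.single i 1) := by
    rw [integral_finsetSum _ fun i _ => integrableOn_of_continuous_of_isBounded
      (D.continuous_fderiv_fderiv_density σ hμ _ _) (isBounded_cell b), Finset.mul_sum]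
    refine Finset.sum_congr rfl fun i _ => ?_
    rw [Matrix.diag_apply, superfluidWeight, Matrix.of_apply,
      D.freeEnergy_eq_integral_density σ flat_p flat_m hμ,
      fderiv_fderiv_setIntegral (D.contDiff_density σ hμ) (isBounded_cell b)
        (measurableSet_cell b)]
  have hI := integral_mono (μ := volume.restrict (cell b))
    ((D.integrableOn_boundDensity_mul σ kp km euler_p euler_m hμ).const_mul (1 / Real.pi ^ 2))
    (integrableOn_of_continuous_of_isBounded (continuous_finsetSum _ fun i _ =>
      D.continuous_fderiv_fderiv_density σ hμ (EuclideanSpace.single i 1)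
        (EuclideanSpace.single i 1)) (isBounded_cell b))
    (fun k => D.sum_fderiv_fderiv_density_ge σ kp km euler_p euler_m hμ k)
  rw [integral_const_mul] at hI
  have hX : 0 ≤ ∫ k in cell b, D.boundDensity kp km μ k * (Np.metric k).trace :=
    integral_nonneg fun k => mul_nonneg (D.boundDensity_nonneg kp km μ k)
      (Np.metric_trace_nonneg k)
  have hg := Np.integral_metric_trace_pos kp euler_p
  have hN := Np.eulerNumber_le kp
  rw [hT, Valley.average]
  refine le_trans ?_ (mul_le_mul_of_nonneg_left hI (sq_nonneg e))
  set I := ∫ k in cell b, D.boundDensity kp km μ k * (Np.metric k).trace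
  set g := ∫ k in cell b, (Np.metric k).trace
  -- Rearranged so that the average keeps its weight and `4π𝒩` is replaced by the larger quantum
  -- volume `g`.
  calc 4 * e ^ 2 / Real.pi * Np.eulerNumber kp * (I / g)
      = 4 * Real.pi * Np.eulerNumber kp * (e ^ 2 * (1 / Real.pi ^ 2 * I) / g) := by
        field_simp
    _ ≤ g * (e ^ 2 * (1 / Real.pi ^ 2 * I) / g) :=
        mul_le_mul_of_nonneg_right hN (by positivity)
    _ = e ^ 2 * (1 / Real.pi ^ 2 * I) := by field_simp

end Pairing

end FlatSC

/-! ### C₂z between the valleys, and uniform s-wave pairing -/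

namespace FlatSC

theorem opTrace_smul {H : Type*} [NormedAddCommGroup H] [InnerProductSpace ℂ H] [CompleteSpace H]
    (z : ℂ) (Z : H →L[ℂ] H) : opTrace (z • Z) = z * opTrace Z := by
  simp only [opTrace, _root_.smul_apply, inner_smul_right, tsum_mul_left]

variable {b : Module.Basis (Fin 2) ℝ Plane}
  {Hp Hm : Type*} [NormedAddCommGroup Hp] [InnerProductSpace ℂ Hp] [CompleteSpace Hp]
  [NormedAddCommGroup Hm] [InnerProductSpace ℂ Hm] [CompleteSpace Hm]
  {Np : Valley b Hp} {Nm : Valley b Hm}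

namespace C2zSymmetry

variable (σ : C2zSymmetry Np Nm)

theorem conjL_area (k : Plane) : conjL σ.C (Np.area k)
    = (σ.U k : Matrix (Fin 2) (Fin 2) ℂ).det • Nm.area (-k) := by
  rw [Valley.area, Valley.area, ← area_change_frame Nm.C2T (fun a => σ.C (Np.u k a)) _ _ (σ.C_u k)]
  simp only [map_sum, conjL_smul, conjL_ketbra, σ.C_C2T]

theorem U_mul_sew (k : Plane) : (σ.U k : Matrix (Fin 2) (Fin 2) ℂ) * Np.sew k
    = Nm.sew (-k) * (σ.U k : Matrix (Fin 2) (Fin 2) ℂ).map conj := by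
  ext c a
  have h := congrArg (fun x => inner ℂ (Nm.u (-k) c) x) (σ.C_C2T (Np.u k a))
  simp only [Np.C2T_u, σ.C_u, map_sum, map_smul, LinearIsometry.map_smulₛₗ, inner_sum,
    inner_smul_right, Nm.inner_u] at h
  simp only [Matrix.mul_apply, Matrix.map_apply, Valley.sew, Matrix.of_apply] at h ⊢
  simp at h ⊢
  linear_combination h

/-- Determinants of `U_mul_sew`; unitarity of `U` turns the conjugate determinant into an inverse.
This matches the squared phases of `Q` in the two valleys. -/
theorem det_sew_mul_sq (k : Plane) : (Np.sew k).det
    * (σ.U k : Matrix (Fin 2) (Fin 2) ℂ).det ^ 2 = (Nm.sew (-k)).det := by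
  have h := congrArg Matrix.det (σ.U_mul_sew k)
  have e : ((σ.U k : Matrix (Fin 2) (Fin 2) ℂ).map conj).det
      = conj (σ.U k : Matrix (Fin 2) (Fin 2) ℂ).det := ((starRingEnd ℂ).map_det _).symm
  have hU := congrArg Matrix.det (Matrix.mem_unitaryGroup_iff.1 (σ.U k).2)
  rw [Matrix.det_mul, Matrix.det_one, Matrix.star_eq_conjTranspose, Matrix.det_conjTranspose,
    RCLike.star_def] at hU
  rw [Matrix.det_mul, Matrix.det_mul, e] at h
  linear_combination (σ.U k : Matrix (Fin 2) (Fin 2) ℂ).det * h + (Nm.sew (-k)).det * hU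

theorem pderivOp_neg (i : Fin 2) (k : Plane) :
    pderivOp i Nm.P (-k) = -conjL σ.C (pderivOp i Np.P k) := by
  have hd : Differentiable ℝ Np.P := Np.contDiff_P.differentiable (by simp)
  have hd' : Differentiable ℝ Nm.P := Nm.contDiff_P.differentiable (by simp)
  have e : (Nm.P ∘ fun k => -k) = fun k => conjL σ.C (Np.P k) :=
    funext fun k => (σ.conjL_P k).symm
  have h1 := (hd' (-k)).hasFDerivAt.comp k (hasFDerivAt_id k).neg
  have h2 : HasFDerivAt (fun k => conjL σ.C (Np.P k)) ((conjL σ.C).comp (fderiv ℝ Np.P k)) k :=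
    (conjL σ.C).hasFDerivAt.comp k (hd k).hasFDerivAt
  have h3 := congrArg (fun Z => Z (EuclideanSpace.single i 1)) (h1.unique (e ▸ h2))
  simp only [ContinuousLinearMap.comp_apply, _root_.neg_apply, ContinuousLinearMap.id_apply,
    map_neg] at h3
  rw [pderivOp, pderivOp, ← h3, neg_neg]

/-- The fields `Q` of the two valleys are related by `C₂z` up to a global sign. -/
theorem exists_sign (kp km : Plane) : ∃ r : ℂ, r ^ 2 = 1 ∧
    ∀ k, Nm.Q₀ km (-k) = r • conjL σ.C (Np.Q₀ kp k) := by
  have h := eq_or_eq_neg_of_continuous (f := fun k => conjL σ.C (Np.Q₀ kp k))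
    (g := fun k => Nm.Q₀ km (-k)) ((conjL σ.C).continuous.comp (Np.continuous_Q₀ kp))
    ((Nm.continuous_Q₀ km).comp continuous_neg) (fun k => ?_) (fun k => Nm.Q₀_ne_zero _ _)
  · rcases h with h | h
    · exact ⟨1, by norm_num, fun k => by rw [one_smul]; exact (h k).symm⟩
    · exact ⟨-1, by norm_num, fun k => by
        rw [neg_smul, one_smul]
        exact neg_eq_iff_eq_neg.1 (h k).symm⟩
  · have hp : (Np.phase kp k * (σ.U k : Matrix (Fin 2) (Fin 2) ℂ).det) ^ 2
        = Nm.phase km (-k) ^ 2 := by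
      rw [mul_pow, Valley.phase_sq, Valley.phase_sq, ← σ.det_sew_mul_sq]; ring
    simp only [Valley.Q₀_eq_phase, conjL_smul, σ.conjL_area, smul_smul]
    rcases sq_eq_sq_iff_eq_or_eq_neg.1 hp with h | h
    · left; rw [h]
    · right; rw [h, neg_smul]

theorem phase_neg {kp km : Plane} {r : ℂ}
    (h : ∀ k, Nm.Q₀ km (-k) = r • conjL σ.C (Np.Q₀ kp k)) (k : Plane) :
    Nm.phase km (-k) = r * (Np.phase kp k * (σ.U k : Matrix (Fin 2) (Fin 2) ℂ).det) := by
  have h1 := h k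
  rw [Valley.Q₀_eq_phase, Valley.Q₀_eq_phase, conjL_smul, σ.conjL_area, smul_smul, smul_smul,
    ← sub_eq_zero, ← sub_smul] at h1
  have h2 := (smul_eq_zero.1 h1).resolve_right (Nm.area_ne_zero (-k))
  linear_combination h2

/-- Reversing `k` changes the sign of both derivatives, so `Φ` only acquires `r`. The reflection of
the integration domain uses periodicity of `Φ`, where orientability enters. -/
theorem eulerAt_eq (orient_m : Nm.Orientable) {kp km : Plane} {r : ℂ}
    (h : ∀ k, Nm.Q₀ km (-k) = r • conjL σ.C (Np.Q₀ kp k)) :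
    Nm.eulerAt km = r * Np.eulerAt kp := by
  have e : ∀ k, Nm.Phi₀ km (-k) = r * Np.Phi₀ kp k := fun k => by
    have t : ∀ X Y : Hp →L[ℂ] Hp, opTrace (r • conjL σ.C (Np.Q₀ kp k) * -conjL σ.C X
        * -conjL σ.C Y) = r * opTrace (Np.Q₀ kp k * X * Y) := fun X Y => by
      rw [← Np.opTrace_conjL_Q₀ σ.C, ← opTrace_smul, mul_assoc, neg_mul_neg, mul_assoc,
        smul_mul_assoc]
    rw [Valley.Phi₀, Valley.Phi₀, h, σ.pderivOp_neg, σ.pderivOp_neg, t, t]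
    ring
  rw [Valley.eulerAt, Valley.eulerAt,
    ← setIntegral_cell_comp_neg b (Nm.Phi₀_periodic orient_m km)]
  simp only [e]
  rw [integral_const_mul]
  ring

/-- The product of the normalizations of `Q_+(k)` and `Q_-(-k)` for valleys related by `C₂z`. -/
theorem channelPhase_eq (orient_m : Nm.Orientable) (kp km : Plane)
    (euler_p : Np.eulerNumber kp ≠ 0) (k : Plane) :
    Pairing.channelPhase Np Nm kp km k
      = (Np.sew k).det * (σ.U k : Matrix (Fin 2) (Fin 2) ℂ).det / 2 := by
  obtain ⟨r, hr, h⟩ := σ.exists_sign kp km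
  have hE := σ.eulerAt_eq orient_m h
  have hn : Nm.eulerNumber km = Np.eulerNumber kp := by
    have : ‖r‖ = 1 := by
      have := congrArg norm hr
      rw [norm_pow, norm_one] at this
      nlinarith [norm_nonneg r]
    rw [Valley.eulerNumber, hE, norm_mul, this, one_mul]; rfl
  have s := Np.eulerSign_sq kp euler_p
  rw [Pairing.channelPhase, σ.phase_neg h, hE, hn]
  have p := Np.phase_sq kp k
  -- Both the Euler sign and `r` occur squared: after normalization C₂z maps `Q_+` to `Q_-` with no
  -- sign ambiguity.
  calc _ = (Np.eulerAt kp / (Np.eulerNumber kp : ℂ)) ^ 2 * r ^ 2 * Np.phase kp k ^ 2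
        * (σ.U k : Matrix (Fin 2) (Fin 2) ℂ).det := by ring
    _ = _ := by rw [s, hr, p]; ring

theorem link_eq (k : Plane) : σ.link k
    = (Nm.sew (-k))ᴴ * (σ.U k : Matrix (Fin 2) (Fin 2) ℂ) := by
  ext c a
  simp only [link, Matrix.of_apply, σ.C_u, inner_sum, inner_smul_right, Nm.inner_C2T_u,
    Matrix.mul_apply]
  exact Finset.sum_congr rfl fun _ _ => mul_comm _ _

end C2zSymmetry

namespace Pairing

variable {D : Pairing Np Nm} {σ : C2zSymmetry Np Nm} {Δ₀ : ℂ}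

namespace IsUniformSWave

theorem Δ_eq (h : D.IsUniformSWave σ Δ₀) (k : Plane) : D.Δ k = Δ₀ • (σ.link k)ᴴ := by
  ext a c
  rw [h k a c, σ.C_C2T, Nm.inner_C2T_right, Matrix.smul_apply, Matrix.conjTranspose_apply,
    C2zSymmetry.link, Matrix.of_apply, RCLike.star_def, inner_conj_symm, smul_eq_mul]

theorem Δ_mul_conjTranspose (h : D.IsUniformSWave σ Δ₀) (k : Plane) :
    D.Δ k * (D.Δ k)ᴴ = ((‖Δ₀‖ ^ 2 : ℝ) : ℂ) • (1 : Matrix (Fin 2) (Fin 2) ℂ) := by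
  have hl : (σ.link k)ᴴ * σ.link k = 1 := mul_eq_one_comm.1 (link_mul_conjTranspose σ k)
  rw [h.Δ_eq, Matrix.conjTranspose_smul, Matrix.conjTranspose_conjTranspose,
    smul_mul_smul_comm, hl, RCLike.star_def, Complex.mul_conj, Complex.normSq_eq_norm_sq]

theorem trace_Δ (h : D.IsUniformSWave σ Δ₀) (k : Plane) :
    (D.Δ k * (D.Δ k)ᴴ).trace = ((‖Δ₀‖ ^ 2 + ‖Δ₀‖ ^ 2 : ℝ) : ℂ) := by
  rw [h.Δ_mul_conjTranspose, Matrix.trace_smul, Matrix.trace_one, Fintype.card_fin]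
  push_cast
  rw [smul_eq_mul]
  ring

theorem det_Δ (h : D.IsUniformSWave σ Δ₀) (k : Plane) :
    (D.Δ k * (D.Δ k)ᴴ).det = ((‖Δ₀‖ ^ 2 * ‖Δ₀‖ ^ 2 : ℝ) : ℂ) := by
  rw [h.Δ_mul_conjTranspose, Matrix.det_smul, Matrix.det_one, Fintype.card_fin]
  push_cast
  ring

/-- The unitary matrix `link†` satisfies the C₂z𝒯 reality condition by itself, so an invariant
multiple of it must have a real coefficient. -/
theorem conj_amplitude (h : D.IsUniformSWave σ Δ₀) : conj Δ₀ = Δ₀ := by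
  have h1 := D.sew_mul_conj 0
  have hX : Np.sew 0 * ((σ.link 0)ᴴ).map conj * (Nm.sew (-0))ᵀ = (σ.link 0)ᴴ := by
    have ht := congrArg Matrix.transpose (σ.U_mul_sew 0)
    rw [Matrix.transpose_mul, Matrix.transpose_mul, Np.sew_symm, Nm.sew_symm] at ht
    have hs : (Nm.sew (-0)).map conj = (Nm.sew (-0))ᴴ := by
      conv_rhs => rw [← Nm.sew_symm]
      rfl
    have hm : ((σ.link 0)ᴴ).map conj
        = (σ.U 0 : Matrix (Fin 2) (Fin 2) ℂ)ᵀ * (Nm.sew (-0))ᴴ := by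
      rw [σ.link_eq, Matrix.conjTranspose_mul, Matrix.conjTranspose_conjTranspose,
        Matrix.map_mul, hs]
      congr 1
      ext; simp
    rw [hm, Nm.sew_symm, σ.link_eq, Matrix.conjTranspose_mul, Matrix.conjTranspose_conjTranspose,
      ← mul_assoc, ht, mul_assoc, Nm.conjTranspose_sew_mul_sew, mul_one]
    rfl
  have e : (D.Δ 0).map conj = conj Δ₀ • ((σ.link 0)ᴴ).map conj := by
    ext; simp [h.Δ_eq]
  rw [e, mul_smul_comm, smul_mul_assoc, hX, h.Δ_eq] at h1
  rw [← sub_eq_zero, ← sub_smul] at h1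
  refine sub_eq_zero.1 ((smul_eq_zero.1 h1).resolve_right fun h0 => ?_)
  have := link_mul_conjTranspose σ 0
  rw [h0, Matrix.mul_zero] at this
  exact zero_ne_one this

/-- Both singular values equal `|Δ₀|`, so one channel vanishes; the phase from `channelPhase_eq`
gives `z = -|Δ₀|²`, and the minus sign selects `⊥`. -/
theorem absΔ_eq_norm (h : D.IsUniformSWave σ Δ₀) (orient_m : Nm.Orientable) (kp km : Plane)
    (euler_p : Np.eulerNumber kp ≠ 0) (euler_m : Nm.eulerNumber km ≠ 0) (k : Plane) :
    D.absΔ kp km .perp k = ‖Δ₀‖ ∧ D.absΔ kp km .par k = 0 := by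
  have hn : Δ₀ ^ 2 = ((‖Δ₀‖ ^ 2 : ℝ) : ℂ) := by
    have := Complex.mul_conj Δ₀
    rw [h.conj_amplitude, Complex.normSq_eq_norm_sq] at this
    rw [pow_two, this]
  have hz : -2 * conj (channelPhase Np Nm kp km k) * (D.Δ k).det = ((-‖Δ₀‖ ^ 2 : ℝ) : ℂ) := by
    have hd : (D.Δ k).det = Δ₀ ^ 2 * (conj (σ.U k : Matrix (Fin 2) (Fin 2) ℂ).det
        * (Nm.sew (-k)).det) := by
      rw [h.Δ_eq, Matrix.det_smul, Fintype.card_fin, σ.link_eq, Matrix.conjTranspose_mul,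
        Matrix.conjTranspose_conjTranspose, Matrix.det_mul, Matrix.det_conjTranspose]
      rfl
    have hc := congrArg (starRingEnd ℂ) (σ.det_sew_mul_sq k)
    rw [map_mul, map_pow] at hc
    rw [σ.channelPhase_eq orient_m kp km euler_p, hd, map_div₀, map_mul, map_ofNat, hn]
    have hu := Nm.det_sew_mul_conj (-k)
    push_cast
    linear_combination (-(‖Δ₀‖ : ℂ) ^ 2 * (Nm.sew (-k)).det) * hc - (‖Δ₀‖ : ℂ) ^ 2 * hu
  obtain ⟨e1, e2⟩ := D.absΔ_eq kp km euler_p euler_m k hz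
  rw [h.trace_Δ, Complex.ofReal_re] at e1 e2
  constructor
  · rw [e1, ← Real.sqrt_sq (norm_nonneg Δ₀)]
    congr 1
    rw [Real.sqrt_sq (norm_nonneg Δ₀)]
    ring
  · rw [e2, Real.sqrt_eq_zero']
    linarith

theorem pairEnergy_zero (h : D.IsUniformSWave σ Δ₀) (μ : ℝ) (k : Plane) :
    D.pairEnergy μ 0 k = 2 * Real.sqrt (μ ^ 2 + ‖Δ₀‖ ^ 2) := by
  rw [pairEnergy, block_zero, h.trace_Δ, h.det_Δ, Complex.ofReal_re, Complex.ofReal_re,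
    energy_eq μ (sq_nonneg _) (sq_nonneg _)]
  ring

theorem freeEnergy_zero (h : D.IsUniformSWave σ Δ₀) (flat_p : Np.Flat) (flat_m : Nm.Flat) (μ : ℝ) :
    D.freeEnergy μ 0 = 1 / (2 * Real.pi) ^ 2 * ((volume (cell b)).toReal
      * (-4 * Real.sqrt (μ ^ 2 + ‖Δ₀‖ ^ 2) - 4 * μ)) := by
  have e : D.pairEnergy μ 0 = fun _ => 2 * Real.sqrt (μ ^ 2 + ‖Δ₀‖ ^ 2) :=
    funext (h.pairEnergy_zero μ)
  rw [D.freeEnergy_eq flat_p flat_m μ 0 (by rw [e]; exact continuous_const)]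
  simp only [e]
  rw [setIntegral_const, smul_eq_mul, measureReal_def]
  ring

theorem hasDerivAt_freeEnergy (h : D.IsUniformSWave σ Δ₀) (flat_p : Np.Flat) (flat_m : Nm.Flat) {μ : ℝ} (hμ : μ ≠ 0) :
    HasDerivAt (fun μ' => D.freeEnergy μ' 0) (1 / (2 * Real.pi) ^ 2 * ((volume (cell b)).toReal
      * (-4 * (μ / Real.sqrt (μ ^ 2 + ‖Δ₀‖ ^ 2)) - 4))) μ := by
  have hp : 0 < μ ^ 2 + ‖Δ₀‖ ^ 2 := by positivity
  simp only [h.freeEnergy_zero flat_p flat_m]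
  have h1 : HasDerivAt (fun x : ℝ => Real.sqrt (x ^ 2 + ‖Δ₀‖ ^ 2))
      (μ / Real.sqrt (μ ^ 2 + ‖Δ₀‖ ^ 2)) μ := by
    have h2 := ((hasDerivAt_pow 2 μ).add_const (‖Δ₀‖ ^ 2)).sqrt hp.ne'
    refine h2.congr_deriv ?_
    rw [Nat.cast_ofNat, Nat.add_one_sub_one, pow_one, mul_div_mul_left _ _ two_ne_zero]
  have h3 := ((h1.const_mul (-4)).sub ((hasDerivAt_id μ).const_mul 4)).const_mul
    (volume (cell b)).toReal |>.const_mul (1 / (2 * Real.pi) ^ 2)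
  simpa using h3

/-- The zone volume cancels between particle number and number of states; `μ ≠ 0` keeps the square
root differentiable even for `Δ₀ = 0`. -/
theorem filling_eq (h : D.IsUniformSWave σ Δ₀) (flat_p : Np.Flat) (flat_m : Nm.Flat) {μ : ℝ} (hμ : μ ≠ 0) :
    D.filling μ = 1 / 2 * (1 + μ / Real.sqrt (μ ^ 2 + ‖Δ₀‖ ^ 2)) := by
  have hv : (volume (cell b)).toReal ≠ 0 :=
    ENNReal.toReal_ne_zero.2 ⟨ZSpan.measure_fundamentalDomain_ne_zero b,
      (isBounded_cell b).measure_lt_top.ne⟩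
  rw [filling, (h.hasDerivAt_freeEnergy flat_p flat_m hμ).deriv]
  have := Real.pi_pos
  field_simp
  ring

theorem two_mul_sqrt_filling (h : D.IsUniformSWave σ Δ₀) (flat_p : Np.Flat) (flat_m : Nm.Flat) {μ : ℝ} (hμ : μ ≠ 0) :
    0 ≤ D.filling μ ∧ D.filling μ ≤ 1 ∧
    2 * Real.sqrt (D.filling μ * (1 - D.filling μ)) = ‖Δ₀‖ / Real.sqrt (‖Δ₀‖ ^ 2 + μ ^ 2) := by
  have hp : 0 < ‖Δ₀‖ ^ 2 + μ ^ 2 := by positivity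
  rw [h.filling_eq flat_p flat_m hμ, add_comm (μ ^ 2)]
  have hE := Real.sqrt_pos.2 hp
  have hE2 := Real.sq_sqrt hp.le
  set E := Real.sqrt (‖Δ₀‖ ^ 2 + μ ^ 2)
  have hx : |μ / E| ≤ 1 := by
    rw [abs_div, abs_of_pos hE, div_le_one hE]
    refine abs_le_of_sq_le_sq ?_ hE.le
    rw [hE2]; linarith [sq_nonneg ‖Δ₀‖]
  obtain ⟨l, u⟩ := abs_le.1 hx
  refine ⟨by linarith, by linarith, ?_⟩
  -- The product is `¼(1 - μ²/E²)`, and `E² - μ² = |Δ₀|²`.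
  have e : 1 / 2 * (1 + μ / E) * (1 - 1 / 2 * (1 + μ / E)) = (‖Δ₀‖ / E / 2) ^ 2 := by
    have : ‖Δ₀‖ ^ 2 = E ^ 2 - μ ^ 2 := by linarith
    rw [div_pow, div_pow, this]
    field_simp
    ring
  rw [e, Real.sqrt_sq (by positivity)]
  ring

theorem average_boundDensity (h : D.IsUniformSWave σ Δ₀) (orient_m : Nm.Orientable) (kp km : Plane)
    (euler_p : Np.eulerNumber kp ≠ 0) (euler_m : Nm.eulerNumber km ≠ 0) (μ : ℝ) :
    Np.average (D.boundDensity kp km μ) = ‖Δ₀‖ ^ 2 / Real.sqrt (‖Δ₀‖ ^ 2 + μ ^ 2) := by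
  have e : ∀ k, D.boundDensity kp km μ k = ‖Δ₀‖ ^ 2 / Real.sqrt (‖Δ₀‖ ^ 2 + μ ^ 2) := fun k => by
    obtain ⟨h1, h2⟩ := h.absΔ_eq_norm orient_m kp km euler_p euler_m k
    rw [boundDensity, h1, h2, sub_zero]
  simp only [Valley.average, e]
  rw [integral_const_mul, mul_div_cancel_right₀ _ (Np.integral_metric_trace_pos kp euler_p).ne']

end IsUniformSWave

end Pairing

end FlatSC

/-! ### The theorem -/

theorem mainTheorem2
    (b : Module.Basis (Fin 2) ℝ FlatSC.Plane)
    {Hp Hm : Type*} [NormedAddCommGroup Hp] [InnerProductSpace ℂ Hp] [CompleteSpace Hp]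
    [NormedAddCommGroup Hm] [InnerProductSpace ℂ Hm] [CompleteSpace Hm]
    (Np : FlatSC.Valley b Hp) (Nm : FlatSC.Valley b Hm)
    (orient_p : Np.Orientable) (orient_m : Nm.Orientable)
    (kp km : FlatSC.Plane)
    (euler_p : Np.eulerNumber kp ≠ 0) (euler_m : Nm.eulerNumber km ≠ 0)
    (flat_p : Np.Flat) (flat_m : Nm.Flat)
    (σ : FlatSC.C2zSymmetry Np Nm)
    (D : FlatSC.Pairing Np Nm)
    (e μ : ℝ) (hμ : μ ≠ 0) :
    -- the second derivatives in the superfluid weight and the average exist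
    (ContDiff ℝ 2 (D.freeEnergy μ) ∧
      0 < ∫ k in FlatSC.cell b, (Np.metric k).trace ∧
      IntegrableOn (fun k => D.boundDensity kp km μ k * (Np.metric k).trace) (FlatSC.cell b)) ∧
    -- the lower bound
    4 * e ^ 2 / Real.pi * Np.eulerNumber kp * Np.average (D.boundDensity kp km μ)
      ≤ (D.superfluidWeight e μ).trace ∧
    -- uniform s-wave pairing
    (∀ Δ₀ : ℂ, D.IsUniformSWave σ Δ₀ →
      (∀ k, D.absΔ kp km .perp k = ‖Δ₀‖ ∧ D.absΔ kp km .par k = 0) ∧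
      DifferentiableAt ℝ (fun μ' => D.freeEnergy μ' 0) μ ∧
      0 ≤ D.filling μ ∧ D.filling μ ≤ 1 ∧
      4 * e ^ 2 / Real.pi * Np.eulerNumber kp * Np.average (D.boundDensity kp km μ)
        = 2 * Real.sqrt (D.filling μ * (1 - D.filling μ)) * ‖Δ₀‖
          * (4 * e ^ 2 / Real.pi * Np.eulerNumber kp) ∧
      2 * Real.sqrt (D.filling μ * (1 - D.filling μ)) * ‖Δ₀‖
          * (4 * e ^ 2 / Real.pi * Np.eulerNumber kp)
        ≤ (D.superfluidWeight e μ).trace) := by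
  have bound := D.le_trace_superfluidWeight σ flat_p flat_m kp km euler_p euler_m e hμ
  refine ⟨⟨D.contDiff_freeEnergy σ flat_p flat_m hμ, Np.integral_metric_trace_pos kp euler_p,
    D.integrableOn_boundDensity_mul σ kp km euler_p euler_m hμ⟩, bound, fun Δ₀ h => ?_⟩
  obtain ⟨f0, f1, f2⟩ := h.two_mul_sqrt_filling flat_p flat_m hμ
  have heq : 4 * e ^ 2 / Real.pi * Np.eulerNumber kp * Np.average (D.boundDensity kp km μ)
      = 2 * Real.sqrt (D.filling μ * (1 - D.filling μ)) * ‖Δ₀‖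
        * (4 * e ^ 2 / Real.pi * Np.eulerNumber kp) := by
    rw [f2, h.average_boundDensity orient_m kp km euler_p euler_m]
    ring
  exact ⟨h.absΔ_eq_norm orient_m kp km euler_p euler_m,
    (h.hasDerivAt_freeEnergy flat_p flat_m hμ).differentiableAt, f0, f1, heq, heq ▸ bound⟩
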